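/- **Setting.** Let $n\ge 2$, $\varrho>0$, $\mathbf J=\begin{pmatrix}0&1\\-1&0\end{pmatrix}$, $\boldsymbol\Omega=\mathrm{diag}(-k,1)$, and let $\mathbf e_1,\mathbf e_2$ be the standard basis of $\mathbb C^2$. Let $\boldsymbol\omega\in\mathbb R^{n-1}$ have rationally independent components with $|\boldsymbol\omega\cdot\mathbf s|^{-1}\le c_0|\mathbf s|^{n}$ for all $\mathbf s\in\mathbb Z^{n-1}\setminus\{0\}$, and put $\boldsymbol\partial=\boldsymbol\omega\cdot\nabla$. Let $H_0(\mathbf y,z_2)$, $(\mathbf y,z_2)\in\mathbb R^{n-1}\times\mathbb R$, be real-analytic near the origin with $\nabla_{\mathbf y}H_0(0,0)=\boldsymbol\omega$, $\partial_{z_2}H_0(0,0)=0$; set $\mathbf S_0=\partial^2_{\mathbf y}H_0(0,0)$, $\mathbf t_0=\nabla_{\mathbf y}\partial_{z_2}H_0(0,0)$, let $\mathbf T_0$ be the $2\times(n-1)$ matrix with rows $0$ and $\mathbf t_0^\top$, and assume that $\mathbf K_0=\mathbf S_0-\mathbf t_0\otimes\mathbf t_0$ is invertible. For $r>0$ and an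 integer $d\ge 0$ let $\mathcal A_{r,d}$ be the space of functions that are $2\pi$-periodic in each variable, continuous on the strip $\{\boldsymbol\xi\in\mathbb C^{n-1}:|\mathrm{Im}\,\xi_j|\le r\varrho\}$, holomorphic inside it, with finite norm $\|u\|_{r,d}=\max_{|\kappa|\le d}\sup|\partial^\kappa u|$; the notation is also used for vector and matrix functions, componentwise. Write $\overline f=(2\pi)^{1-n}\int_{\mathbb T^{n-1}}f\,d\boldsymbol\xi$, $f^*=f-\overline f$, and $|f|_s=\big(\sum_{m\in\mathbb Z^{n-1}}(1+|m|^2)^s|\hat f(m)|^2\big)^{1/2}$ with $\hat f(m)=(2\pi)^{-(n-1)/2}\int_{\mathbb T^{n-1}}e^{-im\cdot\boldsymbol\xi}f\,d\boldsymbol\xi$. Fix $\sigma\in(1/2,1]$, an integer $d\ge2$ and a constant $C_0$. For real $\alpha$, $\varepsilon$ and $k\in[0,1]$ consider a function $w_1$ and matrix functions $\mathbf W$ ($2\times2$), $\mathbf V$ ($(n-1)\times(n-1)$, invertible), $\mathbf S$ ($(n-1)\times(n-1)$), $\mathbf T$ ($2\times(n-1)$) such that $$\|\mathbf V^{-1}-\mathbf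 I\|_{\sigma/2,0}+\|w_1-\alpha\|_{\sigma/2,d}+\|\mathbf W-\mathbf I\|_{\sigma/2,d}\le C_0|\varepsilon|,\qquad \|\mathbf S-\mathbf S_0\|_{\sigma/2,d-1}+\|\mathbf T-\mathbf T_0\|_{\sigma/2,d-1}\le C_0|\varepsilon|,$$ all these differences belonging to the corresponding spaces $\mathcal A$. For given $g_1,\mathbf g_2,\gamma$ consider the problem for $(\boldsymbol\mu,\boldsymbol\lambda,\boldsymbol\chi)\in\mathcal A_{\sigma/4,0}$ (with values in $\mathbb C^{n-1}$, $\mathbb C^2$, $\mathbb C^{n-1}$) and $p\in\mathbb C$: $$\boldsymbol\partial\boldsymbol\mu=-p\nabla w_1-\nabla g_1,\qquad \mathbf J\boldsymbol\partial\boldsymbol\lambda+\boldsymbol\Omega\boldsymbol\lambda+\mathbf T\boldsymbol\mu+p\,\mathbf W^\top\mathbf e_1=\mathbf g_2,\qquad -\boldsymbol\partial\boldsymbol\chi+\mathbf S\boldsymbol\mu+\mathbf T^\top\boldsymbol\lambda=0,$$ $$\overline{\mathbf W\boldsymbol\lambda\cdot\mathbf e_1}+\overline{\boldsymbol\chi\cdot\nabla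 w_1}=\gamma,\qquad \overline{\mathbf V^{-\top}\boldsymbol\chi}=0.$$ *Problem (1)* is the case $g_1=0$, $\mathbf g_2=0$, $\gamma=1$; *Problem (2)* is the case $g_1=\tfrac12(w_1^*)^2$, $\mathbf g_2=-w_1^*\mathbf W^\top\mathbf e_1$, $\gamma=0$. **Theorem.** There are $c>0$ and $\varepsilon_1>0$, depending only on $n,\varrho,\boldsymbol\omega,c_0,H_0,\sigma,d,C_0$ (and not on $\alpha,k,\varepsilon$ or the coefficients), such that for every $\varepsilon_0\in(0,\varepsilon_1]$, every $|\varepsilon|\le\varepsilon_0$, all $\alpha\in\mathbb R$, $k\in[0,1]$ and all coefficients as above: (i) Problem (2) has a unique solution $(\boldsymbol\mu^{(2)},\boldsymbol\lambda^{(2)},\boldsymbol\chi^{(2)})\in\mathcal A_{\sigma/4,0}$, $p^{(2)}\in\mathbb C$, and $$\|\boldsymbol\mu^{(2)}\|_{\sigma/4,0}+\|\boldsymbol\lambda^{(2)}\|_{\sigma/4,0}+\|\boldsymbol\chi^{(2)}\|_{\sigma/4,0}+|p^{(2)}|\le c\|w_1^*\|_{\sigma/2,0},\qquad \|w_1^*\|_{\sigma/2,0}\le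 c|\varepsilon|,$$ $$|\boldsymbol\mu^{(2)}|_0\le c\,\varepsilon_0\,|w_1^*|_{-1},\qquad |\lambda^{(2)}_2|_0+|k|\,|\lambda^{(2)}_1|_0\ge c^{-1}|w_1^*|_{-1}.$$ (ii) Problem (1) has a unique solution $(\boldsymbol\mu^{(1)},\boldsymbol\lambda^{(1)},\boldsymbol\chi^{(1)})\in\mathcal A_{\sigma/4,0}$, $p^{(1)}\in\mathbb C$, and $$\|\boldsymbol\mu^{(1)}\|_{\sigma/4,0}+\|\boldsymbol\lambda^{(1)}\|_{\sigma/4,0}+\|\boldsymbol\chi^{(1)}\|_{\sigma/4,0}+|p^{(1)}|\le c.$$ If $k=0$, then with $\boldsymbol\mu_0=\mathbf K_0^{-1}\overline{\mathbf t_1}$, where $\mathbf t_1^\top$ is the first row of $\mathbf T$, there are a constant $\mathcal C\in\mathbb C$ and functions $\boldsymbol\mu_\varepsilon,\boldsymbol\lambda_\varepsilon$ with $$\boldsymbol\mu^{(1)}=-\boldsymbol\mu_0+\boldsymbol\mu_\varepsilon,\qquad \boldsymbol\lambda^{(1)}=\mathcal C\,\mathbf e_1+(\boldsymbol\mu_0\cdot\mathbf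 t_0)\,\mathbf e_2+\boldsymbol\lambda_\varepsilon,$$ $$|\mathcal C-1|\le c|\varepsilon|,\qquad \|\boldsymbol\mu_\varepsilon\|_{\sigma/4,0}+\|\boldsymbol\lambda_\varepsilon\|_{\sigma/4,0}\le c|\varepsilon|\,|\boldsymbol\mu_0|.$$ -/

import Mathlib

namespace JacobiTorus

noncomputable section

/-! ### Periodic analytic functions on a complex strip, and Sobolev norms -/

/-- The closed strip `|Im ξ_j| ≤ ρ` in `ℂ^N`. -/
def strip {N : ℕ} (ρ : ℝ) : Set (Fin N → ℂ) := {ξ | ∀ j, |(ξ j).im| ≤ ρ}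

/-- The open strip `|Im ξ_j| < ρ`. -/
def stripInt {N : ℕ} (ρ : ℝ) : Set (Fin N → ℂ) := {ξ | ∀ j, |(ξ j).im| < ρ}

/-- The partial derivative `∂f/∂ξ_j`. -/
def pd {N : ℕ} (j : Fin N) (f : (Fin N → ℂ) → ℂ) : (Fin N → ℂ) → ℂ :=
  fun ξ => fderiv ℂ f ξ (Pi.single j 1)

/-- The gradient `∇f`. -/
def grad {N : ℕ} (f : (Fin N → ℂ) → ℂ) : (Fin N → ℂ) → (Fin N → ℂ) :=
  fun ξ j => pd j f ξ

/-- The operator `ω · ∇`, acting on each component of a vector function. -/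
def dirD {N : ℕ} {ι : Type*} (ω : Fin N → ℝ) (u : (Fin N → ℂ) → (ι → ℂ)) :
    (Fin N → ℂ) → (ι → ℂ) :=
  fun ξ i => ∑ j, (ω j : ℂ) * pd j (fun ζ => u ζ i) ξ

/-- The norm `max_{|k| ≤ d} sup |∂^k f|` over the strip of half-width `ρ`, with values in
`[0,∞]`.  A list `[j₁, …, j_r]` stands for the derivative `∂_{j₁} ⋯ ∂_{j_r}`. The supremum is
over the open strip; for a function with derivatives continuous up to the boundary it is the
supremum over the closed one. -/
def nrm {N : ℕ} (ρ : ℝ) (d : ℕ) (f : (Fin N → ℂ) → ℂ) : ENNReal :=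
  ⨆ (l : List (Fin N)) (_ : l.length ≤ d) (ξ ∈ stripInt ρ), ‖(l.foldr pd f) ξ‖ₑ

/-- The space of functions on the closed strip of half-width `ρ`, `2π`-periodic in every variable,
continuous, holomorphic in the interior, and with finite norm of order `d`. -/
structure MemA {N : ℕ} (ρ : ℝ) (d : ℕ) (f : (Fin N → ℂ) → ℂ) : Prop where
  periodic : ∀ ξ ∈ strip ρ, ∀ j, f (ξ + Pi.single j (2 * (Real.pi : ℂ))) = f ξ
  continuousOn : ContinuousOn f (strip ρ)
  holomorphic : DifferentiableOn ℂ f (stripInt ρ)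
  finite : nrm ρ d f < ⊤

/-- Vector functions with all components in the space above, and their norm. -/
def MemAVec {N : ℕ} {ι : Type*} (ρ : ℝ) (d : ℕ) (u : (Fin N → ℂ) → (ι → ℂ)) : Prop :=
  ∀ i, MemA ρ d (fun ξ => u ξ i)

def nrmVec {N : ℕ} {ι : Type*} (ρ : ℝ) (d : ℕ) (u : (Fin N → ℂ) → (ι → ℂ)) : ENNReal :=
  ⨆ i, nrm ρ d (fun ξ => u ξ i)

/-- Matrix functions with all entries in the space above, and their norm. -/
def MemAMat {N : ℕ} {ι κ : Type*} (ρ : ℝ) (d : ℕ) (A : (Fin N → ℂ) → Matrix ι κ ℂ) : Prop :=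
  ∀ i j, MemA ρ d (fun ξ => A ξ i j)

def nrmMat {N : ℕ} {ι κ : Type*} (ρ : ℝ) (d : ℕ) (A : (Fin N → ℂ) → Matrix ι κ ℂ) : ENNReal :=
  ⨆ (i) (j), nrm ρ d (fun ξ => A ξ i j)

/-- The integral over the torus `(ℝ / 2πℤ)^N`. -/
def torusInt {N : ℕ} (f : (Fin N → ℂ) → ℂ) : ℂ :=
  ∫ x in Set.Icc (0 : Fin N → ℝ) (fun _ => 2 * Real.pi), f (fun j => (x j : ℂ))

/-- The mean value over the torus. -/
def mean {N : ℕ} (f : (Fin N → ℂ) → ℂ) : ℂ := (2 * (Real.pi : ℂ))⁻¹ ^ N * torusInt f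

/-- The deviation `f^* = f - mean f`. -/
def dev {N : ℕ} (f : (Fin N → ℂ) → ℂ) : (Fin N → ℂ) → ℂ := fun ξ => f ξ - mean f

/-- The Fourier coefficient `(2π)^{-N/2} ∫ e^{-i m·ξ} f(ξ) dξ`. -/
def fourierCoef {N : ℕ} (f : (Fin N → ℂ) → ℂ) (m : Fin N → ℤ) : ℂ :=
  (((2 * Real.pi) ^ (-(N : ℝ) / 2) : ℝ) : ℂ) *
    torusInt (fun ξ => Complex.exp (-Complex.I * ∑ j, (m j : ℂ) * ξ j) * f ξ)

/-- The square of the Sobolev norm, `∑_m (1+|m|²)^s |f̂(m)|²`. -/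
def sobSq {N : ℕ} (s : ℝ) (f : (Fin N → ℂ) → ℂ) : ENNReal :=
  ∑' m : Fin N → ℤ,
    ENNReal.ofReal ((1 + ∑ j, (m j : ℝ) ^ 2) ^ s * ‖fourierCoef f m‖ ^ 2)

/-- The Sobolev norm `|f|_s`. -/
def sob {N : ℕ} (s : ℝ) (f : (Fin N → ℂ) → ℂ) : ENNReal := sobSq s f ^ (1 / 2 : ℝ)

/-- The Sobolev norm of a vector function. -/
def sobVec {N : ℕ} {ι : Type*} [Fintype ι] (s : ℝ) (u : (Fin N → ℂ) → (ι → ℂ)) : ENNReal :=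
  (∑ i, sobSq s (fun ξ => u ξ i)) ^ (1 / 2 : ℝ)

/-! ### The unperturbed Hamiltonian and the frequency vector -/

/-- The frequency vector is rationally independent and satisfies
`|ω·s|⁻¹ ≤ c₀ |s|^n` for all nonzero integer vectors `s` (with `n - 1` components). -/
def Diophantine (n : ℕ) (ω : Fin (n - 1) → ℝ) (c₀ : ℝ) : Prop :=
  ∀ s : Fin (n - 1) → ℤ, s ≠ 0 →
    (∑ j, ω j * (s j : ℝ)) ≠ 0 ∧
    |∑ j, ω j * (s j : ℝ)|⁻¹ ≤ c₀ * Real.sqrt (∑ j, (s j : ℝ) ^ 2) ^ n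

/-- `S₀ = ∂²H₀/∂y²` at the origin, for `H₀ = H₀(y, z₂)`. -/
def S0 {N : ℕ} (H₀ : (Fin N → ℝ) × ℝ → ℝ) : Matrix (Fin N) (Fin N) ℝ :=
  Matrix.of fun i j =>
    fderiv ℝ (fun q => fderiv ℝ H₀ q (Pi.single j 1, 0)) 0 (Pi.single i 1, 0)

/-- `t₀ = ∇_y ∂_{z₂} H₀` at the origin. -/
def t0 {N : ℕ} (H₀ : (Fin N → ℝ) × ℝ → ℝ) : Fin N → ℝ :=
  fun j => fderiv ℝ (fun q => fderiv ℝ H₀ q (0, 1)) 0 (Pi.single j 1, 0)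

/-- `T₀ = ∂²H₀/∂z∂y` at the origin, with `z = (z₁, z₂)`; `H₀` does not depend on `z₁`. -/
def T0 {N : ℕ} (H₀ : (Fin N → ℝ) × ℝ → ℝ) : Matrix (Fin 2) (Fin N) ℝ :=
  Matrix.of ![0, t0 H₀]

/-- `K₀ = S₀ - t₀ ⊗ t₀`. -/
def K0 {N : ℕ} (H₀ : (Fin N → ℝ) × ℝ → ℝ) : Matrix (Fin N) (Fin N) ℝ :=
  S0 H₀ - Matrix.vecMulVec (t0 H₀) (t0 H₀)

/-! ### The linear problems -/

/-- The coefficients `w₁, W, V, S, T` of the linear problems. -/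
structure Coeffs (N : ℕ) where
  w₁ : (Fin N → ℂ) → ℂ
  W : (Fin N → ℂ) → Matrix (Fin 2) (Fin 2) ℂ
  V : (Fin N → ℂ) → Matrix (Fin N) (Fin N) ℂ
  S : (Fin N → ℂ) → Matrix (Fin N) (Fin N) ℂ
  T : (Fin N → ℂ) → Matrix (Fin 2) (Fin N) ℂ

/-- The coefficients are `O(ε)`-close, on the strip of half-width `ρ`, to the unperturbed ones
`w₁ = α`, `W = I`, `V = I`, `S = S₀`, `T = T₀`. -/
structure Admissible {N : ℕ} (H₀ : (Fin N → ℝ) × ℝ → ℝ) (ρ : ℝ) (d : ℕ) (C₀ ε α : ℝ)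
    (D : Coeffs N) : Prop where
  mem_w₁ : MemA ρ d (fun ξ => D.w₁ ξ - (α : ℂ))
  mem_W : MemAMat ρ d (fun ξ => D.W ξ - 1)
  isUnit_V : ∀ ξ ∈ strip ρ, IsUnit (D.V ξ).det
  mem_V : MemAMat ρ 0 (fun ξ => (D.V ξ)⁻¹ - 1)
  mem_S : MemAMat ρ (d - 1) (fun ξ => D.S ξ - (S0 H₀).map Complex.ofReal)
  mem_T : MemAMat ρ (d - 1) (fun ξ => D.T ξ - (T0 H₀).map Complex.ofReal)
  bound_VwW :
    nrmMat ρ 0 (fun ξ => (D.V ξ)⁻¹ - 1) + nrm ρ d (fun ξ => D.w₁ ξ - (α : ℂ))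
      + nrmMat ρ d (fun ξ => D.W ξ - 1) ≤ ENNReal.ofReal (C₀ * |ε|)
  bound_ST :
    nrmMat ρ (d - 1) (fun ξ => D.S ξ - (S0 H₀).map Complex.ofReal)
      + nrmMat ρ (d - 1) (fun ξ => D.T ξ - (T0 H₀).map Complex.ofReal)
      ≤ ENNReal.ofReal (C₀ * |ε|)

/-- The basis vectors of `ℂ²`. -/
def e₁ : Fin 2 → ℂ := ![1, 0]
def e₂ : Fin 2 → ℂ := ![0, 1]

/-- The symplectic matrix `J`. -/
def J : Matrix (Fin 2) (Fin 2) ℂ := !![0, 1; -1, 0]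

/-- `Ω = diag(-k, 1)`. -/
def Om (k : ℝ) : Matrix (Fin 2) (Fin 2) ℂ := !![-(k : ℂ), 0; 0, 1]

/-- A solution `(μ, λ, χ, p)` of the linear system with right-hand sides `g₁`, `g₂`, `γ`, in the
space of functions analytic on the strip of half-width `ρ`. -/
structure IsSolution {N : ℕ} (ω : Fin N → ℝ) (k : ℝ) (D : Coeffs N) (ρ : ℝ)
    (g₁ : (Fin N → ℂ) → ℂ) (g₂ : (Fin N → ℂ) → (Fin 2 → ℂ)) (γ : ℂ)
    (μ : (Fin N → ℂ) → (Fin N → ℂ)) (lam : (Fin N → ℂ) → (Fin 2 → ℂ))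
    (χ : (Fin N → ℂ) → (Fin N → ℂ)) (p : ℂ) : Prop where
  mem_μ : MemAVec ρ 0 μ
  mem_lam : MemAVec ρ 0 lam
  mem_χ : MemAVec ρ 0 χ
  eq_μ : ∀ ξ ∈ stripInt ρ, dirD ω μ ξ = - (p • grad D.w₁ ξ) - grad g₁ ξ
  eq_lam : ∀ ξ ∈ stripInt ρ,
    J.mulVec (dirD ω lam ξ) + (Om k).mulVec (lam ξ) + (D.T ξ).mulVec (μ ξ)
      + p • (D.W ξ).transpose.mulVec e₁ = g₂ ξ
  eq_χ : ∀ ξ ∈ stripInt ρ,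
    - dirD ω χ ξ + (D.S ξ).mulVec (μ ξ) + (D.T ξ).transpose.mulVec (lam ξ) = 0
  mean_lam :
    mean (fun ξ => dotProduct ((D.W ξ).mulVec (lam ξ)) e₁)
      + mean (fun ξ => dotProduct (χ ξ) (grad D.w₁ ξ)) = γ
  mean_χ : ∀ i, mean (fun ξ => ((D.V ξ)⁻¹.transpose.mulVec (χ ξ)) i) = 0

/-- The first Jacobi-field problem (zero right-hand sides, normalisation `γ = 1`). -/
def IsSolution₁ {N : ℕ} (ω : Fin N → ℝ) (k : ℝ) (D : Coeffs N) (ρ : ℝ)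
    (μ : (Fin N → ℂ) → (Fin N → ℂ)) (lam : (Fin N → ℂ) → (Fin 2 → ℂ))
    (χ : (Fin N → ℂ) → (Fin N → ℂ)) (p : ℂ) : Prop :=
  IsSolution ω k D ρ (fun _ => 0) (fun _ => 0) 1 μ lam χ p

/-- The second Jacobi-field problem: right-hand sides `-½ ∇(w₁^*)²`, `-w₁^* Wᵀ e₁`, and `γ = 0`. -/
def IsSolution₂ {N : ℕ} (ω : Fin N → ℝ) (k : ℝ) (D : Coeffs N) (ρ : ℝ)
    (μ : (Fin N → ℂ) → (Fin N → ℂ)) (lam : (Fin N → ℂ) → (Fin 2 → ℂ))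
    (χ : (Fin N → ℂ) → (Fin N → ℂ)) (p : ℂ) : Prop :=
  IsSolution ω k D ρ (fun ξ => 1 / 2 * (dev D.w₁ ξ) ^ 2)
    (fun ξ => - (dev D.w₁ ξ • (D.W ξ).transpose.mulVec e₁)) 0 μ lam χ p

/-- `μ₀ = K₀⁻¹ t̄₁`, where `t̄₁` is the mean value of the first row of `T`. -/
def mu0 {N : ℕ} (H₀ : (Fin N → ℝ) × ℝ → ℝ) (D : Coeffs N) : Fin N → ℂ :=
  ((K0 H₀).map Complex.ofReal)⁻¹.mulVec (fun j => mean (fun ξ => D.T ξ 0 j))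

/-- The Euclidean norm of a vector in `ℂ^N`. -/
def vabs {N : ℕ} (v : Fin N → ℂ) : ℝ := Real.sqrt (∑ j, ‖v j‖ ^ 2)

end

end JacobiTorus

open JacobiTorus

namespace JacobiTorus

noncomputable section

open MeasureTheory Set Filter Topology
open scoped Pointwise

variable {N : ℕ}

/-! ### Fourier coefficients on the torus -/

-- Everything is done in Fourier variables. Fix the constants `X = (m, p, b, x)`, where `m`, `b`,
-- `x` are the means of `μ`, of the first component of `λ`, and of `χ`. At every nonzero frequency
-- `s` the equations are then solved explicitly: `μ` and `χ` by division by `i ω·s`, and `λ` by a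
-- 2×2 block of determinant `(ω·s)² + k`, which is positive for every `k ≥ 0`. The Diophantine
-- condition makes the inverse divisors subexponential, so each inversion costs an arbitrarily small
-- amount of exponential decay, that is, of strip width. What remains are the zero modes of the
-- `χ`-equation and of the first `λ`-equation together with the two normalisation conditions,
-- collected in the residual `R = (q, r, γ, y)`. For zero sources `X ↦ R` is a linear map between
-- spaces of the same finite dimension.
--
-- At `ε = 0` this map is `q = K₀ m`, `r = p - k b`, `γ = b`, `y = x`. The matrix `K₀ = S₀ - t₀ ⊗
-- t₀` appears because the second `λ`-equation forces the mean of `λ₂` to be `-t₀·m`. The map is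
-- invertible uniformly in `k ∈ [0,1]`, and for general coefficients it changes by `O(ε)`. Hence
-- `‖X‖ ≤ C (‖R‖ + ε ‖X‖ + sources)` (`full_estimate`), small `ε` absorbs the middle term
-- (`hom_estimate`), and injectivity in finite dimension gives existence (`exists_Full_residual`)
-- and uniqueness (`exists_unique_solution`).
--
-- Uniformity of the constants is obtained by proving all estimates for families. `Bd r A f` says
-- that the Fourier coefficients of the family `f i` are at most `K (A i) e^{-r|s|}` with one
-- constant `K`; the rate `r` may be negative. Taking all admissible data as the index set turns
-- such a statement into a bound uniform in `α`, `k`, `ε` and the coefficients.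
--
-- For Problem (2) the source estimate `src_estimate` is used twice. With a positive rate and
-- amplitude the sup norm of `w₁*` it gives the analytic bounds. With a slightly negative rate and
-- amplitude `|w₁*|_{-1}` it shows that the constants are `O(ε |w₁*|_{-1})`; combined with the mixed
-- bound `Bd.sq` for the square of `w₁*` this gives the estimate of `μ`. The lower bound comes from
-- solving the first `λ`-equation for `w₁*`: in `H⁻¹` the remaining terms are `O(ε)|w₁*|_{-1}` and
-- are absorbed (`src_sob_estimate`).
--
-- For Problem (1) with `k = 0`, the multiple `b e₁` can be subtracted from `λ` without changing the
-- `(μ, λ)`-system. Then `p = O(ε(|m| + |p|))`, and the mean of the `χ`-equation reads `K₀ m + b t̄₁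
-- = O(ε |m|)` with `b = 1 + O(ε)`. So `m` equals `-μ₀` up to an error relative to `|μ₀|`
-- (`first_problem_k_zero`).

local instance : MeasureSpace UnitAddCircle := ⟨AddCircle.haarAddCircle⟩

local instance : IsProbabilityMeasure (volume : Measure UnitAddCircle) :=
  inferInstanceAs (IsProbabilityMeasure AddCircle.haarAddCircle)

/-- A real point of `ℂ^N`. -/
def realPt (x : Fin N → ℝ) : Fin N → ℂ := fun j => (x j : ℂ)

/-- Functions whose restriction to the real torus is continuous and `2π`-periodic. -/
structure TC (f : (Fin N → ℂ) → ℂ) : Prop where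
  cont : Continuous (fun x : Fin N → ℝ => f (realPt x))
  per : ∀ (x : Fin N → ℝ) j, f (realPt x + Pi.single j (2 * (Real.pi : ℂ))) = f (realPt x)

/-- The character `e^{i s·ξ}`. -/
def chr (s : Fin N → ℤ) (ξ : Fin N → ℂ) : ℂ := Complex.exp (Complex.I * ∑ j, (s j : ℂ) * ξ j)

/-- Fourier coefficients, normalised so that `f = ∑ fc f s · chr s`. -/
def fc (f : (Fin N → ℂ) → ℂ) (s : Fin N → ℤ) : ℂ := mean (fun ξ => chr (-s) ξ * f ξ)

/-- The trigonometric series with coefficients `a`. -/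
def Ser (a : (Fin N → ℤ) → ℂ) (ξ : Fin N → ℂ) : ℂ := ∑' s, a s * chr s ξ

theorem TC.periodic {f : (Fin N → ℂ) → ℂ} (hf : TC f) (x : Fin N → ℝ) (s : Fin N → ℤ) :
    f (realPt (x + fun j => 2 * Real.pi * s j)) = f (realPt x) := by
  set g : (Fin N → ℝ) → ℂ := fun x => f (realPt x) with hg
  have h1 : ∀ j, Function.Periodic g (Pi.single j (2 * Real.pi)) := by
    intro j y
    have := hf.per y j
    simp only [hg]
    rw [← this]
    congr 1
    ext i
    by_cases h : i = j
    · subst h; simp [realPt]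
    · simp [realPt, h]
  have h2 : ∀ t : Finset (Fin N),
      Function.Periodic g (∑ j ∈ t, s j • (Pi.single j (2 * Real.pi) : Fin N → ℝ)) := by
    intro t
    induction t using Finset.induction_on with
    | empty => intro y; simp
    | insert a t ha ih =>
      rw [Finset.sum_insert ha]
      exact ((h1 a).zsmul (s a)).add_period ih
  have h3 := h2 Finset.univ x
  have : (∑ j, s j • (Pi.single j (2 * Real.pi) : Fin N → ℝ)) = fun j => 2 * Real.pi * s j := by
    ext i
    simp [Finset.sum_apply, Pi.single_apply, mul_comm]
  rw [this] at h3
  exact h3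

/-- The continuous function on the unit torus induced by a periodic function. -/
theorem TC.exists_lift {f : (Fin N → ℂ) → ℂ} (hf : TC f) :
    ∃ F : C(UnitAddTorus (Fin N), ℂ), ∀ x : Fin N → ℝ,
      F (fun i => (x i : UnitAddCircle)) = f (realPt (fun i => 2 * Real.pi * x i)) := by
  -- Products of quotient maps need not be quotient maps; openness is the property that passes to
  -- the product.
  have hq : IsOpenQuotientMap (Pi.map (fun (_ : Fin N) (y : ℝ) => (y : UnitAddCircle))) :=
    IsOpenQuotientMap.piMap fun _ => QuotientAddGroup.isOpenQuotientMap_mk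
  let g : C(Fin N → ℝ, ℂ) := ⟨fun x => f (realPt (fun i => 2 * Real.pi * x i)),
    hf.cont.comp (by fun_prop)⟩
  have hg : Function.FactorsThrough g
      (⟨_, hq.continuous⟩ : C(Fin N → ℝ, UnitAddTorus (Fin N))) := by
    intro x y hxy
    have h1 : ∀ i, ∃ n : ℤ, y i - x i = n := by
      intro i
      have h2 : (x i : UnitAddCircle) = (y i : UnitAddCircle) := congrFun hxy i
      rw [QuotientAddGroup.eq, AddSubgroup.mem_zmultiples_iff] at h2
      obtain ⟨n, hn⟩ := h2
      exact ⟨n, by simp at hn; linarith⟩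
    choose n hn using h1
    have h3 := hf.periodic (fun i => 2 * Real.pi * x i) n
    change f _ = f _
    rw [← h3]
    congr 1
    ext i
    have := hn i
    simp only [realPt, Pi.add_apply]
    congr 1
    linear_combination (-2 * Real.pi) * this
  refine ⟨IsQuotientMap.lift (f := ⟨_, hq.continuous⟩) hq.isQuotientMap g hg, fun x => ?_⟩
  have := IsQuotientMap.lift_comp (f := ⟨_, hq.continuous⟩) hq.isQuotientMap g hg
  exact DFunLike.congr_fun this x

/-- A dilation by `2π` brings the cube to the half-open unit cell used by
`UnitAddTorus.integral_preimage`. Since only scaling and a null set are involved, no regularity of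
`f` is required. -/
theorem mean_eq_integral (f : (Fin N → ℂ) → ℂ) :
    mean f = ∫ x in {x : Fin N → ℝ | ∀ i, x i ∈ Ioc (0 : ℝ) (0 + 1)},
      f (realPt (fun i => 2 * Real.pi * x i)) := by
  have hpi : (0 : ℝ) < 2 * Real.pi := by positivity
  have h1 : ∫ x in {x : Fin N → ℝ | ∀ i, x i ∈ Ioc (0 : ℝ) (0 + 1)},
      f (realPt (fun i => 2 * Real.pi * x i)) =
      ∫ x in Icc (0 : Fin N → ℝ) 1, f (realPt ((2 * Real.pi) • x)) := by
    have : {x : Fin N → ℝ | ∀ i, x i ∈ Ioc (0 : ℝ) (0 + 1)} =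
        Set.pi univ (fun i => Ioc ((0 : Fin N → ℝ) i) ((1 : Fin N → ℝ) i)) := by
      ext x; simp [Set.mem_pi]
    rw [this, volume_pi, setIntegral_congr_set Measure.univ_pi_Ioc_ae_eq_Icc]
    rfl
  rw [h1, Measure.setIntegral_comp_smul_of_pos volume (fun y => f (realPt y)) _ hpi]
  have h2 : (2 * Real.pi) • Icc (0 : Fin N → ℝ) 1 =
      Icc (0 : Fin N → ℝ) (fun _ => 2 * Real.pi) := by
    ext y
    rw [Set.mem_smul_set_iff_inv_smul_mem₀ hpi.ne']
    simp only [Set.mem_Icc, Pi.le_def, Pi.smul_apply, smul_eq_mul, Pi.zero_apply, Pi.one_apply]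
    constructor
    · rintro ⟨h3, h4⟩
      refine ⟨fun i => ?_, fun i => ?_⟩
      · have := h3 i
        rwa [mul_nonneg_iff_of_pos_left (inv_pos.2 hpi)] at this
      · have := h4 i
        rwa [inv_mul_le_iff₀ hpi, mul_one] at this
    · rintro ⟨h3, h4⟩
      refine ⟨fun i => mul_nonneg (inv_pos.2 hpi).le (h3 i), fun i => ?_⟩
      rw [inv_mul_le_iff₀ hpi, mul_one]; exact h4 i
  rw [h2, mean, torusInt]
  rw [Complex.real_smul, inv_pow, Module.finrank_fin_fun]
  push_cast
  rfl

theorem TC.mean_eq {f : (Fin N → ℂ) → ℂ} {F : C(UnitAddTorus (Fin N), ℂ)}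
    (hF : ∀ x : Fin N → ℝ,
      F (fun i => (x i : UnitAddCircle)) = f (realPt (fun i => 2 * Real.pi * x i))) :
    mean f = ∫ t, F t := by
  rw [mean_eq_integral, UnitAddTorus.integral_preimage F (fun _ => 0)]
  simp only [hF]

/-- Translation invariance of the mean. -/
theorem TC.mean_translate {f : (Fin N → ℂ) → ℂ} (hf : TC f) (a : Fin N → ℝ) :
    mean (fun ξ => f (ξ + realPt a)) = mean f := by
  obtain ⟨F, hF⟩ := hf.exists_lift
  -- The same torus integral is read off in the cell with corner `a / 2π`, which is then translated
  -- back to the unit cell.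
  rw [TC.mean_eq hF, mean_eq_integral, UnitAddTorus.integral_preimage F (fun i => a i / (2 * Real.pi))]
  simp only [hF]
  have hmp : MeasurePreserving (fun x : Fin N → ℝ => x + fun i => a i / (2 * Real.pi)) volume volume :=
    measurePreserving_add_right volume _
  rw [← hmp.setIntegral_preimage_emb (MeasurableEquiv.addRight _).measurableEmbedding
    (fun x => f (realPt (fun i => 2 * Real.pi * x i)))]
  have : (fun x : Fin N → ℝ => x + fun i => a i / (2 * Real.pi)) ⁻¹'
      {x : Fin N → ℝ | ∀ i, x i ∈ Ioc (a i / (2 * Real.pi)) (a i / (2 * Real.pi) + 1)} =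
      {x : Fin N → ℝ | ∀ i, x i ∈ Ioc (0 : ℝ) (0 + 1)} := by
    ext x
    simp only [mem_preimage, mem_ofPred_eq, Pi.add_apply, mem_Ioc]
    refine forall_congr' fun i => ?_
    constructor <;> rintro ⟨h1, h2⟩ <;> constructor <;> linarith
  rw [this]
  congr 1
  ext x
  congr 1
  ext i
  simp only [realPt, Pi.add_apply]
  have : (Real.pi : ℂ) ≠ 0 := by exact_mod_cast Real.pi_ne_zero
  push_cast
  field_simp

/-! Closure properties. -/

theorem TC.const (c : ℂ) : TC (fun _ : Fin N → ℂ => c) := ⟨continuous_const, fun _ _ => rfl⟩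

theorem TC.add {f g : (Fin N → ℂ) → ℂ} (hf : TC f) (hg : TC g) : TC (fun ξ => f ξ + g ξ) :=
  ⟨hf.cont.add hg.cont, fun x j => by simp only [hf.per, hg.per]⟩

theorem TC.sub {f g : (Fin N → ℂ) → ℂ} (hf : TC f) (hg : TC g) : TC (fun ξ => f ξ - g ξ) :=
  ⟨hf.cont.sub hg.cont, fun x j => by simp only [hf.per, hg.per]⟩

theorem TC.mul {f g : (Fin N → ℂ) → ℂ} (hf : TC f) (hg : TC g) : TC (fun ξ => f ξ * g ξ) :=
  ⟨hf.cont.mul hg.cont, fun x j => by simp only [hf.per, hg.per]⟩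

theorem TC.neg {f : (Fin N → ℂ) → ℂ} (hf : TC f) : TC (fun ξ => -f ξ) :=
  ⟨hf.cont.neg, fun x j => by simp only [hf.per]⟩

theorem TC.sum {ι : Type*} (t : Finset ι) {f : ι → (Fin N → ℂ) → ℂ} (hf : ∀ i, TC (f i)) :
    TC (fun ξ => ∑ i ∈ t, f i ξ) :=
  ⟨continuous_finsetSum _ fun i _ => (hf i).cont,
    fun x j => Finset.sum_congr rfl fun i _ => (hf i).per x j⟩

/-! ### Characters and their modulus off the real torus. -/

theorem chr_add_single (s : Fin N → ℤ) (ξ : Fin N → ℂ) (j : Fin N) :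
    chr s (ξ + Pi.single j (2 * (Real.pi : ℂ))) = chr s ξ := by
  unfold chr
  rw [Complex.exp_eq_exp_iff_exists_int]
  refine ⟨s j, ?_⟩
  simp only [Pi.add_apply, mul_add, Finset.sum_add_distrib, Pi.single_apply]
  simp
  ring

theorem chr_continuous (s : Fin N → ℤ) : Continuous (chr s) := by
  unfold chr; fun_prop

theorem realPt_continuous : Continuous (realPt : (Fin N → ℝ) → (Fin N → ℂ)) := by
  unfold realPt; fun_prop

theorem tc_chr (s : Fin N → ℤ) : TC (chr s) :=
  ⟨(chr_continuous s).comp realPt_continuous, fun _ j => chr_add_single s _ j⟩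

theorem chr_zero (ξ : Fin N → ℂ) : chr 0 ξ = 1 := by simp [chr]

theorem chr_add (s t : Fin N → ℤ) (ξ : Fin N → ℂ) : chr (s + t) ξ = chr s ξ * chr t ξ := by
  simp only [chr, ← Complex.exp_add, ← mul_add, ← Finset.sum_add_distrib]
  congr 2
  refine Finset.sum_congr rfl fun j _ => ?_
  simp; ring

theorem chr_apply_add (s : Fin N → ℤ) (ξ η : Fin N → ℂ) : chr s (ξ + η) = chr s ξ * chr s η := by
  simp only [chr, ← Complex.exp_add, ← mul_add, ← Finset.sum_add_distrib]
  rfl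

theorem norm_chr (s : Fin N → ℤ) (ξ : Fin N → ℂ) :
    ‖chr s ξ‖ = Real.exp (-∑ j, (s j : ℝ) * (ξ j).im) := by
  rw [chr, Complex.norm_exp]
  congr 1
  rw [Complex.I_mul_re]
  simp [Complex.im_sum, Complex.mul_im]

theorem norm_chr_realPt (s : Fin N → ℤ) (x : Fin N → ℝ) : ‖chr s (realPt x)‖ = 1 := by
  rw [norm_chr]; simp [realPt]

/-! ### Linearity and bounds for means and Fourier coefficients. -/

theorem torusInt_integrable {f : (Fin N → ℂ) → ℂ} (hf : TC f) :
    IntegrableOn (fun x : Fin N → ℝ => f (fun j => (x j : ℂ)))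
      (Set.Icc (0 : Fin N → ℝ) (fun _ => 2 * Real.pi)) :=
  hf.cont.continuousOn.integrableOn_compact isCompact_Icc

theorem mean_add {f g : (Fin N → ℂ) → ℂ} (hf : TC f) (hg : TC g) :
    mean (fun ξ => f ξ + g ξ) = mean f + mean g := by
  simp only [mean, torusInt]
  rw [integral_add (torusInt_integrable hf) (torusInt_integrable hg), mul_add]

theorem mean_const_mul (c : ℂ) (f : (Fin N → ℂ) → ℂ) :
    mean (fun ξ => c * f ξ) = c * mean f := by
  simp only [mean, torusInt]
  rw [integral_const_mul]; ring

theorem mean_neg (f : (Fin N → ℂ) → ℂ) : mean (fun ξ => -f ξ) = -mean f := by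
  simpa using mean_const_mul (-1) f

theorem mean_sub {f g : (Fin N → ℂ) → ℂ} (hf : TC f) (hg : TC g) :
    mean (fun ξ => f ξ - g ξ) = mean f - mean g := by
  simp only [sub_eq_add_neg]
  rw [mean_add hf hg.neg, mean_neg]

theorem mean_const (c : ℂ) : mean (fun _ : Fin N → ℂ => c) = c := by
  rw [mean_eq_integral]
  have := UnitAddTorus.integral_preimage (d := Fin N) (fun _ => c) (fun _ => 0)
  rw [← this]
  simp

theorem mean_sum {ι : Type*} (t : Finset ι) {f : ι → (Fin N → ℂ) → ℂ} (hf : ∀ i, TC (f i)) :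
    mean (fun ξ => ∑ i ∈ t, f i ξ) = ∑ i ∈ t, mean (f i) := by
  classical
  induction t using Finset.induction_on with
  | empty => simpa using mean_const (N := N) 0
  | insert a t ha ih =>
    simp only [Finset.sum_insert ha]
    rw [mean_add (hf a) (TC.sum t hf), ih]

theorem mean_congr {f g : (Fin N → ℂ) → ℂ} (h : ∀ x, f (realPt x) = g (realPt x)) :
    mean f = mean g := by
  simp only [mean, torusInt]
  congr 2
  ext x
  exact h x

theorem norm_mean_le {f : (Fin N → ℂ) → ℂ} {M : ℝ} (h : ∀ x, ‖f (realPt x)‖ ≤ M) :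
    ‖mean f‖ ≤ M := by
  rw [mean, torusInt, norm_mul]
  have h1 := norm_setIntegral_le_of_norm_le_const (μ := volume) (C := M)
    (s := Set.Icc (0 : Fin N → ℝ) (fun _ => 2 * Real.pi))
    (f := fun x : Fin N → ℝ => f (fun j => (x j : ℂ))) isCompact_Icc.measure_lt_top
    (fun x _ => h x)
  have h2 : volume.real (Set.Icc (0 : Fin N → ℝ) (fun _ => 2 * Real.pi)) = (2 * Real.pi) ^ N := by
    rw [measureReal_def, Real.volume_Icc_pi_toReal]
    · simp
    · intro i; simp [Real.pi_pos.le]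
  rw [h2] at h1
  have h3 : ‖(2 * (Real.pi : ℂ))⁻¹ ^ N‖ = ((2 * Real.pi) ^ N)⁻¹ := by
    simp [abs_of_pos Real.pi_pos, ← inv_pow]
  rw [h3]
  calc _ ≤ ((2 * Real.pi) ^ N)⁻¹ * (M * (2 * Real.pi) ^ N) := by gcongr
    _ = M := by
      have : (2 * Real.pi) ^ N ≠ 0 := by positivity
      field_simp

theorem fc_add {f g : (Fin N → ℂ) → ℂ} (hf : TC f) (hg : TC g) (s : Fin N → ℤ) :
    fc (fun ξ => f ξ + g ξ) s = fc f s + fc g s := by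
  simp only [fc, mul_add]
  exact mean_add ((tc_chr _).mul hf) ((tc_chr _).mul hg)

theorem fc_sub {f g : (Fin N → ℂ) → ℂ} (hf : TC f) (hg : TC g) (s : Fin N → ℤ) :
    fc (fun ξ => f ξ - g ξ) s = fc f s - fc g s := by
  simp only [fc, mul_sub]
  exact mean_sub ((tc_chr _).mul hf) ((tc_chr _).mul hg)

theorem fc_const_mul (c : ℂ) (f : (Fin N → ℂ) → ℂ) (s : Fin N → ℤ) :
    fc (fun ξ => c * f ξ) s = c * fc f s := by
  simp only [fc, ← mean_const_mul]
  congr 1; ext ξ; ring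

theorem fc_neg (f : (Fin N → ℂ) → ℂ) (s : Fin N → ℤ) : fc (fun ξ => -f ξ) s = -fc f s := by
  simpa using fc_const_mul (-1) f s

theorem fc_sum {ι : Type*} (t : Finset ι) {f : ι → (Fin N → ℂ) → ℂ} (hf : ∀ i, TC (f i))
    (s : Fin N → ℤ) : fc (fun ξ => ∑ i ∈ t, f i ξ) s = ∑ i ∈ t, fc (f i) s := by
  simp only [fc, Finset.mul_sum]
  exact mean_sum t fun i => (tc_chr _).mul (hf i)

theorem fc_congr {f g : (Fin N → ℂ) → ℂ} (h : ∀ x, f (realPt x) = g (realPt x)) (s : Fin N → ℤ) :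
    fc f s = fc g s := mean_congr fun x => by rw [h]

theorem fc_zero (f : (Fin N → ℂ) → ℂ) : fc f 0 = mean f :=
  mean_congr fun x => by simp [chr_zero]

theorem norm_fc_le {f : (Fin N → ℂ) → ℂ} {M : ℝ} (h : ∀ x, ‖f (realPt x)‖ ≤ M) (s : Fin N → ℤ) :
    ‖fc f s‖ ≤ M := norm_mean_le fun x => by rw [norm_mul, norm_chr_realPt, one_mul]; exact h x

theorem fc_chr_mul (t : Fin N → ℤ) (f : (Fin N → ℂ) → ℂ) (s : Fin N → ℤ) :
    fc (fun ξ => chr t ξ * f ξ) s = fc f (s - t) := by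
  unfold fc
  congr 1
  ext ξ
  rw [← mul_assoc, ← chr_add]
  congr 2
  abel

/-! ### Comparison with Fourier series on the unit torus. -/

theorem mFourier_coe (s : Fin N → ℤ) (x : Fin N → ℝ) :
    UnitAddTorus.mFourier s (fun i => (x i : UnitAddCircle)) =
      chr s (realPt (fun i => 2 * Real.pi * x i)) := by
  simp only [UnitAddTorus.mFourier, ContinuousMap.coe_mk, fourier_coe_apply, ← Complex.exp_sum, chr]
  congr 1
  rw [Finset.mul_sum]
  refine Finset.sum_congr rfl fun i _ => ?_
  simp [realPt]; ring

theorem fc_eq_mFourierCoeff {f : (Fin N → ℂ) → ℂ} {F : C(UnitAddTorus (Fin N), ℂ)}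
    (hF : ∀ x : Fin N → ℝ,
      F (fun i => (x i : UnitAddCircle)) = f (realPt (fun i => 2 * Real.pi * x i)))
    (s : Fin N → ℤ) : fc f s = UnitAddTorus.mFourierCoeff F s := by
  have := TC.mean_eq (f := fun ξ => chr (-s) ξ * f ξ) (F := UnitAddTorus.mFourier (-s) * F)
    (fun x => by rw [ContinuousMap.mul_apply, mFourier_coe, hF])
  exact this

/-- Pointwise Fourier inversion, transferred from the unit torus: continuity and absolute
summability of the coefficients are enough. -/
theorem TC.hasSum {f : (Fin N → ℂ) → ℂ} (hf : TC f) (hs : Summable (fc f)) (x : Fin N → ℝ) :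
    HasSum (fun s => fc f s * chr s (realPt x)) (f (realPt x)) := by
  obtain ⟨F, hF⟩ := hf.exists_lift
  have h1 : UnitAddTorus.mFourierCoeff F = fc f := by
    ext s; exact (fc_eq_mFourierCoeff hF s).symm
  have h2 := UnitAddTorus.hasSum_mFourier_series_apply_of_summable (f := F) (by rwa [h1])
    (fun i => ((x i / (2 * Real.pi) : ℝ) : UnitAddCircle))
  rw [h1, hF] at h2
  simp only [mFourier_coe, smul_eq_mul] at h2
  have : (fun i => 2 * Real.pi * (x i / (2 * Real.pi))) = x := by
    ext i
    have := Real.pi_ne_zero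
    field_simp
  rwa [this] at h2

theorem fc_chr (t s : Fin N → ℤ) : fc (chr t) s = if s = t then 1 else 0 := by
  have h0 := UnitAddTorus.orthonormal_mFourier (d := Fin N)
  have h1 := fc_eq_mFourierCoeff (f := chr t) (F := UnitAddTorus.mFourier t)
    (fun x => mFourier_coe t x) s
  rw [h1, ← UnitAddTorus.mFourierCoeff_toLp, ← UnitAddTorus.mFourierBasis_repr,
    HilbertBasis.repr_apply_apply, UnitAddTorus.coe_mFourierBasis]
  exact (orthonormal_iff_ite.1 h0) s t

theorem fc_const (c : ℂ) (s : Fin N → ℤ) :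
    fc (fun _ : Fin N → ℂ => c) s = if s = 0 then c else 0 := by
  have h := fc_const_mul (N := N) c (fun ξ => chr 0 ξ) s
  simp only [chr_zero, mul_one] at h
  rw [h, show (fun _ : Fin N → ℂ => (1 : ℂ)) = chr 0 from funext fun ξ => (chr_zero ξ).symm, fc_chr]
  split_ifs <;> simp

end

end JacobiTorus

namespace JacobiTorus

noncomputable section

open MeasureTheory Set Filter Topology

variable {N : ℕ}

/-! ### Holomorphic functions on a strip -/

/-- The `ℓ¹` length of a frequency. -/
def l1 (s : Fin N → ℤ) : ℝ := ∑ j, |(s j : ℝ)|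

theorem l1_nonneg (s : Fin N → ℤ) : 0 ≤ l1 s := Finset.sum_nonneg fun _ _ => abs_nonneg _

theorem abs_le_l1 (s : Fin N → ℤ) (j : Fin N) : |(s j : ℝ)| ≤ l1 s :=
  Finset.single_le_sum (f := fun j => |(s j : ℝ)|) (fun _ _ => abs_nonneg _) (Finset.mem_univ j)

theorem l1_add_le (s t : Fin N → ℤ) : l1 (s + t) ≤ l1 s + l1 t := by
  simp only [l1, ← Finset.sum_add_distrib]
  refine Finset.sum_le_sum fun j _ => ?_
  simpa using abs_add_le (s j : ℝ) (t j)

theorem l1_neg (s : Fin N → ℤ) : l1 (-s) = l1 s := by simp [l1]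

theorem summable_exp_abs_int {δ : ℝ} (hδ : 0 < δ) :
    Summable (fun k : ℤ => Real.exp (-δ * |(k : ℝ)|)) := by
  have h : Summable (fun n : ℕ => Real.exp (-δ * n)) := by
    have := summable_geometric_of_lt_one (Real.exp_pos (-δ)).le (Real.exp_lt_one_iff.2 (by linarith))
    refine this.congr fun n => ?_
    rw [← Real.exp_nat_mul]; ring_nf
  refine Summable.of_nat_of_neg ?_ ?_ <;> simpa using h

/-- The `ℓ¹` length is additive over coordinates, so the series is a product of one-dimensional
geometric series; the induction peels off one coordinate. This length is the natural one because the
characters are bounded by `e^{r l1 s}` on the strip of half-width `r`. -/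
theorem summable_exp_l1 {δ : ℝ} (hδ : 0 < δ) :
    Summable (fun s : Fin N → ℤ => Real.exp (-δ * l1 s)) := by
  induction N with
  | zero => exact Summable.of_finite
  | succ n ih =>
    have h1 := (summable_exp_abs_int hδ).mul_of_nonneg ih (fun _ => (Real.exp_pos _).le)
      (fun _ => (Real.exp_pos _).le)
    rw [← (Fin.consEquiv (fun _ : Fin (n + 1) => ℤ)).summable_iff]
    refine h1.congr fun p => ?_
    simp only [Function.comp, ← Real.exp_add, l1, Fin.consEquiv_apply, Fin.sum_univ_succ,
      Fin.cons_zero, Fin.cons_succ]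
    ring_nf

theorem stripInt_subset_strip {ρ : ℝ} : stripInt (N := N) ρ ⊆ strip ρ := fun _ h j => (h j).le

theorem strip_mono {r ρ : ℝ} (h : r ≤ ρ) : strip (N := N) r ⊆ strip ρ :=
  fun _ hξ j => (hξ j).trans h

theorem stripInt_mono {r ρ : ℝ} (h : r ≤ ρ) : stripInt (N := N) r ⊆ stripInt ρ :=
  fun _ hξ j => (hξ j).trans_le h

theorem strip_subset_stripInt {r ρ : ℝ} (h : r < ρ) : strip (N := N) r ⊆ stripInt ρ :=
  fun _ hξ j => (hξ j).trans_lt h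

theorem isOpen_stripInt (ρ : ℝ) : IsOpen (stripInt (N := N) ρ) := by
  simp only [stripInt, Set.ofPred_forall]
  refine isOpen_iInter_of_finite fun j => isOpen_lt (by fun_prop) continuous_const

theorem convex_stripInt (ρ : ℝ) : Convex ℝ (stripInt (N := N) ρ) := by
  intro x hx y hy a b ha hb hab j
  have h1 := abs_lt.1 (hx j)
  have h2 := abs_lt.1 (hy j)
  simp only [Pi.add_apply, Pi.smul_apply, Complex.add_im, Complex.smul_im, smul_eq_mul]
  rw [abs_lt]
  rcases ha.eq_or_lt with h | h
  · subst h; simp at hab; subst hab; simpa using h2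
  · constructor <;> nlinarith

theorem realPt_mem_stripInt {ρ : ℝ} (hρ : 0 < ρ) (x : Fin N → ℝ) : realPt x ∈ stripInt ρ :=
  fun j => by simpa [realPt] using hρ

theorem zero_mem_stripInt {ρ : ℝ} (hρ : 0 < ρ) : (0 : Fin N → ℂ) ∈ stripInt ρ :=
  fun j => by simpa using hρ

/-- Scaling by `t < 1` moves a point of the closed strip into the open one, and `t → 1` recovers the
point. -/
theorem strip_subset_closure {ρ : ℝ} (hρ : 0 < ρ) :
    strip (N := N) ρ ⊆ closure (stripInt ρ) := by
  intro ξ hξ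
  have h1 : Tendsto (fun t : ℝ => t • ξ) (𝓝[<] 1) (𝓝 ξ) := by
    have : Tendsto (fun t : ℝ => t • ξ) (𝓝 1) (𝓝 ((1 : ℝ) • ξ)) :=
      (continuous_id.smul continuous_const).tendsto 1
    rw [one_smul] at this
    exact this.mono_left nhdsWithin_le_nhds
  refine mem_closure_of_tendsto h1 ?_
  have h2 : Ioo (0 : ℝ) 1 ∈ 𝓝[<] (1 : ℝ) := Ioo_mem_nhdsLT (by norm_num)
  filter_upwards [h2] with t ht j
  simp only [Pi.smul_apply, Complex.smul_im, smul_eq_mul, abs_mul, abs_of_pos ht.1]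
  have := hξ j
  nlinarith [ht.1, ht.2, abs_nonneg (ξ j).im]

/-! ### Sup norms and the analytic space of order zero. -/

theorem nrm_zero (ρ : ℝ) (f : (Fin N → ℂ) → ℂ) : nrm ρ 0 f = ⨆ ξ ∈ stripInt ρ, ‖f ξ‖ₑ := by
  apply le_antisymm
  · refine iSup₂_le fun l hl => ?_
    have : l = [] := by simpa using hl
    subst this
    exact le_rfl
  · exact le_iSup₂_of_le (f := fun (l : List (Fin N)) (_ : l.length ≤ 0) =>
      ⨆ ξ ∈ stripInt ρ, ‖(l.foldr pd f) ξ‖ₑ) [] (by simp) le_rfl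

theorem nrm_le_of_bound {ρ : ℝ} {f : (Fin N → ℂ) → ℂ} {M : ℝ}
    (h : ∀ ξ ∈ stripInt ρ, ‖f ξ‖ ≤ M) : nrm ρ 0 f ≤ ENNReal.ofReal M := by
  rw [nrm_zero]
  refine iSup₂_le fun ξ hξ => ?_
  rw [← ofReal_norm]
  exact ENNReal.ofReal_le_ofReal (h ξ hξ)

theorem nrm_zero_le (ρ : ℝ) (d : ℕ) (f : (Fin N → ℂ) → ℂ) : nrm ρ 0 f ≤ nrm ρ d f :=
  iSup_mono fun _ => iSup_mono' fun h => ⟨h.trans (Nat.zero_le d), le_rfl⟩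

theorem nrm_mono {r ρ : ℝ} (h : r ≤ ρ) (f : (Fin N → ℂ) → ℂ) : nrm r 0 f ≤ nrm ρ 0 f := by
  simp only [nrm_zero]
  exact biSup_mono (stripInt_mono h)

theorem norm_le_of_nrm_le {ρ M : ℝ} (hM : 0 ≤ M) {f : (Fin N → ℂ) → ℂ}
    (h : nrm ρ 0 f ≤ ENNReal.ofReal M) {ξ : Fin N → ℂ} (hξ : ξ ∈ stripInt ρ) : ‖f ξ‖ ≤ M := by
  rw [nrm_zero] at h
  have := (le_iSup₂ (f := fun ξ (_ : ξ ∈ stripInt ρ) => ‖f ξ‖ₑ) ξ hξ).trans h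
  rw [← ofReal_norm] at this
  exact (ENNReal.ofReal_le_ofReal_iff hM).1 this

theorem MemA.of_bound {ρ : ℝ} {f : (Fin N → ℂ) → ℂ} {M : ℝ}
    (hp : ∀ ξ ∈ strip ρ, ∀ j, f (ξ + Pi.single j (2 * (Real.pi : ℂ))) = f ξ)
    (hc : ContinuousOn f (strip ρ)) (hd : DifferentiableOn ℂ f (stripInt ρ))
    (h : ∀ ξ ∈ stripInt ρ, ‖f ξ‖ ≤ M) : MemA ρ 0 f :=
  ⟨hp, hc, hd, (nrm_le_of_bound h).trans_lt ENNReal.ofReal_lt_top⟩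

theorem MemA.zero {ρ : ℝ} {d : ℕ} {f : (Fin N → ℂ) → ℂ} (hf : MemA ρ d f) : MemA ρ 0 f :=
  ⟨hf.periodic, hf.continuousOn, hf.holomorphic, (nrm_zero_le ρ d f).trans_lt hf.finite⟩

theorem MemA.mono {r ρ : ℝ} {f : (Fin N → ℂ) → ℂ} (hf : MemA ρ 0 f) (h : r ≤ ρ) : MemA r 0 f :=
  ⟨fun ξ hξ => hf.periodic ξ (strip_mono h hξ), hf.continuousOn.mono (strip_mono h),
    hf.holomorphic.mono (stripInt_mono h), (nrm_mono h f).trans_lt hf.finite⟩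

theorem MemA.exists_bound {ρ : ℝ} {f : (Fin N → ℂ) → ℂ} (hf : MemA ρ 0 f) :
    ∃ M, 0 ≤ M ∧ ∀ ξ ∈ stripInt ρ, ‖f ξ‖ ≤ M :=
  ⟨_, ENNReal.toReal_nonneg, fun _ hξ => norm_le_of_nrm_le ENNReal.toReal_nonneg
    (ENNReal.ofReal_toReal hf.finite.ne).ge hξ⟩

theorem add_single_mem_strip {ρ : ℝ} {ξ : Fin N → ℂ} (hξ : ξ ∈ strip ρ) (j : Fin N) :
    ξ + Pi.single j (2 * (Real.pi : ℂ)) ∈ strip ρ := by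
  intro i
  have : ((Pi.single j (2 * (Real.pi : ℂ)) : Fin N → ℂ) i).im = 0 := by
    by_cases h : i = j
    · subst h; simp
    · simp [h]
  simpa [this] using hξ i

theorem MemA.congr {ρ : ℝ} {f g : (Fin N → ℂ) → ℂ} (hf : MemA ρ 0 f)
    (h : EqOn g f (strip ρ)) : MemA ρ 0 g := by
  obtain ⟨M, -, hM⟩ := hf.exists_bound
  refine MemA.of_bound (M := M) (fun ξ hξ j => ?_) (hf.continuousOn.congr h)
    (hf.holomorphic.congr (h.mono stripInt_subset_strip)) fun ξ hξ => ?_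
  · rw [h hξ, h (add_single_mem_strip hξ j), hf.periodic ξ hξ]
  · rw [h (stripInt_subset_strip hξ)]; exact hM ξ hξ

theorem MemA.tc {ρ : ℝ} (hρ : 0 < ρ) {f : (Fin N → ℂ) → ℂ} (hf : MemA ρ 0 f) : TC f :=
  ⟨hf.continuousOn.comp_continuous realPt_continuous
    fun x => stripInt_subset_strip (realPt_mem_stripInt hρ x),
    fun x j => hf.periodic _ (stripInt_subset_strip (realPt_mem_stripInt hρ x)) j⟩

theorem MemA.const {ρ : ℝ} (c : ℂ) : MemA ρ 0 (fun _ : Fin N → ℂ => c) :=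
  MemA.of_bound (M := ‖c‖) (fun _ _ _ => rfl) continuousOn_const (differentiableOn_const c)
    fun _ _ => le_rfl

theorem MemA.add {ρ : ℝ} {f g : (Fin N → ℂ) → ℂ} (hf : MemA ρ 0 f) (hg : MemA ρ 0 g) :
    MemA ρ 0 (fun ξ => f ξ + g ξ) := by
  obtain ⟨M, -, hM⟩ := hf.exists_bound
  obtain ⟨M', -, hM'⟩ := hg.exists_bound
  exact MemA.of_bound (M := M + M') (fun ξ hξ j => by rw [hf.periodic ξ hξ, hg.periodic ξ hξ])
    (hf.continuousOn.add hg.continuousOn) (hf.holomorphic.add hg.holomorphic)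
    fun ξ hξ => (norm_add_le _ _).trans (add_le_add (hM ξ hξ) (hM' ξ hξ))

theorem MemA.mul {ρ : ℝ} {f g : (Fin N → ℂ) → ℂ} (hf : MemA ρ 0 f) (hg : MemA ρ 0 g) :
    MemA ρ 0 (fun ξ => f ξ * g ξ) := by
  obtain ⟨M, h0, hM⟩ := hf.exists_bound
  obtain ⟨M', -, hM'⟩ := hg.exists_bound
  exact MemA.of_bound (M := M * M') (fun ξ hξ j => by rw [hf.periodic ξ hξ, hg.periodic ξ hξ])
    (hf.continuousOn.mul hg.continuousOn) (hf.holomorphic.mul hg.holomorphic)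
    fun ξ hξ => by
      rw [norm_mul]
      exact mul_le_mul (hM ξ hξ) (hM' ξ hξ) (norm_nonneg _) h0

theorem MemA.const_mul {ρ : ℝ} (c : ℂ) {f : (Fin N → ℂ) → ℂ} (hf : MemA ρ 0 f) :
    MemA ρ 0 (fun ξ => c * f ξ) := (MemA.const c).mul hf

theorem MemA.neg {ρ : ℝ} {f : (Fin N → ℂ) → ℂ} (hf : MemA ρ 0 f) : MemA ρ 0 (fun ξ => -f ξ) := by
  simpa using hf.const_mul (-1)

theorem MemA.sub {ρ : ℝ} {f g : (Fin N → ℂ) → ℂ} (hf : MemA ρ 0 f) (hg : MemA ρ 0 g) :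
    MemA ρ 0 (fun ξ => f ξ - g ξ) := by
  simpa [sub_eq_add_neg] using hf.add hg.neg

theorem MemA.sum {ρ : ℝ} {ι : Type*} (t : Finset ι) {f : ι → (Fin N → ℂ) → ℂ}
    (hf : ∀ i, MemA ρ 0 (f i)) : MemA ρ 0 (fun ξ => ∑ i ∈ t, f i ξ) := by
  classical
  induction t using Finset.induction_on with
  | empty => simpa using MemA.const 0
  | insert a t ha ih =>
    simp only [Finset.sum_insert ha]
    exact (hf a).add ih

/-! Shifting the torus into the complex domain. -/

/-- The purely imaginary point `i y`. -/
def imPt (y : Fin N → ℝ) : Fin N → ℂ := fun j => Complex.I * (y j : ℂ)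

/-- Differentiation under the integral along a complex line. The domination comes from Cauchy's
estimate, so a bound on `G` alone suffices. -/
theorem differentiableOn_mean_line {ρ M : ℝ} {G : (Fin N → ℂ) → ℂ}
    (hd : DifferentiableOn ℂ G (stripInt ρ)) (hM : ∀ ξ ∈ stripInt ρ, ‖G ξ‖ ≤ M)
    (v : Fin N → ℝ) :
    DifferentiableOn ℂ (fun z : ℂ => mean (fun ξ => G (ξ + z • realPt v)))
      {z | ∀ j, |z.im * v j| < ρ} := by
  have hUo : IsOpen {z : ℂ | ∀ j, |z.im * v j| < ρ} := by
    simp only [Set.ofPred_forall]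
    exact isOpen_iInter_of_finite fun j => isOpen_lt (by fun_prop) continuous_const
  have hmem : ∀ z ∈ {z : ℂ | ∀ j, |z.im * v j| < ρ}, ∀ x : Fin N → ℝ,
      realPt x + z • realPt v ∈ stripInt ρ := by
    intro z hz x j
    simpa [realPt, Complex.mul_im] using hz j
  intro z₀ hz₀
  obtain ⟨R, hR, hball⟩ := Metric.isOpen_iff.1 hUo z₀ hz₀
  have hdx : ∀ x : Fin N → ℝ, DifferentiableOn ℂ (fun z : ℂ => G (realPt x + z • realPt v))
      {z | ∀ j, |z.im * v j| < ρ} := fun x =>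
    hd.comp (by fun_prop) fun z hz => hmem z hz x
  have hcont : ∀ z ∈ {z : ℂ | ∀ j, |z.im * v j| < ρ},
      Continuous (fun x : Fin N → ℝ => G (realPt x + z • realPt v)) := fun z hz =>
    hd.continuousOn.comp_continuous (realPt_continuous.add continuous_const) fun x => hmem z hz x
  have key := hasDerivAt_integral_of_dominated_loc_of_deriv_le (𝕜 := ℂ)
    (μ := volume.restrict (Icc (0 : Fin N → ℝ) (fun _ => 2 * Real.pi)))
    (F := fun z x => G (realPt x + z • realPt v))
    (F' := fun z x => deriv (fun z : ℂ => G (realPt x + z • realPt v)) z)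
    (x₀ := z₀) (s := Metric.ball z₀ (R / 2)) (bound := fun _ => M / (R / 4))
    (Metric.ball_mem_nhds _ (by positivity)) ?_ ?_ ?_ ?_ ?_ ?_
  · have h2 := (key.2.const_mul ((2 * (Real.pi : ℂ))⁻¹ ^ N)).differentiableAt
    exact h2.differentiableWithinAt
  · filter_upwards [hUo.mem_nhds hz₀] with z hz
    exact (hcont z hz).aestronglyMeasurable
  · exact (hcont z₀ hz₀).continuousOn.integrableOn_compact isCompact_Icc
  -- Measurability in `x` of the complex derivative: it is a limit of difference quotients that are
  -- continuous in `x`. The increments `R / (n + 2)` are smaller than `R`, so the shifted points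
  -- stay in the domain.
  · have h3 : ∀ n : ℕ, 0 < R / (n + 2) ∧ R / ((n : ℝ) + 2) < R := fun n => by
      constructor
      · positivity
      · rw [div_lt_iff₀ (by positivity)]; nlinarith [(Nat.cast_nonneg n : (0 : ℝ) ≤ n)]
    refine aestronglyMeasurable_of_tendsto_ae (u := atTop) (f := fun (n : ℕ) (x : Fin N → ℝ) =>
      ((R / (n + 2) : ℝ) : ℂ)⁻¹ • (G (realPt x + (z₀ + (R / (n + 2) : ℝ)) • realPt v) -
        G (realPt x + z₀ • realPt v))) (fun n => ?_) (Eventually.of_forall fun x => ?_)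
    · have h4 := hcont (z₀ + (R / (n + 2) : ℝ)) (hball (by
        simp only [Metric.mem_ball, dist_self_add_left, Complex.norm_real, Real.norm_eq_abs]
        rw [abs_of_pos (h3 n).1]
        exact (h3 n).2))
      have h5 := hcont z₀ hz₀
      exact ((continuous_const_smul (((R / (n + 2) : ℝ) : ℂ)⁻¹)).comp (h4.sub h5)).aestronglyMeasurable
    · have h4 := ((hdx x).differentiableAt (hUo.mem_nhds hz₀)).hasDerivAt
      rw [hasDerivAt_iff_tendsto_slope_zero] at h4
      refine h4.comp (f := fun n : ℕ => ((R / (n + 2) : ℝ) : ℂ)) ?_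
      refine tendsto_nhdsWithin_iff.2 ⟨?_, Eventually.of_forall fun n => ?_⟩
      · have h5 : Tendsto (fun n : ℕ => R / ((n : ℝ) + 2)) atTop (𝓝 0) :=
          Tendsto.div_atTop tendsto_const_nhds
            (tendsto_atTop_add_const_right _ _ tendsto_natCast_atTop_atTop)
        exact (Complex.continuous_ofReal.tendsto' 0 0 rfl).comp h5
      · simp only [mem_compl_iff, mem_singleton_iff, Complex.ofReal_eq_zero]
        exact (h3 n).1.ne'
  · refine Eventually.of_forall fun x z hz => ?_
    -- Discs of radius `R / 4` about points of the ball of radius `R / 2` stay inside the ball of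
    -- radius `R`; this is where the bound `M / (R / 4)` comes from.
    have hsub : Metric.closedBall z (R / 4) ⊆ Metric.ball z₀ R := by
      intro w hw
      rw [Metric.mem_closedBall] at hw
      rw [Metric.mem_ball] at hz ⊢
      linarith [dist_triangle w z z₀]
    refine Complex.norm_deriv_le_of_forall_mem_sphere_norm_le (by positivity) ?_ ?_
    · refine DifferentiableOn.diffContOnCl ?_
      rw [closure_ball _ (by positivity)]
      exact (hdx x).mono (hsub.trans hball)
    · intro w hw
      exact hM _ (hmem w (hball (hsub (Metric.sphere_subset_closedBall hw))) x)
  · exact (continuous_const.continuousOn.integrableOn_compact isCompact_Icc)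
  · refine Eventually.of_forall fun x z hz => ?_
    refine ((hdx x).differentiableAt (hUo.mem_nhds (hball ?_))).hasDerivAt
    exact Metric.ball_subset_ball (by linarith) hz

/-- The mean of `G(· + z y)` is holomorphic in `z` on a convex domain and, by translation
invariance, equals `mean G` at the real points `1/(n+1)`, which accumulate at `0`. The identity
theorem extends this to `z = i`. This takes the place of a contour shift in each variable. -/
theorem mean_shift {ρ M : ℝ} {G : (Fin N → ℂ) → ℂ} (hρ : 0 < ρ) (hG : TC G)
    (hd : DifferentiableOn ℂ G (stripInt ρ)) (hM : ∀ ξ ∈ stripInt ρ, ‖G ξ‖ ≤ M)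
    (y : Fin N → ℝ) (hy : ∀ j, |y j| < ρ) :
    mean (fun ξ => G (ξ + imPt y)) = mean G := by
  have hUo : IsOpen {z : ℂ | ∀ j, |z.im * y j| < ρ} := by
    simp only [Set.ofPred_forall]
    exact isOpen_iInter_of_finite fun j => isOpen_lt (by fun_prop) continuous_const
  have hUc : Convex ℝ {z : ℂ | ∀ j, |z.im * y j| < ρ} := by
    have : {z : ℂ | ∀ j, |z.im * y j| < ρ} =
        (fun z : ℂ => z • realPt y) ⁻¹' (stripInt ρ) := by
      ext z
      simp [stripInt, realPt, Complex.mul_im]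
    rw [this]
    have := (convex_stripInt (N := N) ρ).is_linear_preimage
      (f := fun z : ℂ => z • realPt y) ⟨fun a b => add_smul a b _, fun a b => smul_assoc a b _⟩
    exact this
  have h1 := (differentiableOn_mean_line hd hM y).analyticOnNhd hUo
  have h2 : AnalyticOnNhd ℂ (fun _ : ℂ => mean G) {z : ℂ | ∀ j, |z.im * y j| < ρ} :=
    analyticOnNhd_const
  have h0 : (0 : ℂ) ∈ {z : ℂ | ∀ j, |z.im * y j| < ρ} := by simp [hρ]
  have h3 := h1.eqOn_of_preconnected_of_frequently_eq h2 hUc.isPreconnected h0 ?_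
  · have h4 : Complex.I ∈ {z : ℂ | ∀ j, |z.im * y j| < ρ} := by simpa using hy
    exact h3 h4
  · have h5 : Tendsto (fun n : ℕ => ((1 / ((n : ℝ) + 1) : ℝ) : ℂ)) atTop (𝓝[≠] 0) := by
      refine tendsto_nhdsWithin_iff.2 ⟨?_, Eventually.of_forall fun n => ?_⟩
      · exact (Complex.continuous_ofReal.tendsto' 0 0 rfl).comp
          tendsto_one_div_add_atTop_nhds_zero_nat
      · simp only [mem_compl_iff, mem_singleton_iff, Complex.ofReal_eq_zero]
        positivity
    refine h5.frequently (Frequently.of_forall fun n => ?_)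
    have := hG.mean_translate ((1 / ((n : ℝ) + 1)) • y)
    rw [← this]
    congr 1
    ext ξ
    congr 2
    ext j
    simp [realPt]

theorem differentiable_chr (s : Fin N → ℤ) : Differentiable ℂ (chr s) := by
  unfold chr; fun_prop

theorem norm_chr_le {r : ℝ} (s : Fin N → ℤ) {ξ : Fin N → ℂ} (hξ : ξ ∈ strip r) :
    ‖chr s ξ‖ ≤ Real.exp (r * l1 s) := by
  rw [norm_chr, Real.exp_le_exp, l1, Finset.mul_sum, ← Finset.sum_neg_distrib]
  refine Finset.sum_le_sum fun j _ => ?_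
  have h1 := hξ j
  have h2 : -((s j : ℝ) * (ξ j).im) ≤ |(s j : ℝ)| * |(ξ j).im| := by
    rw [← abs_mul]; exact neg_le_abs _
  nlinarith [abs_nonneg (s j : ℝ)]

/-- `mean_shift` applied to the product of `f` with a character; taking the character out of the
shifted integrand produces the factor. -/
theorem MemA.fc_shift {ρ : ℝ} (hρ : 0 < ρ) {f : (Fin N → ℂ) → ℂ} (hf : MemA ρ 0 f)
    (y : Fin N → ℝ) (hy : ∀ j, |y j| < ρ) (s : Fin N → ℤ) :
    fc (fun ξ => f (ξ + imPt y)) s = chr s (imPt y) * fc f s := by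
  obtain ⟨M, hM0, hM⟩ := hf.exists_bound
  have h1 := mean_shift (M := Real.exp (ρ * l1 (-s)) * M) hρ ((tc_chr (-s)).mul (hf.tc hρ))
    ((differentiable_chr (-s)).differentiableOn.mul hf.holomorphic)
    (fun ξ hξ => by
      rw [norm_mul]
      exact mul_le_mul (norm_chr_le _ (stripInt_subset_strip hξ)) (hM ξ hξ) (norm_nonneg _)
        (Real.exp_pos _).le) y hy
  unfold fc
  rw [← h1, ← mean_const_mul]
  congr 1
  ext ξ
  rw [chr_apply_add]
  have : chr s (imPt y) * chr (-s) (imPt y) = 1 := by rw [← chr_add]; simp [chr_zero]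
  linear_combination (-(chr (-s) ξ) * f (ξ + imPt y)) * this

theorem MemA.shift_mem {ρ : ℝ} {f : (Fin N → ℂ) → ℂ} (hf : MemA ρ 0 f)
    (y : Fin N → ℝ) (hy : ∀ j, |y j| < ρ) : TC (fun ξ => f (ξ + imPt y)) := by
  have hm : ∀ x : Fin N → ℝ, realPt x + imPt y ∈ strip ρ := fun x j => by
    simpa [realPt, imPt] using (hy j).le
  refine ⟨hf.continuousOn.comp_continuous (realPt_continuous.add continuous_const) hm, ?_⟩
  intro x j
  rw [← hf.periodic _ (hm x) j]
  congr 1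
  abel

theorem norm_chr_imPt (s : Fin N → ℤ) (y : Fin N → ℝ) :
    ‖chr s (imPt y)‖ = Real.exp (-∑ j, (s j : ℝ) * y j) := by
  rw [norm_chr]; simp [imPt]

/-- Exponential decay of the Fourier coefficients. -/
theorem MemA.norm_fc_le {ρ r M : ℝ} (hr : 0 ≤ r) (hrρ : r < ρ) {f : (Fin N → ℂ) → ℂ}
    (hf : MemA ρ 0 f) (hM : ∀ ξ ∈ stripInt ρ, ‖f ξ‖ ≤ M) (s : Fin N → ℤ) :
    ‖fc f s‖ ≤ M * Real.exp (-r * l1 s) := by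
  -- The shift by `r` against the sign of each frequency makes the modulus of the character exactly
  -- `e^{r l1 s}`.
  set y : Fin N → ℝ := fun j => -r * SignType.sign (s j : ℝ) with hy
  have hyr : ∀ j, |y j| ≤ r := fun j => by
    simp only [hy, abs_mul, abs_neg, abs_of_nonneg hr]
    have : |((SignType.sign (s j : ℝ) : SignType) : ℝ)| ≤ 1 := by
      rcases lt_trichotomy (s j : ℝ) 0 with h | h | h
      · simp [sign_neg h]
      · simp [h]
      · simp [sign_pos h]
    nlinarith
  have hyρ : ∀ j, |y j| < ρ := fun j => (hyr j).trans_lt hrρ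
  have h1 := hf.fc_shift (hr.trans_lt hrρ) y hyρ s
  have h2 : ‖fc (fun ξ => f (ξ + imPt y)) s‖ ≤ M := JacobiTorus.norm_fc_le (fun x => hM (realPt x + imPt y) fun j => by
    simpa [realPt, imPt] using hyρ j) s
  rw [h1, norm_mul, norm_chr_imPt] at h2
  have h3 : -∑ j, (s j : ℝ) * y j = r * l1 s := by
    rw [l1, Finset.mul_sum, ← Finset.sum_neg_distrib]
    refine Finset.sum_congr rfl fun j _ => ?_
    have := sign_mul_self (s j : ℝ)
    simp only [hy]
    rw [← this]; ring
  rw [h3] at h2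
  have h4 : Real.exp (r * l1 s) * Real.exp (-r * l1 s) = 1 := by
    rw [← Real.exp_add]; simp
  calc ‖fc f s‖ = (Real.exp (r * l1 s) * ‖fc f s‖) * Real.exp (-r * l1 s) := by
        linear_combination (-‖fc f s‖) * h4
    _ ≤ _ := by gcongr

theorem summable_of_decay {R r A : ℝ} (hr : r < R) {b : (Fin N → ℤ) → ℂ}
    (hb : ∀ s, ‖b s‖ ≤ A * Real.exp (-R * l1 s) * Real.exp (r * l1 s)) : Summable b := by
  refine Summable.of_norm_bounded ((summable_exp_l1 (sub_pos.2 hr)).mul_left A) fun s => ?_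
  refine (hb s).trans (le_of_eq ?_)
  rw [mul_assoc, ← Real.exp_add]
  ring_nf

/-- Inversion is known only on the real torus. A complex point `x + iy` is reached by applying it to
`f(· + iy)`, whose coefficients are `chr s (iy) · fc f s` and are summable because `y` stays at a
positive distance from the boundary. -/
theorem MemA.hasSum {ρ : ℝ} {f : (Fin N → ℂ) → ℂ} (hρ : 0 < ρ) (hf : MemA ρ 0 f)
    {ξ : Fin N → ℂ} (hξ : ξ ∈ stripInt ρ) : HasSum (fun s => fc f s * chr s ξ) (f ξ) := by
  obtain ⟨M, hM0, hM⟩ := hf.exists_bound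
  obtain ⟨r, hr0, hrρ, hξr⟩ : ∃ r, 0 < r ∧ r < ρ ∧ ξ ∈ strip r := by
    have h1 : ∃ r, 0 ≤ r ∧ r < ρ ∧ ξ ∈ strip r := by
      rcases isEmpty_or_nonempty (Fin N) with h | h
      · exact ⟨0, le_rfl, hρ, fun j => h.elim j⟩
      · obtain ⟨j, hj⟩ := Finite.exists_max (fun j => |(ξ j).im|)
        exact ⟨|(ξ j).im|, abs_nonneg _, hξ j, hj⟩
    obtain ⟨r, h1, h2, h3⟩ := h1
    exact ⟨(r + ρ) / 2, by linarith, by linarith, strip_mono (by linarith) h3⟩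
  set x : Fin N → ℝ := fun j => (ξ j).re
  set y : Fin N → ℝ := fun j => (ξ j).im
  have hxy : realPt x + imPt y = ξ := by
    ext j
    simp only [realPt, imPt, Pi.add_apply, x, y]
    rw [mul_comm]; exact Complex.re_add_im _
  have h1 := hf.shift_mem y hξ
  have h2 : fc (fun ξ => f (ξ + imPt y)) = fun s => chr s (imPt y) * fc f s :=
    funext (hf.fc_shift hρ y hξ)
  have hr1 : (r + ρ) / 2 < ρ := by linarith
  have h3 := h1.hasSum (by
    rw [h2]
    refine summable_of_decay (R := (r + ρ) / 2) (r := r) (A := M) (by linarith) fun s => ?_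
    rw [norm_mul, mul_comm]
    refine mul_le_mul (hf.norm_fc_le (by linarith) hr1 hM s) (norm_chr_le s ?_) (norm_nonneg _)
      (by positivity)
    intro j
    simpa [imPt] using hξr j) x
  rw [h2, hxy] at h3
  refine h3.congr_fun fun s => ?_
  rw [← hxy, chr_apply_add]
  ring

/-! Trigonometric series with exponentially decaying coefficients. -/

/-- This is how a derivative is paid for: a factor `|s|` costs a small part `δ` of the exponential
rate. -/
theorem l1_mul_exp_le {δ : ℝ} (hδ : 0 < δ) (s : Fin N → ℤ) :
    l1 s ≤ δ⁻¹ * Real.exp (δ * l1 s) := by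
  have h1 := Real.add_one_le_exp (δ * l1 s)
  rw [le_inv_mul_iff₀ hδ]
  linarith

theorem hasFDerivAt_chr (s : Fin N → ℤ) (ξ : Fin N → ℂ) :
    HasFDerivAt (chr s) (chr s ξ • (Complex.I • ∑ j, (s j : ℂ) •
      (ContinuousLinearMap.proj j : (Fin N → ℂ) →L[ℂ] ℂ))) ξ := by
  have h1 : HasFDerivAt (fun ξ : Fin N → ℂ => Complex.I * ∑ j, (s j : ℂ) * ξ j)
      (Complex.I • ∑ j, (s j : ℂ) • (ContinuousLinearMap.proj j : (Fin N → ℂ) →L[ℂ] ℂ)) ξ := by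
    refine HasFDerivAt.const_mul ?_ _
    exact HasFDerivAt.fun_sum fun j _ => (hasFDerivAt_apply j ξ).const_mul _
  exact h1.cexp

theorem norm_chr_deriv_le (s : Fin N → ℤ) :
    ‖Complex.I • ∑ j, (s j : ℂ) • (ContinuousLinearMap.proj j : (Fin N → ℂ) →L[ℂ] ℂ)‖ ≤ l1 s := by
  rw [norm_smul, Complex.norm_I, one_mul]
  refine (norm_sum_le _ _).trans (Finset.sum_le_sum fun j _ => ?_)
  rw [norm_smul, Complex.norm_intCast]
  have : ‖(ContinuousLinearMap.proj j : (Fin N → ℂ) →L[ℂ] ℂ)‖ ≤ 1 :=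
    ContinuousLinearMap.opNorm_le_bound _ zero_le_one fun x => by
      simpa using norm_le_pi_norm x j
  nlinarith [abs_nonneg (s j : ℝ)]

section Series

variable {R r A : ℝ} {a : (Fin N → ℤ) → ℂ}

theorem Ser.summable (hr : r < R) (ha : ∀ s, ‖a s‖ ≤ A * Real.exp (-R * l1 s))
    {ξ : Fin N → ℂ} (hξ : ξ ∈ strip r) : Summable (fun s => a s * chr s ξ) :=
  summable_of_decay hr fun s => by
    rw [norm_mul]
    exact mul_le_mul (ha s) (norm_chr_le s hξ) (norm_nonneg _) ((norm_nonneg _).trans (ha s))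

theorem Ser.norm_term_le (ha : ∀ s, ‖a s‖ ≤ A * Real.exp (-R * l1 s))
    {ξ : Fin N → ℂ} (hξ : ξ ∈ strip r) (s : Fin N → ℤ) :
    ‖a s * chr s ξ‖ ≤ A * Real.exp (-(R - r) * l1 s) := by
  rw [norm_mul]
  calc _ ≤ (A * Real.exp (-R * l1 s)) * Real.exp (r * l1 s) :=
        mul_le_mul (ha s) (norm_chr_le s hξ) (norm_nonneg _) ((norm_nonneg _).trans (ha s))
    _ = _ := by rw [mul_assoc, ← Real.exp_add]; ring_nf

theorem Ser.norm_le (hr : r < R) (ha : ∀ s, ‖a s‖ ≤ A * Real.exp (-R * l1 s))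
    {ξ : Fin N → ℂ} (hξ : ξ ∈ strip r) :
    ‖Ser a ξ‖ ≤ A * ∑' s : Fin N → ℤ, Real.exp (-(R - r) * l1 s) := by
  have h1 := summable_exp_l1 (N := N) (sub_pos.2 hr)
  rw [← tsum_mul_left]
  exact tsum_of_norm_bounded (h1.mul_left A).hasSum (Ser.norm_term_le ha hξ)

theorem Ser.hasFDerivAt (hr0 : 0 < r) (hr : r < R)
    (ha : ∀ s, ‖a s‖ ≤ A * Real.exp (-R * l1 s)) {ξ : Fin N → ℂ} (hξ : ξ ∈ stripInt r) :
    HasFDerivAt (Ser a) (∑' s, a s • chr s ξ • (Complex.I • ∑ j, (s j : ℂ) •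
      (ContinuousLinearMap.proj j : (Fin N → ℂ) →L[ℂ] ℂ))) ξ ∧
    Summable (fun s => a s • chr s ξ • (Complex.I • ∑ j, (s j : ℂ) •
      (ContinuousLinearMap.proj j : (Fin N → ℂ) →L[ℂ] ℂ))) := by
  -- Half of the gap `R - r` absorbs the factor from the derivative, the other half keeps the series
  -- summable.
  have hδ : 0 < (R - r) / 2 := by linarith
  have hA : 0 ≤ A := by
    have := (norm_nonneg _).trans (ha 0)
    simpa [l1] using this
  have hu : Summable (fun s : Fin N → ℤ =>
      A * ((R - r) / 2)⁻¹ * Real.exp (-((R - r) / 2) * l1 s)) :=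
    (summable_exp_l1 hδ).mul_left _
  have hb : ∀ s, ∀ ξ ∈ stripInt r, ‖a s • chr s ξ • (Complex.I • ∑ j, (s j : ℂ) •
      (ContinuousLinearMap.proj j : (Fin N → ℂ) →L[ℂ] ℂ))‖ ≤
      A * ((R - r) / 2)⁻¹ * Real.exp (-((R - r) / 2) * l1 s) := by
    intro s ξ hξ
    rw [← mul_smul, norm_smul]
    calc _ ≤ (A * Real.exp (-(R - r) * l1 s)) * (((R - r) / 2)⁻¹ * Real.exp ((R - r) / 2 * l1 s)) :=
          mul_le_mul (Ser.norm_term_le ha (stripInt_subset_strip hξ) s)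
            ((norm_chr_deriv_le s).trans (l1_mul_exp_le hδ s)) (norm_nonneg _) (by positivity)
      _ = A * ((R - r) / 2)⁻¹ * (Real.exp (-(R - r) * l1 s) * Real.exp ((R - r) / 2 * l1 s)) := by
          ring
      _ = _ := by rw [← Real.exp_add]; ring_nf
  refine ⟨hasFDerivAt_tsum_of_isPreconnected (f := fun s ξ => a s * chr s ξ) hu (isOpen_stripInt r)
    (convex_stripInt r).isPreconnected (fun s ξ _ => ?_) hb (zero_mem_stripInt hr0) ?_ hξ, ?_⟩
  · exact (hasFDerivAt_chr s ξ).const_mul (a s)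
  · exact Ser.summable hr ha (stripInt_subset_strip (zero_mem_stripInt hr0))
  · exact Summable.of_norm_bounded hu fun s => hb s ξ hξ

theorem Ser.memA (hr0 : 0 < r) (hr : r < R) (ha : ∀ s, ‖a s‖ ≤ A * Real.exp (-R * l1 s)) :
    MemA r 0 (Ser a) := by
  refine MemA.of_bound (fun ξ _ j => ?_) ?_
    (fun ξ hξ => (Ser.hasFDerivAt hr0 hr ha hξ).1.differentiableAt.differentiableWithinAt)
    (fun ξ hξ => Ser.norm_le hr ha (stripInt_subset_strip hξ))
  · simp only [Ser, chr_add_single]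
  · exact continuousOn_tsum (fun s => (continuous_const.mul (chr_continuous s)).continuousOn)
      ((summable_exp_l1 (sub_pos.2 hr)).mul_left A) fun s ξ hξ => Ser.norm_term_le ha hξ s

theorem Ser.pd (hr0 : 0 < r) (hr : r < R) (ha : ∀ s, ‖a s‖ ≤ A * Real.exp (-R * l1 s))
    {ξ : Fin N → ℂ} (hξ : ξ ∈ stripInt r) (j : Fin N) :
    pd j (Ser a) ξ = Ser (fun s => Complex.I * (s j : ℂ) * a s) ξ := by
  obtain ⟨h1, h2⟩ := Ser.hasFDerivAt hr0 hr ha hξ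
  rw [JacobiTorus.pd, h1.fderiv, ← ContinuousLinearMap.apply_apply (𝕜 := ℂ) (Pi.single j 1),
    ContinuousLinearMap.map_tsum _ h2, Ser]
  refine tsum_congr fun s => ?_
  simp [Pi.single_apply]
  ring

end Series

/-- Sum and mean are interchanged by dominated convergence, and orthogonality of the characters
leaves one term. Absolute summability is enough here. -/
theorem fc_Ser {a : (Fin N → ℤ) → ℂ} (ha : Summable a) (s : Fin N → ℤ) : fc (Ser a) s = a s := by
  have h1 : ∀ t : Fin N → ℤ, Continuous fun x : Fin N → ℝ => chr (-s) (realPt x) *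
      (a t * chr t (realPt x)) := fun t =>
    ((chr_continuous _).comp realPt_continuous).mul
      (continuous_const.mul ((chr_continuous _).comp realPt_continuous))
  have h2 : HasSum (fun t => mean (fun ξ => chr (-s) ξ * (a t * chr t ξ))) (fc (Ser a) s) := by
    unfold fc mean torusInt
    refine HasSum.mul_left _ ?_
    refine hasSum_integral_of_dominated_convergence (fun t _ => ‖a t‖)
      (fun t => (h1 t).aestronglyMeasurable) (fun t => Eventually.of_forall fun x => ?_)
      (Eventually.of_forall fun x => ha.norm) ?_ (Eventually.of_forall fun x => ?_)
    · have e1 := norm_chr_realPt (-s) x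
      have e2 := norm_chr_realPt t x
      unfold realPt at e1 e2
      rw [norm_mul, norm_mul, e1, e2]
      simp
    · exact continuous_const.continuousOn.integrableOn_compact isCompact_Icc
    · refine HasSum.mul_left _ ?_
      refine Summable.hasSum (Summable.of_norm ?_)
      refine ha.norm.congr fun t => ?_
      have e2 := norm_chr_realPt t x
      unfold realPt at e2
      rw [norm_mul, e2, mul_one]
  have h3 : ∀ t, mean (fun ξ => chr (-s) ξ * (a t * chr t ξ)) = if t = s then a s else 0 := by
    intro t
    have := fc_const_mul (a t) (chr t) s
    rw [fc_chr] at this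
    unfold fc at this
    rw [this]
    by_cases h : s = t
    · simp [h]
    · simp [h, Ne.symm h]
  simp only [h3] at h2
  exact h2.unique (hasSum_ite_eq s (a s))

theorem summable_of_decay_pos {R A : ℝ} (hR : 0 < R) {b : (Fin N → ℤ) → ℂ}
    (hb : ∀ s, ‖b s‖ ≤ A * Real.exp (-R * l1 s)) : Summable b :=
  summable_of_decay (r := 0) hR fun s => by simpa using hb s

/-! Consequences for functions on the strip. -/

/-- Both functions are sums of the same series in the open strip; continuity carries the equality to
the boundary. -/
theorem MemA.eqOn_of_fc_eq {ρ : ℝ} (hρ : 0 < ρ) {f g : (Fin N → ℂ) → ℂ} (hf : MemA ρ 0 f)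
    (hg : MemA ρ 0 g) (h : ∀ s, fc f s = fc g s) : EqOn f g (strip ρ) := by
  have h1 : EqOn f g (stripInt ρ) := by
    intro ξ hξ
    have h2 := hf.hasSum hρ hξ
    simp only [h] at h2
    exact h2.unique (hg.hasSum hρ hξ)
  exact h1.of_subset_closure hf.continuousOn hg.continuousOn stripInt_subset_strip
    (strip_subset_closure hρ)

theorem MemA.eqOn_Ser {ρ : ℝ} (hρ : 0 < ρ) {f : (Fin N → ℂ) → ℂ} (hf : MemA ρ 0 f) :
    EqOn f (Ser (fc f)) (stripInt ρ) := fun _ hξ => (hf.hasSum hρ hξ).tsum_eq.symm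

theorem MemA.exists_decay {ρ r : ℝ} (hr : 0 ≤ r) (hrρ : r < ρ) {f : (Fin N → ℂ) → ℂ}
    (hf : MemA ρ 0 f) : ∃ A, ∀ s, ‖fc f s‖ ≤ A * Real.exp (-r * l1 s) := by
  obtain ⟨M, -, hM⟩ := hf.exists_bound
  exact ⟨M, hf.norm_fc_le hr hrρ hM⟩

theorem exists_decay_mul {R R' A K : ℝ} (hK : 0 ≤ K) {a c : (Fin N → ℤ) → ℂ}
    (ha : ∀ s, ‖a s‖ ≤ A * Real.exp (-R * l1 s))
    (hc : ∀ s, ‖c s‖ ≤ K * Real.exp ((R - R') * l1 s)) (s : Fin N → ℤ) :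
    ‖c s * a s‖ ≤ (K * A) * Real.exp (-R' * l1 s) := by
  rw [norm_mul]
  calc _ ≤ (K * Real.exp ((R - R') * l1 s)) * (A * Real.exp (-R * l1 s)) :=
        mul_le_mul (hc s) (ha s) (norm_nonneg _) (by positivity)
    _ = (K * A) * (Real.exp ((R - R') * l1 s) * Real.exp (-R * l1 s)) := by ring
    _ = _ := by rw [← Real.exp_add]; ring_nf

theorem MemA.pd_eqOn {ρ : ℝ} {f : (Fin N → ℂ) → ℂ} (hf : MemA ρ 0 f)
    (j : Fin N) : EqOn (pd j f) (Ser (fun s => Complex.I * (s j : ℂ) * fc f s)) (stripInt ρ) := by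
  intro ξ hξ
  have hρ : 0 < ρ := (abs_nonneg _).trans_lt (hξ j)
  -- The coordinate with the largest imaginary part determines a smaller strip still containing `ξ`,
  -- on which the series may be differentiated termwise.
  obtain ⟨i, hi⟩ := (haveI : Nonempty (Fin N) := ⟨j⟩; Finite.exists_max (fun j => |(ξ j).im|))
  obtain ⟨r, h1, h2⟩ := exists_between (hξ i)
  obtain ⟨R, h3, h4⟩ := exists_between h2
  have hr0 : 0 < r := (abs_nonneg _).trans_lt h1
  have hξr : ξ ∈ stripInt r := fun j => (hi j).trans_lt h1
  obtain ⟨A, hA⟩ := hf.exists_decay (by linarith) h4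
  rw [← Ser.pd hr0 h3 hA hξr, pd, pd]
  congr 1
  exact Filter.EventuallyEq.fderiv_eq
    (Filter.eventuallyEq_of_mem ((isOpen_stripInt ρ).mem_nhds hξ) (hf.eqOn_Ser hρ))

theorem norm_I_mul_le {δ : ℝ} (hδ : 0 < δ) (s : Fin N → ℤ) (j : Fin N) :
    ‖Complex.I * (s j : ℂ)‖ ≤ δ⁻¹ * Real.exp (δ * l1 s) := by
  rw [norm_mul, Complex.norm_I, one_mul, Complex.norm_intCast]
  exact (abs_le_l1 s j).trans (l1_mul_exp_le hδ s)

theorem MemA.pd_memA {r ρ : ℝ} (hr : 0 < r) (hrρ : r < ρ) {f : (Fin N → ℂ) → ℂ}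
    (hf : MemA ρ 0 f) (j : Fin N) : MemA r 0 (pd j f) := by
  obtain ⟨R, h1, h2⟩ := exists_between hrρ
  obtain ⟨R', h3, h4⟩ := exists_between h1
  obtain ⟨A, hA⟩ := hf.exists_decay (by linarith) h2
  have h5 := exists_decay_mul (R := R) (R' := R') (c := fun s => Complex.I * (s j : ℂ))
    (inv_pos.2 (sub_pos.2 h4)).le hA (fun s => norm_I_mul_le (sub_pos.2 h4) s j)
  refine (Ser.memA hr h3 h5).congr ?_
  exact (hf.pd_eqOn j).mono (strip_subset_stripInt hrρ)

theorem MemA.fc_pd {ρ : ℝ} (hρ : 0 < ρ) {f : (Fin N → ℂ) → ℂ} (hf : MemA ρ 0 f) (j : Fin N)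
    (s : Fin N → ℤ) : fc (pd j f) s = Complex.I * (s j : ℂ) * fc f s := by
  obtain ⟨R, h1, h2⟩ := exists_between hρ
  obtain ⟨R', h3, h4⟩ := exists_between h1
  obtain ⟨A, hA⟩ := hf.exists_decay (by linarith) h2
  have h5 := exists_decay_mul (R := R) (R' := R') (c := fun s => Complex.I * (s j : ℂ))
    (inv_pos.2 (sub_pos.2 h4)).le hA (fun s => norm_I_mul_le (sub_pos.2 h4) s j)
  rw [← fc_Ser (summable_of_decay_pos h3 h5) s]
  exact fc_congr (fun x => hf.pd_eqOn j (realPt_mem_stripInt hρ x)) s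

end

end JacobiTorus

namespace JacobiTorus

noncomputable section

open MeasureTheory Set Filter Topology

variable {N : ℕ}

/-! ### Products and uniform bounds for families of functions -/

/-- Only one factor has to have summable coefficients: it is expanded and integrated term by term
against the other, which is merely continuous on the torus. This asymmetry allows the second factor
to be controlled by growing bounds. -/
theorem hasSum_fc_mul {h f : (Fin N → ℂ) → ℂ} (hh : TC h) (hs : Summable (fc h)) (hf : TC f)
    (s : Fin N → ℤ) :
    HasSum (fun t => fc h t * fc f (s - t)) (fc (fun ξ => h ξ * f ξ) s) := by
  have hcont : ∀ t : Fin N → ℤ, Continuous fun x : Fin N → ℝ => chr (-s) (realPt x) *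
      (fc h t * chr t (realPt x) * f (realPt x)) := fun t =>
    ((chr_continuous _).comp realPt_continuous).mul
      ((continuous_const.mul ((chr_continuous _).comp realPt_continuous)).mul hf.cont)
  have h2 : HasSum (fun t => mean (fun ξ => chr (-s) ξ * (fc h t * chr t ξ * f ξ)))
      (fc (fun ξ => h ξ * f ξ) s) := by
    unfold mean
    rw [fc, mean]
    unfold torusInt
    refine HasSum.mul_left _ ?_
    refine hasSum_integral_of_dominated_convergence
      (fun t x => ‖fc h t‖ * ‖f (realPt x)‖)
      (fun t => (hcont t).aestronglyMeasurable) (fun t => Eventually.of_forall fun x => ?_)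
      (Eventually.of_forall fun x => hs.norm.mul_right _) ?_ (Eventually.of_forall fun x => ?_)
    · have e1 := norm_chr_realPt (-s) x
      have e2 := norm_chr_realPt t x
      unfold realPt at e1 e2 ⊢
      rw [norm_mul, norm_mul, norm_mul, e1, e2]
      simp
    · simp only [tsum_mul_right]
      exact (continuous_const.mul hf.cont.norm).continuousOn.integrableOn_compact isCompact_Icc
    · exact ((hh.hasSum hs x).mul_right _).mul_left _
  refine h2.congr_fun fun t => ?_
  rw [← fc_chr_mul, ← fc_const_mul]
  refine congrArg mean (funext fun ξ => ?_)
  ring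

variable {I : Type*}

/-- A family of constants is `O(A)`. -/
def Bc (A : I → ℝ) (x : I → ℂ) : Prop := ∃ K, 0 ≤ K ∧ ∀ i, ‖x i‖ ≤ K * A i

/-- A family of functions on the torus whose Fourier coefficients are `O(A e^{-r|s|})`. -/
def Bd (r : ℝ) (A : I → ℝ) (f : I → (Fin N → ℂ) → ℂ) : Prop :=
  (∀ i, TC (f i)) ∧ ∃ K, 0 ≤ K ∧ ∀ i s, ‖fc (f i) s‖ ≤ K * A i * Real.exp (-r * l1 s)

/-- Domination of weights. -/
def Le (A B : I → ℝ) : Prop := ∃ C, 0 ≤ C ∧ ∀ i, A i ≤ C * B i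

theorem Le.of_le {A B : I → ℝ} (h : ∀ i, A i ≤ B i) : Le A B := ⟨1, zero_le_one, by simpa using h⟩

theorem Bc.mono {A B : I → ℝ} {x : I → ℂ} (hx : Bc A x) (h : Le A B) : Bc B x := by
  obtain ⟨K, hK, h1⟩ := hx
  obtain ⟨C, hC, h2⟩ := h
  exact ⟨K * C, by positivity, fun i => (h1 i).trans (by
    rw [mul_assoc]; exact mul_le_mul_of_nonneg_left (h2 i) hK)⟩

theorem Bc.congr' {A : I → ℝ} {x y : I → ℂ} (hx : Bc A x) (h : ∀ i, y i = x i) : Bc A y := by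
  rwa [funext h]

theorem Bc.add {A : I → ℝ} {x y : I → ℂ} (hx : Bc A x) (hy : Bc A y) :
    Bc A (fun i => x i + y i) := by
  obtain ⟨K, hK, h1⟩ := hx
  obtain ⟨L, hL, h2⟩ := hy
  exact ⟨K + L, by positivity, fun i => (norm_add_le _ _).trans (by linarith [h1 i, h2 i])⟩

theorem Bc.neg {A : I → ℝ} {x : I → ℂ} (hx : Bc A x) : Bc A (fun i => -x i) := by
  obtain ⟨K, hK, h1⟩ := hx
  exact ⟨K, hK, fun i => by rw [norm_neg]; exact h1 i⟩

theorem Bc.sub {A : I → ℝ} {x y : I → ℂ} (hx : Bc A x) (hy : Bc A y) :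
    Bc A (fun i => x i - y i) := by
  simpa [sub_eq_add_neg] using hx.add hy.neg

theorem Bc.const_mul {A : I → ℝ} (c : ℂ) {x : I → ℂ} (hx : Bc A x) : Bc A (fun i => c * x i) := by
  obtain ⟨K, hK, h1⟩ := hx
  refine ⟨‖c‖ * K, by positivity, fun i => ?_⟩
  rw [norm_mul, mul_assoc]
  exact mul_le_mul_of_nonneg_left (h1 i) (norm_nonneg _)

theorem Bc.zero {A : I → ℝ} : Bc A (fun _ => 0) := ⟨0, le_rfl, by simp⟩

theorem Bc.sum {A : I → ℝ} {κ : Type*} (t : Finset κ) {x : κ → I → ℂ} (hx : ∀ j, Bc A (x j)) :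
    Bc A (fun i => ∑ j ∈ t, x j i) := by
  classical
  induction t using Finset.induction_on with
  | empty => simpa using Bc.zero
  | insert a t ha ih =>
    simp only [Finset.sum_insert ha]
    exact (hx a).add ih

theorem Bd.tc {r : ℝ} {A : I → ℝ} {f : I → (Fin N → ℂ) → ℂ} (hf : Bd r A f) (i : I) : TC (f i) :=
  hf.1 i

theorem Bd.mono {r : ℝ} {A B : I → ℝ} {f : I → (Fin N → ℂ) → ℂ} (hf : Bd r A f) (h : Le A B) :
    Bd r B f := by
  obtain ⟨K, hK, h1⟩ := hf.2
  obtain ⟨C, hC, h2⟩ := h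
  refine ⟨hf.1, K * C, by positivity, fun i s => (h1 i s).trans ?_⟩
  rw [mul_assoc K C]
  have := mul_le_mul_of_nonneg_left (h2 i) hK
  gcongr

theorem Bd.anti {r r' : ℝ} (h : r' ≤ r) {A : I → ℝ} {f : I → (Fin N → ℂ) → ℂ} (hf : Bd r A f) :
    Bd r' A f := by
  obtain ⟨K, hK, h1⟩ := hf.2
  refine ⟨hf.1, K, hK, fun i s => (h1 i s).trans ?_⟩
  have h2 : 0 ≤ K * A i := by
    have := (norm_nonneg _).trans (h1 i 0)
    simpa [l1] using this
  have h3 := l1_nonneg s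
  gcongr

theorem Bd.add {r : ℝ} {A : I → ℝ} {f g : I → (Fin N → ℂ) → ℂ} (hf : Bd r A f) (hg : Bd r A g) :
    Bd r A (fun i ξ => f i ξ + g i ξ) := by
  obtain ⟨K, hK, h1⟩ := hf.2
  obtain ⟨L, hL, h2⟩ := hg.2
  refine ⟨fun i => (hf.1 i).add (hg.1 i), K + L, by positivity, fun i s => ?_⟩
  rw [fc_add (hf.1 i) (hg.1 i), add_mul, add_mul]
  exact (norm_add_le _ _).trans (add_le_add (h1 i s) (h2 i s))

theorem Bd.neg {r : ℝ} {A : I → ℝ} {f : I → (Fin N → ℂ) → ℂ} (hf : Bd r A f) :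
    Bd r A (fun i ξ => -f i ξ) := by
  obtain ⟨K, hK, h1⟩ := hf.2
  exact ⟨fun i => (hf.1 i).neg, K, hK, fun i s => by rw [fc_neg, norm_neg]; exact h1 i s⟩

theorem Bd.sub {r : ℝ} {A : I → ℝ} {f g : I → (Fin N → ℂ) → ℂ} (hf : Bd r A f) (hg : Bd r A g) :
    Bd r A (fun i ξ => f i ξ - g i ξ) := by
  simpa [sub_eq_add_neg] using hf.add hg.neg

theorem Bd.const {A : I → ℝ} {x : I → ℂ} (hx : Bc A x) (r : ℝ) :
    Bd (N := N) r A (fun i _ => x i) := by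
  obtain ⟨K, hK, h1⟩ := hx
  refine ⟨fun i => TC.const _, K, hK, fun i s => ?_⟩
  rw [fc_const]
  split_ifs with h
  · subst h; simpa [l1] using h1 i
  · rw [norm_zero]
    have := (norm_nonneg _).trans (h1 i)
    positivity

theorem Bd.zero {r : ℝ} {A : I → ℝ} : Bd (N := N) r A (fun _ _ => 0) := Bd.const Bc.zero r

theorem Bd.sum {r : ℝ} {A : I → ℝ} {κ : Type*} (t : Finset κ) {f : κ → I → (Fin N → ℂ) → ℂ}
    (hf : ∀ j, Bd r A (f j)) : Bd r A (fun i ξ => ∑ j ∈ t, f j i ξ) := by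
  classical
  induction t using Finset.induction_on with
  | empty => simpa using Bd.zero
  | insert a t ha ih =>
    simp only [Finset.sum_insert ha]
    exact (hf a).add ih

theorem Bd.smul {r : ℝ} {A B : I → ℝ} {x : I → ℂ} {f : I → (Fin N → ℂ) → ℂ} (hx : Bc A x)
    (hf : Bd r B f) : Bd r (fun i => A i * B i) (fun i ξ => x i * f i ξ) := by
  obtain ⟨K, hK, h1⟩ := hx
  obtain ⟨L, hL, h2⟩ := hf.2
  refine ⟨fun i => (TC.const _).mul (hf.1 i), K * L, by positivity, fun i s => ?_⟩
  rw [fc_const_mul, norm_mul]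
  calc _ ≤ (K * A i) * (L * B i * Real.exp (-r * l1 s)) :=
        mul_le_mul (h1 i) (h2 i s) (norm_nonneg _) ((norm_nonneg _).trans (h1 i))
    _ = _ := by ring

theorem Bd.const_mul {r : ℝ} {A : I → ℝ} (c : ℂ) {f : I → (Fin N → ℂ) → ℂ} (hf : Bd r A f) :
    Bd r A (fun i ξ => c * f i ξ) := by
  have := Bd.smul (A := fun _ => 1) (x := fun _ => c) ⟨‖c‖, norm_nonneg _, by simp⟩ hf
  simpa using this

theorem Bd.mean {r : ℝ} {A : I → ℝ} {f : I → (Fin N → ℂ) → ℂ} (hf : Bd r A f) :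
    Bc A (fun i => mean (f i)) := by
  obtain ⟨K, hK, h1⟩ := hf.2
  refine ⟨K, hK, fun i => ?_⟩
  have := h1 i 0
  rw [fc_zero] at this
  simpa [l1] using this

theorem Bd.congr {r : ℝ} {A : I → ℝ} {f g : I → (Fin N → ℂ) → ℂ} (hf : Bd r A f)
    (h : ∀ i ξ, g i ξ = f i ξ) : Bd r A g := by
  have : g = f := funext fun i => funext fun ξ => h i ξ
  rwa [this]

/-- Multiplication by a family that decays faster than the other one grows. -/
theorem Bd.mul {ρ r : ℝ} (hr : |r| < ρ) {H A : I → ℝ} {h f : I → (Fin N → ℂ) → ℂ}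
    (hh : Bd ρ H h) (hf : Bd r A f) : Bd r (fun i => H i * A i) (fun i ξ => h i ξ * f i ξ) := by
  obtain ⟨K, hK, h1⟩ := hh.2
  obtain ⟨L, hL, h2⟩ := hf.2
  have hρ : 0 < ρ := (abs_nonneg r).trans_lt hr
  have hS := summable_exp_l1 (N := N) (sub_pos.2 hr)
  refine ⟨fun i => (hh.1 i).mul (hf.1 i),
    K * L * ∑' t : Fin N → ℤ, Real.exp (-(ρ - |r|) * l1 t), ?_, fun i s => ?_⟩
  · exact mul_nonneg (by positivity) (tsum_nonneg fun _ => (Real.exp_pos _).le)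
  have hKH : 0 ≤ K * H i := by
    have := (norm_nonneg _).trans (h1 i 0)
    simpa [l1] using this
  have hLA : 0 ≤ L * A i := by
    have := (norm_nonneg _).trans (h2 i 0)
    simpa [l1] using this
  have h3 := hasSum_fc_mul (hh.1 i) (summable_of_decay_pos hρ (h1 i)) (hf.1 i) s
  have h4 : ∀ t, ‖fc (h i) t * fc (f i) (s - t)‖ ≤
      (K * H i * (L * A i) * Real.exp (-r * l1 s)) * Real.exp (-(ρ - |r|) * l1 t) := by
    intro t
    rw [norm_mul]
    -- The sign of `r` decides which triangle inequality is used: `l1 s ≤ l1 (s - t) + l1 t` for `r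
    -- ≥ 0`, and `l1 (s - t) ≤ l1 s + l1 t` for `r ≤ 0`.
    have h5 : -r * l1 (s - t) ≤ -r * l1 s + |r| * l1 t := by
      have e1 := l1_add_le (s - t) t
      have e2 := l1_add_le s (-t)
      rw [l1_neg, ← sub_eq_add_neg] at e2
      rw [sub_add_cancel] at e1
      rcases le_total 0 r with h | h
      · rw [abs_of_nonneg h]; nlinarith
      · rw [abs_of_nonpos h]; nlinarith
    calc _ ≤ (K * H i * Real.exp (-ρ * l1 t)) * (L * A i * Real.exp (-r * l1 (s - t))) :=
          mul_le_mul (h1 i t) (h2 i (s - t)) (norm_nonneg _) (by positivity)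
      _ ≤ (K * H i * Real.exp (-ρ * l1 t)) * (L * A i * Real.exp (-r * l1 s + |r| * l1 t)) := by
          gcongr
      _ = (K * H i * (L * A i)) * (Real.exp (-ρ * l1 t) * Real.exp (-r * l1 s + |r| * l1 t)) := by
          ring
      _ = (K * H i * (L * A i)) * (Real.exp (-r * l1 s) * Real.exp (-(ρ - |r|) * l1 t)) := by
          rw [← Real.exp_add, ← Real.exp_add]; ring_nf
      _ = _ := by ring
  have h5 := tsum_of_norm_bounded (hS.mul_left _).hasSum h4
  rw [h3.tsum_eq, tsum_mul_left] at h5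
  refine h5.trans (le_of_eq ?_)
  ring

/-- A family given at nonzero frequencies by Fourier multipliers of subexponential growth. -/
theorem Bd.of_multiplier {r δ K : ℝ} (hK : 0 ≤ K) {A : I → ℝ}
    {f f' g : I → (Fin N → ℂ) → ℂ} (hg : ∀ i, TC (g i)) (hg0 : Bc A (fun i => JacobiTorus.mean (g i)))
    (hf : Bd r A f) (hf' : Bd r A f')
    (h : ∀ i, ∀ s ≠ 0, ‖fc (g i) s‖ ≤ K * Real.exp (δ * l1 s) * (‖fc (f i) s‖ + ‖fc (f' i) s‖)) :
    Bd (r - δ) A g := by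
  obtain ⟨K₀, hK₀, h0⟩ := hg0
  obtain ⟨K₁, hK₁, h1⟩ := hf.2
  obtain ⟨K₂, hK₂, h2⟩ := hf'.2
  refine ⟨hg, K₀ + K * (K₁ + K₂), by positivity, fun i s => ?_⟩
  have e0 : 0 ≤ K₀ * A i := (norm_nonneg _).trans (h0 i)
  have e1 : 0 ≤ K₁ * A i := by
    have := (norm_nonneg _).trans (h1 i 0)
    simpa [l1] using this
  have e2 : 0 ≤ K₂ * A i := by
    have := (norm_nonneg _).trans (h2 i 0)
    simpa [l1] using this
  by_cases hs : s = 0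
  · subst hs
    have := h0 i
    rw [fc_zero]
    simp only [l1, Pi.zero_apply, Int.cast_zero, abs_zero, Finset.sum_const_zero, mul_zero,
      Real.exp_zero, mul_one]
    nlinarith [mul_nonneg hK e1, mul_nonneg hK e2]
  · calc _ ≤ K * Real.exp (δ * l1 s) * (K₁ * A i * Real.exp (-r * l1 s) +
          K₂ * A i * Real.exp (-r * l1 s)) := (h i s hs).trans (by
            have := h1 i s
            have := h2 i s
            gcongr)
      _ = K * (K₁ * A i + K₂ * A i) * (Real.exp (δ * l1 s) * Real.exp (-r * l1 s)) := by ring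
      _ = K * (K₁ * A i + K₂ * A i) * Real.exp (-(r - δ) * l1 s) := by
          rw [← Real.exp_add]; ring_nf
      _ ≤ _ := by
          have : K * (K₁ * A i + K₂ * A i) ≤ (K₀ + K * (K₁ + K₂)) * A i := by nlinarith
          gcongr

/-! Small divisors. -/

/-- The divisor `ω·s`. -/
def dv (ω : Fin N → ℝ) (s : Fin N → ℤ) : ℝ := ∑ j, ω j * (s j : ℝ)

/-- Nonzero divisors with inverses of subexponential growth. -/
def SmallDiv (ω : Fin N → ℝ) : Prop :=
  ∀ δ > 0, ∃ K, 1 ≤ K ∧ ∀ s : Fin N → ℤ, s ≠ 0 → dv ω s ≠ 0 ∧ |dv ω s|⁻¹ ≤ K * Real.exp (δ * l1 s)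

/-- A polynomial is dominated by an exponential through `xⁿ / n! ≤ eˣ` with `x = δ l1 s`. Only this
subexponential form of the Diophantine condition enters the estimates. -/
theorem Diophantine.smallDiv {n : ℕ} {ω : Fin (n - 1) → ℝ} {c₀ : ℝ} (h : Diophantine n ω c₀) :
    SmallDiv ω := by
  intro δ hδ
  -- The constant is kept at least `1`, so that `1 + |ω·s|⁻¹` can be bounded by twice the
  -- exponential bound.
  refine ⟨max 1 (|c₀| * (n.factorial / δ ^ n)), le_max_left _ _, fun s hs => ?_⟩
  obtain ⟨h1, h2⟩ := h s hs
  refine ⟨h1, h2.trans ?_⟩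
  have h3 : Real.sqrt (∑ j, (s j : ℝ) ^ 2) ≤ l1 s := by
    rw [Real.sqrt_le_left (l1_nonneg s), l1]
    have := Finset.sum_sq_le_sq_sum_of_nonneg (s := Finset.univ) (f := fun j => |(s j : ℝ)|)
      fun j _ => abs_nonneg _
    simpa using this
  have h4 := Real.pow_div_factorial_le_exp (δ * l1 s) (mul_nonneg hδ.le (l1_nonneg s)) n
  have h5 : Real.sqrt (∑ j, (s j : ℝ) ^ 2) ^ n ≤ (n.factorial / δ ^ n) * Real.exp (δ * l1 s) := by
    have hf : (0 : ℝ) < n.factorial := by exact_mod_cast n.factorial_pos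
    have hd : 0 < δ ^ n := by positivity
    rw [mul_pow, div_le_iff₀ hf] at h4
    rw [div_mul_eq_mul_div, le_div_iff₀ hd]
    calc _ ≤ l1 s ^ n * δ ^ n := by gcongr
      _ ≤ _ := by linarith
  calc _ ≤ |c₀| * ((n.factorial / δ ^ n) * Real.exp (δ * l1 s)) := by
        refine mul_le_mul (le_abs_self _) h5 (by positivity) (abs_nonneg _)
    _ = (|c₀| * (n.factorial / δ ^ n)) * Real.exp (δ * l1 s) := by ring
    _ ≤ _ := by gcongr; exact le_max_right _ _

end

end JacobiTorus

namespace JacobiTorus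

noncomputable section

open MeasureTheory Set Filter Topology

variable {N : ℕ}

/-! ### A priori estimates for the linear system in Fourier variables -/

/-- The inhomogeneity of the `λ`-equation. -/
def lamF (D : Coeffs N) (g₂ : (Fin N → ℂ) → (Fin 2 → ℂ)) (μ : (Fin N → ℂ) → (Fin N → ℂ)) (p : ℂ)
    (a : Fin 2) : (Fin N → ℂ) → ℂ :=
  fun ξ => (∑ j, D.T ξ a j * μ ξ j) + p * D.W ξ 0 a - g₂ ξ a

/-- The inhomogeneity of the `χ`-equation. -/
def chiF (D : Coeffs N) (μ : (Fin N → ℂ) → (Fin N → ℂ)) (lam : (Fin N → ℂ) → (Fin 2 → ℂ))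
    (j : Fin N) : (Fin N → ℂ) → ℂ :=
  fun ξ => (∑ l, D.S ξ j l * μ ξ l) + ∑ a, D.T ξ a j * lam ξ a

/-- The equations for `μ` and `λ` in Fourier variables, with mean values `m` of `μ` and `b` of the
first component of `λ`, up to a constant residual `r` in the first `λ`-equation. -/
structure FSys (ω : Fin N → ℝ) (k : ℝ) (D : Coeffs N) (g₁ : (Fin N → ℂ) → ℂ)
    (g₂ : (Fin N → ℂ) → (Fin 2 → ℂ)) (μ : (Fin N → ℂ) → (Fin N → ℂ))
    (lam : (Fin N → ℂ) → (Fin 2 → ℂ)) (m : Fin N → ℂ) (p b r : ℂ) : Prop where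
  tcμ : ∀ j, TC (fun ξ => μ ξ j)
  tcl : ∀ a, TC (fun ξ => lam ξ a)
  meanμ : ∀ j, mean (fun ξ => μ ξ j) = m j
  meanl : mean (fun ξ => lam ξ 0) = b
  eqμ : ∀ j s, Complex.I * dv ω s * fc (fun ξ => μ ξ j) s =
    -(Complex.I * s j * (p * fc (dev D.w₁) s + fc g₁ s))
  eq0 : ∀ s, Complex.I * dv ω s * fc (fun ξ => lam ξ 1) s - k * fc (fun ξ => lam ξ 0) s +
    fc (lamF D g₂ μ p 0) s = if s = 0 then r else 0
  eq1 : ∀ s, -(Complex.I * dv ω s * fc (fun ξ => lam ξ 0) s) + fc (fun ξ => lam ξ 1) s +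
    fc (lamF D g₂ μ p 1) s = 0

/-- The equation for `χ` in Fourier variables, with mean value `x` and constant residual `q`. -/
structure FChi (ω : Fin N → ℝ) (D : Coeffs N) (μ : (Fin N → ℂ) → (Fin N → ℂ))
    (lam : (Fin N → ℂ) → (Fin 2 → ℂ)) (χ : (Fin N → ℂ) → (Fin N → ℂ)) (x q : Fin N → ℂ) :
    Prop where
  tcχ : ∀ j, TC (fun ξ => χ ξ j)
  meanχ : ∀ j, mean (fun ξ => χ ξ j) = x j
  eqχ : ∀ j s, -(Complex.I * dv ω s * fc (fun ξ => χ ξ j) s) + fc (chiF D μ lam j) s =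
    if s = 0 then q j else 0

variable {I : Type*}

/-- Uniform closeness of a family of coefficients to the unperturbed ones. -/
structure Near (ρ : ℝ) (E : I → ℝ) (S₀ : Matrix (Fin N) (Fin N) ℂ) (t₀ : Fin N → ℂ)
    (D : I → Coeffs N) : Prop where
  w : Bd ρ E (fun i => dev (D i).w₁)
  W : ∀ a b, Bd ρ E (fun i ξ => (D i).W ξ a b - (1 : Matrix (Fin 2) (Fin 2) ℂ) a b)
  V : ∀ a b, Bd ρ E (fun i ξ => ((D i).V ξ)⁻¹ a b - (1 : Matrix (Fin N) (Fin N) ℂ) a b)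
  S : ∀ a b, Bd ρ E (fun i ξ => (D i).S ξ a b - S₀ a b)
  T0 : ∀ j, Bd ρ E (fun i ξ => (D i).T ξ 0 j)
  T1 : ∀ j, Bd ρ E (fun i ξ => (D i).T ξ 1 j - t₀ j)

theorem Bd.sub_mean {r : ℝ} {Q : I → ℝ} {f : I → (Fin N → ℂ) → ℂ} {x : I → ℂ}
    (h : Bd r Q (fun i ξ => f i ξ - x i)) (hf : ∀ i, TC (f i)) :
    Bc Q (fun i => JacobiTorus.mean (f i) - x i) := by
  have := h.mean
  simpa only [mean_sub (hf _) (TC.const _), mean_const] using this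

theorem Bd.mul_le {ρ r : ℝ} (hr : |r| < ρ) {H A B : I → ℝ} {h f : I → (Fin N → ℂ) → ℂ}
    (hh : Bd ρ H h) (hf : Bd r A f) (hAB : Le (fun i => H i * A i) B) :
    Bd r B (fun i ξ => h i ξ * f i ξ) := (Bd.mul hr hh hf).mono hAB

theorem fc_sub_const {f : (Fin N → ℂ) → ℂ} (hf : TC f) (c : ℂ) {s : Fin N → ℤ} (hs : s ≠ 0) :
    fc (fun ξ => f ξ - c) s = fc f s := by
  rw [fc_sub hf (TC.const c), fc_const, if_neg hs, sub_zero]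

/-- Inverting `ω·∇`. -/
theorem Bd.of_transport {ω : Fin N → ℝ} (hω : SmallDiv ω) {r δ : ℝ} (hδ : 0 < δ) {Y : I → ℝ}
    {f g : I → (Fin N → ℂ) → ℂ} (hg : ∀ i, TC (g i))
    (hg0 : Bc Y (fun i => JacobiTorus.mean (g i))) (hf : Bd r Y f)
    (h : ∀ i, ∀ s ≠ 0, ‖Complex.I * dv ω s * fc (g i) s‖ ≤
      δ⁻¹ * Real.exp (δ * l1 s) * ‖fc (f i) s‖) : Bd (r - 2 * δ) Y g := by
  obtain ⟨K, hK, hd⟩ := hω δ hδ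
  refine Bd.of_multiplier (K := K * δ⁻¹) (by positivity) hg hg0 hf Bd.zero fun i s hs => ?_
  obtain ⟨h1, h2⟩ := hd s hs
  have h3 := h i s hs
  rw [norm_mul, norm_mul, Complex.norm_I, one_mul, Complex.norm_real, Real.norm_eq_abs] at h3
  have h4 : 0 < |dv ω s| := abs_pos.2 h1
  -- One `δ` is spent on the divisor and one on the derivative permitted on the right-hand side.
  calc ‖fc (g i) s‖ = |dv ω s|⁻¹ * (|dv ω s| * ‖fc (g i) s‖) := by field_simp
    _ ≤ (K * Real.exp (δ * l1 s)) * (δ⁻¹ * Real.exp (δ * l1 s) * ‖fc (f i) s‖) := by gcongr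
    _ = K * δ⁻¹ * (Real.exp (δ * l1 s) * Real.exp (δ * l1 s)) * ‖fc (f i) s‖ := by ring
    _ = K * δ⁻¹ * Real.exp (2 * δ * l1 s) * ‖fc (f i) s‖ := by rw [← Real.exp_add]; ring_nf
    _ ≤ _ := by gcongr; exact le_add_of_nonneg_right (norm_nonneg _)

/-- Inverting the `2 × 2` system at a nonzero frequency. -/
theorem norm_le_of_block {a k : ℝ} (ha : a ≠ 0) (hk : 0 ≤ k) {u v F G : ℂ}
    (h0 : Complex.I * a * v - k * u + F = 0) (h1 : -(Complex.I * a * u) + v + G = 0) :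
    ‖u‖ ≤ (1 + |a|⁻¹) ^ 2 * (‖F‖ + ‖G‖) ∧ ‖v‖ ≤ (1 + |a|⁻¹) ^ 2 * (‖F‖ + ‖G‖) := by
  have ha' : 0 < |a| := abs_pos.2 ha
  have hI : Complex.I * Complex.I = -1 := Complex.I_mul_I
  -- The determinant of the block. Its lower bound `a²` does not involve `k`, which makes the result
  -- uniform down to `k = 0`.
  have hd : 0 < a ^ 2 + k := by positivity
  have hsq : |a| * |a| = a ^ 2 := by rw [← sq, sq_abs]
  have hu : ((a ^ 2 + k : ℝ) : ℂ) * u = F - Complex.I * a * G := by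
    push_cast
    linear_combination (-1) * h0 + Complex.I * a * h1 + a ^ 2 * u * hI
  have hv : ((a ^ 2 + k : ℝ) : ℂ) * v = Complex.I * a * F - k * G := by
    push_cast
    linear_combination (k : ℂ) * h1 - Complex.I * a * h0 + a ^ 2 * v * hI
  have nu := congrArg norm hu
  have nv := congrArg norm hv
  rw [norm_mul, Complex.norm_real, Real.norm_eq_abs, abs_of_pos hd] at nu nv
  have bu : (a ^ 2 + k) * ‖u‖ ≤ ‖F‖ + |a| * ‖G‖ := by
    rw [nu]; refine (norm_sub_le _ _).trans (le_of_eq ?_); simp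
  have bv : (a ^ 2 + k) * ‖v‖ ≤ |a| * ‖F‖ + k * ‖G‖ := by
    rw [nv]; refine (norm_sub_le _ _).trans (le_of_eq ?_); simp [abs_of_nonneg hk]
  set q := |a|⁻¹ with hq
  have hqa : q * |a| = 1 := inv_mul_cancel₀ ha'.ne'
  have hq0 : 0 < q := inv_pos.2 ha'
  have hF := norm_nonneg F
  have hG := norm_nonneg G
  have e1 : q ^ 2 * a ^ 2 = 1 := by rw [← hsq]; linear_combination (q * |a| + 1) * hqa
  constructor
  · refine le_of_mul_le_mul_left (bu.trans ?_) hd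
    have e2 : |a| = q * a ^ 2 := by rw [← hsq]; linear_combination (-|a|) * hqa
    -- With `q = |a|⁻¹`, the slack of the claimed inequality is displayed as a sum of non-negative
    -- terms.
    have e3 : (a ^ 2 + k) * ((1 + q) ^ 2 * (‖F‖ + ‖G‖)) = ‖F‖ + |a| * ‖G‖ +
        (q ^ 2 * a ^ 2 * ‖G‖ + q * a ^ 2 * (2 * ‖F‖ + ‖G‖) + a ^ 2 * (‖F‖ + ‖G‖) +
          k * ((1 + q) ^ 2 * (‖F‖ + ‖G‖))) := by
      linear_combination ‖F‖ * e1 - ‖G‖ * e2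
    rw [e3]
    exact le_add_of_nonneg_right (by positivity)
  · refine le_of_mul_le_mul_left (bv.trans ?_) hd
    have e2 : |a| = q * a ^ 2 := by rw [← hsq]; linear_combination (-|a|) * hqa
    have e3 : (a ^ 2 + k) * ((1 + q) ^ 2 * (‖F‖ + ‖G‖)) = |a| * ‖F‖ + k * ‖G‖ +
        (a ^ 2 * q ^ 2 * (‖F‖ + ‖G‖) + q * a ^ 2 * (‖F‖ + 2 * ‖G‖) + a ^ 2 * (‖F‖ + ‖G‖) +
          k * (‖F‖ + (q ^ 2 + 2 * q) * (‖F‖ + ‖G‖))) := by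
      linear_combination (-‖F‖) * e2
    rw [e3]
    exact le_add_of_nonneg_right (by positivity)

/-- `norm_le_of_block` at each nonzero frequency: the square of the inverse divisor costs `2δ`, and
`k` does not enter the constant. The means are supplied separately, since the block says nothing
useful uniformly at `s = 0`. -/
theorem Bd.of_block {ω : Fin N → ℝ} (hω : SmallDiv ω) {r δ : ℝ} (hδ : 0 < δ) {Q k : I → ℝ}
    (hk : ∀ i, 0 ≤ k i) {F G u v : I → (Fin N → ℂ) → ℂ} (hu : ∀ i, TC (u i)) (hv : ∀ i, TC (v i))
    (hu0 : Bc Q (fun i => JacobiTorus.mean (u i))) (hv0 : Bc Q (fun i => JacobiTorus.mean (v i)))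
    (hF : Bd r Q F) (hG : Bd r Q G)
    (h0 : ∀ i, ∀ s ≠ 0, Complex.I * dv ω s * fc (v i) s - k i * fc (u i) s + fc (F i) s = 0)
    (h1 : ∀ i, ∀ s ≠ 0, -(Complex.I * dv ω s * fc (u i) s) + fc (v i) s + fc (G i) s = 0) :
    Bd (r - 2 * δ) Q u ∧ Bd (r - 2 * δ) Q v := by
  obtain ⟨K, hK, hd⟩ := hω δ hδ
  have key : ∀ s : Fin N → ℤ, s ≠ 0 →
      (1 + |dv ω s|⁻¹) ^ 2 ≤ 4 * K ^ 2 * Real.exp (2 * δ * l1 s) := by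
    intro s hs
    have h2 := (hd s hs).2
    have h3 : 1 ≤ K * Real.exp (δ * l1 s) := by
      have := Real.one_le_exp (mul_nonneg hδ.le (l1_nonneg s))
      nlinarith
    have h4 : Real.exp (2 * δ * l1 s) = Real.exp (δ * l1 s) ^ 2 := by
      rw [← Real.exp_nat_mul]; push_cast; ring_nf
    rw [h4]
    calc _ ≤ (K * Real.exp (δ * l1 s) + K * Real.exp (δ * l1 s)) ^ 2 := by gcongr
      _ = _ := by ring
  refine ⟨Bd.of_multiplier (K := 4 * K ^ 2) (by positivity) hu hu0 hF hG fun i s hs => ?_,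
    Bd.of_multiplier (K := 4 * K ^ 2) (by positivity) hv hv0 hF hG fun i s hs => ?_⟩
  · refine (norm_le_of_block (hd s hs).1 (hk i) (h0 i s hs) (h1 i s hs)).1.trans ?_
    have := key s hs
    gcongr
  · refine (norm_le_of_block (hd s hs).1 (hk i) (h0 i s hs) (h1 i s hs)).2.trans ?_
    have := key s hs
    gcongr

section Estimates

variable {ω : Fin N → ℝ} {ρ r δ : ℝ} {E Y Q Z k : I → ℝ} {S₀ : Matrix (Fin N) (Fin N) ℂ}
  {t₀ : Fin N → ℂ} {D : I → Coeffs N} {g₁ : I → (Fin N → ℂ) → ℂ}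
  {g₂ : I → (Fin N → ℂ) → (Fin 2 → ℂ)} {μ : I → (Fin N → ℂ) → (Fin N → ℂ)}
  {lam : I → (Fin N → ℂ) → (Fin 2 → ℂ)} {χ : I → (Fin N → ℂ) → (Fin N → ℂ)}
  {m x q : I → Fin N → ℂ} {p b res : I → ℂ}

/-- The equation for `μ` is driven only by `p w₁* + g₁`, so its oscillation is as small as these
terms even when the mean `m` is not small. The gradient and the divisor together cost `2δ`. -/
theorem FSys.mu_estimate (hω : SmallDiv ω) (hδ : 0 < δ)
    (hw : Bd r Y (fun i ξ => p i * dev (D i).w₁ ξ)) (hg₁ : Bd r Y g₁)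
    (h : ∀ i, FSys ω (k i) (D i) (g₁ i) (g₂ i) (μ i) (lam i) (m i) (p i) (b i) (res i))
    (j : Fin N) : Bd (r - 2 * δ) Y (fun i ξ => μ i ξ j - m i j) := by
  refine Bd.of_transport hω hδ (fun i => ((h i).tcμ j).sub (TC.const _)) ?_ (hw.add hg₁)
    fun i s hs => ?_
  · simp only [mean_sub ((h _).tcμ j) (TC.const _), mean_const, (h _).meanμ, sub_self]
    exact Bc.zero
  · rw [fc_sub_const ((h i).tcμ j) _ hs, (h i).eqμ, fc_add (hw.tc i) (hg₁.tc i), fc_const_mul,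
      norm_neg, norm_mul]
    have := norm_I_mul_le hδ s j
    gcongr

/-- The main a priori estimate for the `(μ, λ)`-system. -/
theorem FSys.estimate (hω : SmallDiv ω) (hδ : 0 < δ) (hr : |r| < ρ) (hr' : |r - 2 * δ| < ρ)
    (hD : Near ρ E S₀ t₀ D) (hk : ∀ i, 0 ≤ k i)
    (hEZ : Le (fun i => E i * Z i) Y) (hYQ : Le Y Q) (hQZ : Le Q Z)
    (hm : ∀ j, Bc Z (fun i => m i j)) (hp : Bc Z p) (hb : Bc Z b)
    (hμ : ∀ j, Bd r Y (fun i ξ => μ i ξ j - m i j))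
    (hg₂ : ∀ a, Bd r Q (fun i ξ => g₂ i ξ a)) (hg₂m : ∀ a, Bc Y (fun i => mean (fun ξ => g₂ i ξ a)))
    (h : ∀ i, FSys ω (k i) (D i) (g₁ i) (g₂ i) (μ i) (lam i) (m i) (p i) (b i) (res i)) :
    Bc Y (fun i => res i - (p i - k i * b i)) ∧
    Bd (r - 2 * δ) Q (fun i ξ => lam i ξ 0 - b i) ∧
    Bd (r - 2 * δ) Q (fun i ξ => lam i ξ 1 + ∑ j, t₀ j * m i j) ∧
    (∀ a, Bd (r - 2 * δ) Z (fun i ξ => lam i ξ a)) ∧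
    ∀ j, Bd (r - 2 * δ) Z (fun i => chiF (D i) (μ i) (lam i) j) ∧
      Bc Y (fun i => mean (chiF (D i) (μ i) (lam i) j) -
        (∑ l, S₀ j l * m i l - t₀ j * ∑ l, t₀ l * m i l)) := by
  -- Three weights are in play: `Z` bounds the constants, `Y` the perturbative terms, and `Q` the
  -- oscillation of `λ`. Later `Q = Z` when the source `g₂` is not small, and `Q = Y` when there are
  -- no sources.
  have hYZ : Le Y Z := by
    obtain ⟨C, hC, h1⟩ := hYQ
    obtain ⟨C', hC', h2⟩ := hQZ
    exact ⟨C * C', by positivity, fun i => (h1 i).trans (by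
      rw [mul_assoc]; exact mul_le_mul_of_nonneg_left (h2 i) hC)⟩
  have hμZ : ∀ j, Bd r Z (fun i ξ => μ i ξ j) := fun j =>
    (((hμ j).mono hYZ).add (Bd.const (hm j) r)).congr fun i ξ => by ring
  have hrW : ∀ a, Bd r Y (fun i ξ => p i * ((D i).W ξ 0 a - (1 : Matrix (Fin 2) (Fin 2) ℂ) 0 a)) :=
    fun a => (Bd.mul_le hr (hD.W 0 a) (Bd.const hp r) hEZ).congr fun i ξ => by ring
  -- Before `g₂` is subtracted, the inhomogeneities equal their unperturbed constants `p` and `t₀·m`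
  -- up to order `Y`. The source is put back at order `Q`, but only its mean, of order `Y`, affects
  -- the zero modes.
  have hF0' : Bd r Y (fun i ξ => lamF (D i) (g₂ i) (μ i) (p i) 0 ξ + g₂ i ξ 0 - p i) := by
    refine ((Bd.sum Finset.univ fun j => Bd.mul_le hr (hD.T0 j) (hμZ j) hEZ).add
      (hrW 0)).congr fun i ξ => ?_
    simp only [lamF, Matrix.one_apply_eq]
    ring
  have hF1' : Bd r Y (fun i ξ => lamF (D i) (g₂ i) (μ i) (p i) 1 ξ + g₂ i ξ 1 -
      ∑ j, t₀ j * m i j) := by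
    refine ((Bd.sum Finset.univ fun j => (Bd.mul_le hr (hD.T1 j) (hμZ j) hEZ).add
      ((hμ j).const_mul (t₀ j))).add (hrW 1)).congr fun i ξ => ?_
    have e : ∀ j, (D i).T ξ 1 j * μ i ξ j = (((D i).T ξ 1 j - t₀ j) * μ i ξ j +
      t₀ j * (μ i ξ j - m i j)) + t₀ j * m i j := fun j => by ring
    simp only [lamF, e, Finset.sum_add_distrib]
    simp
    ring
  have hF0 : Bd r Q (fun i ξ => lamF (D i) (g₂ i) (μ i) (p i) 0 ξ - p i) :=
    ((hF0'.mono hYQ).sub (hg₂ 0)).congr fun i ξ => by ring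
  have hF1 : Bd r Q (fun i ξ => lamF (D i) (g₂ i) (μ i) (p i) 1 ξ - ∑ j, t₀ j * m i j) :=
    ((hF1'.mono hYQ).sub (hg₂ 1)).congr fun i ξ => by ring
  have htF0 : ∀ i, TC (lamF (D i) (g₂ i) (μ i) (p i) 0) := fun i => by
    have := (hF0.tc i).add (TC.const (p i))
    simpa using this
  have htF1 : ∀ i, TC (lamF (D i) (g₂ i) (μ i) (p i) 1) := fun i => by
    have := (hF1.tc i).add (TC.const (∑ j, t₀ j * m i j))
    simpa using this
  have hmF0 : Bc Y (fun i => mean (lamF (D i) (g₂ i) (μ i) (p i) 0) - p i) := by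
    have h1 := (Bd.sub_mean hF0' fun i => (htF0 i).add ((hg₂ 0).tc i)).sub (hg₂m 0)
    simp only [mean_add (htF0 _) ((hg₂ 0).tc _)] at h1
    simpa [add_sub_right_comm] using h1
  have hmF1 : Bc Y (fun i => mean (lamF (D i) (g₂ i) (μ i) (p i) 1) - ∑ j, t₀ j * m i j) := by
    have h1 := (Bd.sub_mean hF1' fun i => (htF1 i).add ((hg₂ 1).tc i)).sub (hg₂m 1)
    simp only [mean_add (htF1 _) ((hg₂ 1).tc _)] at h1
    simpa [add_sub_right_comm] using h1
  have hdv0 : dv ω 0 = 0 := by simp [dv]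
  -- Zero mode of the first `λ`-equation; that of the second, next, determines the mean of `λ₂`,
  -- which is `-t₀·m` to leading order.
  have hres : ∀ i, res i - (p i - k i * b i) = mean (lamF (D i) (g₂ i) (μ i) (p i) 0) - p i := by
    intro i
    have h1 := (h i).eq0 0
    simp only [hdv0, fc_zero, (h i).meanl, if_true] at h1
    rw [← h1]; push_cast; ring
  have hl1 : ∀ i, mean (fun ξ => lam i ξ 1) = -mean (lamF (D i) (g₂ i) (μ i) (p i) 1) := by
    intro i
    have h1 := (h i).eq1 0
    simp only [hdv0, fc_zero] at h1
    push_cast at h1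
    linear_combination h1
  have hv0 : Bc Y (fun i => mean (fun ξ => lam i ξ 1 + ∑ j, t₀ j * m i j)) := by
    refine hmF1.neg.congr' fun i => ?_
    rw [mean_add ((h i).tcl 1) (TC.const _), mean_const, hl1]
    ring
  -- The leading constants `b` and `-t₀·m` are removed first; the coefficients at nonzero
  -- frequencies are unaffected.
  have hblock := Bd.of_block hω hδ (r := r) (Q := Q) hk
    (u := fun i ξ => lam i ξ 0 - b i) (v := fun i ξ => lam i ξ 1 + ∑ j, t₀ j * m i j)
    (fun i => ((h i).tcl 0).sub (TC.const _)) (fun i => ((h i).tcl 1).add (TC.const _))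
    (by
      simp only [mean_sub ((h _).tcl 0) (TC.const _), mean_const, (h _).meanl, sub_self]
      exact Bc.zero) (hv0.mono hYQ) hF0 hF1
    (fun i s hs => by
      have h1 := (h i).eq0 s
      rw [if_neg hs] at h1
      rw [fc_sub_const ((h i).tcl 0) _ hs, fc_sub_const (htF0 i) _ hs,
        fc_add ((h i).tcl 1) (TC.const _), fc_const, if_neg hs, add_zero]
      exact h1)
    (fun i s hs => by
      have h1 := (h i).eq1 s
      rw [fc_sub_const ((h i).tcl 0) _ hs, fc_sub_const (htF1 i) _ hs,
        fc_add ((h i).tcl 1) (TC.const _), fc_const, if_neg hs, add_zero]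
      exact h1)
  obtain ⟨hu, hv⟩ := hblock
  have hc : Bc Z (fun i => ∑ j, t₀ j * m i j) :=
    Bc.sum Finset.univ fun j => (hm j).const_mul (t₀ j)
  have hlZ0 : Bd (r - 2 * δ) Z (fun i ξ => lam i ξ 0) :=
    ((hu.mono hQZ).add (Bd.const hb _)).congr fun i ξ => by ring
  have hlZ1 : Bd (r - 2 * δ) Z (fun i ξ => lam i ξ 1) :=
    ((hv.mono hQZ).sub (Bd.const hc _)).congr fun i ξ => by ring
  have hlZ : ∀ a, Bd (r - 2 * δ) Z (fun i ξ => lam i ξ a) := fun a => by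
    fin_cases a
    · exact hlZ0
    · exact hlZ1
  refine ⟨by simpa only [hres] using hmF0, hu, hv, hlZ, fun j => ?_⟩
  have hrd : r - 2 * δ ≤ r := by linarith
  have hsmall : Bd (r - 2 * δ) Y (fun i ξ => chiF (D i) (μ i) (lam i) j ξ -
      (∑ l, S₀ j l * m i l) - t₀ j * lam i ξ 1) := by
    refine (((Bd.sum Finset.univ fun l => (Bd.mul_le hr (hD.S j l) (hμZ l) hEZ).add
      ((hμ l).const_mul (S₀ j l))).anti hrd).add
      ((Bd.mul_le hr' (hD.T0 j) hlZ0 hEZ).add (Bd.mul_le hr' (hD.T1 j) hlZ1 hEZ))).congr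
      fun i ξ => ?_
    have e : ∀ l, (D i).S ξ j l * μ i ξ l = (((D i).S ξ j l - S₀ j l) * μ i ξ l +
      S₀ j l * (μ i ξ l - m i l)) + S₀ j l * m i l := fun l => by ring
    simp only [chiF, e, Fin.sum_univ_two]
    rw [Finset.sum_add_distrib]
    ring
  have hSm : Bc Z (fun i => ∑ l, S₀ j l * m i l) :=
    Bc.sum Finset.univ fun l => (hm l).const_mul (S₀ j l)
  have hchi : Bd (r - 2 * δ) Z (fun i => chiF (D i) (μ i) (lam i) j) :=
    (((hsmall.mono hYZ).add (Bd.const hSm _)).add (hlZ1.const_mul (t₀ j))).congr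
      fun i ξ => by ring
  refine ⟨hchi, ?_⟩
  -- Replacing the mean of `λ₂` by `-t₀·m` turns `S₀ m + t₀ λ₂` into `(S₀ - t₀ ⊗ t₀) m`.
  have h1 := hsmall.mean.add (hv0.const_mul (t₀ j))
  have e : ∀ i, mean (fun ξ => chiF (D i) (μ i) (lam i) j ξ - (∑ l, S₀ j l * m i l) -
      t₀ j * lam i ξ 1) = mean (chiF (D i) (μ i) (lam i) j) - (∑ l, S₀ j l * m i l) -
      t₀ j * mean (fun ξ => lam i ξ 1) := fun i => by
    rw [mean_sub ((hchi.tc i).sub (TC.const _)) ((hlZ1.const_mul (t₀ j)).tc i),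
      mean_sub (hchi.tc i) (TC.const _), mean_const, mean_const_mul]
  simp only [e, mean_add ((h _).tcl 1) (TC.const _), mean_const] at h1
  have e2 : (fun i => mean (chiF (D i) (μ i) (lam i) j) -
      (∑ l, S₀ j l * m i l - t₀ j * ∑ l, t₀ l * m i l)) = fun i =>
      mean (chiF (D i) (μ i) (lam i) j) - (∑ l, S₀ j l * m i l) - t₀ j * mean (fun ξ => lam i ξ 1) +
      t₀ j * (mean (fun ξ => lam i ξ 1) + ∑ l, t₀ l * m i l) := by
    funext i; ring
  rw [e2]
  exact h1

/-- The a priori estimate for `χ` and the normalisation conditions. -/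
theorem FChi.estimate (hω : SmallDiv ω) (hδ : 0 < δ) (hr : |r| < ρ) (hr' : |r - 2 * δ| < ρ)
    (hδ1 : δ ≤ 1)
    {ρ' : ℝ} (hρ' : |r - 2 * δ| < ρ') (hD : Near ρ E S₀ t₀ D)
    (hdw : ∀ j, Bd ρ' E (fun i => pd j (D i).w₁))
    (hEZ : Le (fun i => E i * Z i) Y)
    (hl : ∀ a, Bd r Z (fun i ξ => lam i ξ a)) (hlb : ∀ i, mean (fun ξ => lam i ξ 0) = b i)
    (hH : ∀ j, Bd r Z (fun i => chiF (D i) (μ i) (lam i) j))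
    (hx : ∀ j, Bc Z (fun i => x i j))
    (h : ∀ i, FChi ω (D i) (μ i) (lam i) (χ i) (x i) (q i)) :
    (∀ j, Bd (r - 2 * δ) Z (fun i ξ => χ i ξ j)) ∧
    Bc Y (fun i => mean (fun ξ => dotProduct (((D i).W ξ).mulVec (lam i ξ)) e₁)
      + mean (fun ξ => dotProduct (χ i ξ) (grad (D i).w₁ ξ)) - b i) ∧
    ∀ j, Bc Y (fun i => mean (fun ξ => (((D i).V ξ)⁻¹.transpose.mulVec (χ i ξ)) j) - x i j) := by
  have hχ : ∀ j, Bd (r - 2 * δ) Z (fun i ξ => χ i ξ j) := by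
    intro j
    refine Bd.of_transport hω hδ (fun i => (h i).tcχ j) ?_ (hH j) fun i s hs => ?_
    · simpa only [(h _).meanχ] using hx j
    · have h1 := (h i).eqχ j s
      rw [if_neg hs] at h1
      have h2 : Complex.I * dv ω s * fc (fun ξ => χ i ξ j) s = fc (chiF (D i) (μ i) (lam i) j) s := by
        linear_combination -h1
      rw [h2]
      -- There is no derivative on the right-hand side here; the factor that `Bd.of_transport`
      -- allows for one is at least `1` because `δ ≤ 1`.
      have h3 : 1 ≤ δ⁻¹ := (one_le_inv₀ hδ).2 hδ1
      have h4 := Real.one_le_exp (mul_nonneg hδ.le (l1_nonneg s))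
      have h5 : 1 ≤ δ⁻¹ * Real.exp (δ * l1 s) := by nlinarith
      nlinarith [norm_nonneg (fc (chiF (D i) (μ i) (lam i) j) s)]
  refine ⟨hχ, ?_, fun j => ?_⟩
  · have h1 := Bd.mul_le hr (hD.W 0 0) (hl 0) hEZ
    have h2 := Bd.mul_le hr (hD.W 0 1) (hl 1) hEZ
    have h3 := Bd.sum Finset.univ fun j => Bd.mul_le hρ' (hdw j) (hχ j) hEZ
    have h4 := (h1.mean.add h2.mean).add h3.mean
    refine h4.congr' ?_
    intro i
    have e1 : mean (fun ξ => dotProduct (((D i).W ξ).mulVec (lam i ξ)) e₁) =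
        mean (fun ξ => (((D i).W ξ 0 0 - (1 : Matrix (Fin 2) (Fin 2) ℂ) 0 0) * lam i ξ 0 +
          ((D i).W ξ 0 1 - (1 : Matrix (Fin 2) (Fin 2) ℂ) 0 1) * lam i ξ 1) + lam i ξ 0) := by
      congr 1; ext ξ
      simp [dotProduct, Matrix.mulVec, e₁, Fin.sum_univ_two]
      ring
    rw [e1, mean_add ((h1.tc i).add (h2.tc i)) ((hl 0).tc i), mean_add (h1.tc i) (h2.tc i), hlb]
    have e2 : (fun ξ => dotProduct (χ i ξ) (grad (D i).w₁ ξ)) =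
        fun ξ => ∑ j, pd j (D i).w₁ ξ * χ i ξ j := by
      ext ξ
      simp only [dotProduct, grad]
      exact Finset.sum_congr rfl fun j _ => mul_comm _ _
    rw [e2]
    ring
  · have h3 := Bd.sum Finset.univ fun l => Bd.mul_le hr' (hD.V l j) (hχ l) hEZ
    refine h3.mean.congr' ?_
    intro i
    have e1 : (fun ξ => (((D i).V ξ)⁻¹.transpose.mulVec (χ i ξ)) j) = fun ξ =>
        (∑ l, (((D i).V ξ)⁻¹ l j - (1 : Matrix (Fin N) (Fin N) ℂ) l j) * χ i ξ l) + χ i ξ j := by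
      ext ξ
      simp only [Matrix.mulVec, dotProduct, Matrix.transpose_apply, sub_mul,
        Finset.sum_sub_distrib]
      simp [Matrix.one_apply]
    rw [e1, mean_add (h3.tc i) ((h i).tcχ j), (h i).meanχ]
    ring

end Estimates

end

end JacobiTorus

namespace JacobiTorus

noncomputable section

open MeasureTheory Set Filter Topology

variable {N : ℕ}

/-! ### Functions on the open strip -/

/-- Functions that belong to the analytic space on every smaller closed strip. -/
def Loc (ρ : ℝ) (f : (Fin N → ℂ) → ℂ) : Prop := ∀ r, 0 < r → r < ρ → MemA r 0 f

theorem MemA.loc {ρ : ℝ} {f : (Fin N → ℂ) → ℂ} (hf : MemA ρ 0 f) : Loc ρ f :=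
  fun _ _ h => hf.mono h.le

theorem Loc.mono {r ρ : ℝ} (h : r ≤ ρ) {f : (Fin N → ℂ) → ℂ} (hf : Loc ρ f) : Loc r f :=
  fun s h0 hs => hf s h0 (hs.trans_le h)

theorem Loc.const {ρ : ℝ} (c : ℂ) : Loc ρ (fun _ : Fin N → ℂ => c) := fun _ _ _ => MemA.const c

theorem Loc.add {ρ : ℝ} {f g : (Fin N → ℂ) → ℂ} (hf : Loc ρ f) (hg : Loc ρ g) :
    Loc ρ (fun ξ => f ξ + g ξ) := fun r h0 h => (hf r h0 h).add (hg r h0 h)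

theorem Loc.sub {ρ : ℝ} {f g : (Fin N → ℂ) → ℂ} (hf : Loc ρ f) (hg : Loc ρ g) :
    Loc ρ (fun ξ => f ξ - g ξ) := fun r h0 h => (hf r h0 h).sub (hg r h0 h)

theorem Loc.neg {ρ : ℝ} {f : (Fin N → ℂ) → ℂ} (hf : Loc ρ f) : Loc ρ (fun ξ => -f ξ) :=
  fun r h0 h => (hf r h0 h).neg

theorem Loc.mul {ρ : ℝ} {f g : (Fin N → ℂ) → ℂ} (hf : Loc ρ f) (hg : Loc ρ g) :
    Loc ρ (fun ξ => f ξ * g ξ) := fun r h0 h => (hf r h0 h).mul (hg r h0 h)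

theorem Loc.const_mul {ρ : ℝ} (c : ℂ) {f : (Fin N → ℂ) → ℂ} (hf : Loc ρ f) :
    Loc ρ (fun ξ => c * f ξ) := (Loc.const c).mul hf

theorem Loc.sum {ρ : ℝ} {ι : Type*} (t : Finset ι) {f : ι → (Fin N → ℂ) → ℂ}
    (hf : ∀ i, Loc ρ (f i)) : Loc ρ (fun ξ => ∑ i ∈ t, f i ξ) :=
  fun r h0 h => MemA.sum t fun i => hf i r h0 h

theorem Loc.tc {ρ : ℝ} (hρ : 0 < ρ) {f : (Fin N → ℂ) → ℂ} (hf : Loc ρ f) : TC f :=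
  (hf (ρ / 2) (by linarith) (by linarith)).tc (by linarith)

/-- The reason for working on the open strip: boundedness up to the boundary is lost under
differentiation, while membership in every smaller strip is preserved. -/
theorem Loc.pd {ρ : ℝ} {f : (Fin N → ℂ) → ℂ} (hf : Loc ρ f) (j : Fin N) : Loc ρ (pd j f) := by
  intro r h0 h
  obtain ⟨R, h1, h2⟩ := exists_between h
  exact (hf R (h0.trans h1) h2).pd_memA h0 h1 j

theorem Loc.fc_pd {ρ : ℝ} (hρ : 0 < ρ) {f : (Fin N → ℂ) → ℂ} (hf : Loc ρ f) (j : Fin N)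
    (s : Fin N → ℤ) : fc (JacobiTorus.pd j f) s = Complex.I * (s j : ℂ) * fc f s :=
  (hf (ρ / 2) (by linarith) (by linarith)).fc_pd (by linarith) j s

theorem Loc.eqOn_iff {ρ : ℝ} (hρ : 0 < ρ) {f g : (Fin N → ℂ) → ℂ} (hf : Loc ρ f) (hg : Loc ρ g) :
    (∀ ξ ∈ stripInt ρ, f ξ = g ξ) ↔ ∀ s, fc f s = fc g s := by
  constructor
  · intro h s
    exact fc_congr (fun x => h _ (realPt_mem_stripInt hρ x)) s
  · intro h ξ hξ
    obtain ⟨r, h0, h1, h2⟩ : ∃ r, 0 < r ∧ r < ρ ∧ ξ ∈ strip r := by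
      rcases isEmpty_or_nonempty (Fin N) with h | h
      · exact ⟨ρ / 2, by linarith, by linarith, fun j => h.elim j⟩
      · obtain ⟨j, hj⟩ := Finite.exists_max (fun j => |(ξ j).im|)
        obtain ⟨r, h1, h2⟩ := exists_between (hξ j)
        exact ⟨r, (abs_nonneg _).trans_lt h1, h2, fun i => (hj i).trans h1.le⟩
    exact (hf r h0 h1).eqOn_of_fc_eq h0 (hg r h0 h1) h h2

theorem Loc.dirD {ρ : ℝ} {ι : Type*} {ω : Fin N → ℝ} {u : (Fin N → ℂ) → (ι → ℂ)} {i : ι}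
    (hu : Loc ρ (fun ξ => u ξ i)) : Loc ρ (fun ξ => dirD ω u ξ i) :=
  Loc.sum _ fun j => (hu.pd j).const_mul _

theorem fc_dirD {ρ : ℝ} (hρ : 0 < ρ) {ι : Type*} {ω : Fin N → ℝ} {u : (Fin N → ℂ) → (ι → ℂ)}
    {i : ι} (hu : Loc ρ (fun ξ => u ξ i)) (s : Fin N → ℤ) :
    fc (fun ξ => dirD ω u ξ i) s = Complex.I * dv ω s * fc (fun ξ => u ξ i) s := by
  unfold dirD
  rw [fc_sum _ (fun j => ((hu.pd j).const_mul _).tc hρ)]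
  simp only [fc_const_mul, hu.fc_pd hρ, dv]
  push_cast
  rw [Finset.mul_sum, Finset.sum_mul]
  exact Finset.sum_congr rfl fun j _ => by ring

/-- Coefficients whose entries are analytic on an open strip. -/
structure LocCoeffs (ρ : ℝ) (D : Coeffs N) : Prop where
  w : Loc ρ D.w₁
  W : ∀ a b, Loc ρ (fun ξ => D.W ξ a b)
  V : ∀ a b, Loc ρ (fun ξ => (D.V ξ)⁻¹ a b)
  S : ∀ a b, Loc ρ (fun ξ => D.S ξ a b)
  T : ∀ a b, Loc ρ (fun ξ => D.T ξ a b)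

theorem LocCoeffs.mono {r ρ : ℝ} (h : r ≤ ρ) {D : Coeffs N} (hD : LocCoeffs ρ D) :
    LocCoeffs r D :=
  ⟨hD.w.mono h, fun a b => (hD.W a b).mono h, fun a b => (hD.V a b).mono h,
    fun a b => (hD.S a b).mono h, fun a b => (hD.T a b).mono h⟩

theorem LocCoeffs.lamF {ρ : ℝ} {D : Coeffs N} (hD : LocCoeffs ρ D)
    {g₂ : (Fin N → ℂ) → (Fin 2 → ℂ)} (hg : ∀ a, Loc ρ (fun ξ => g₂ ξ a))
    {μ : (Fin N → ℂ) → (Fin N → ℂ)} (hμ : ∀ j, Loc ρ (fun ξ => μ ξ j)) (p : ℂ) (a : Fin 2) :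
    Loc ρ (lamF D g₂ μ p a) :=
  ((Loc.sum _ fun j => (hD.T a j).mul (hμ j)).add ((hD.W 0 a).const_mul p)).sub (hg a)

theorem LocCoeffs.chiF {ρ : ℝ} {D : Coeffs N} (hD : LocCoeffs ρ D)
    {μ : (Fin N → ℂ) → (Fin N → ℂ)} (hμ : ∀ j, Loc ρ (fun ξ => μ ξ j))
    {lam : (Fin N → ℂ) → (Fin 2 → ℂ)} (hl : ∀ a, Loc ρ (fun ξ => lam ξ a)) (j : Fin N) :
    Loc ρ (chiF D μ lam j) :=
  (Loc.sum _ fun l => (hD.S j l).mul (hμ l)).add (Loc.sum _ fun a => (hD.T a j).mul (hl a))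

theorem fc_dev_mul {f : (Fin N → ℂ) → ℂ} (hf : TC f) (s : Fin N → ℤ) (j : Fin N) :
    (s j : ℂ) * fc (dev f) s = s j * fc f s := by
  by_cases hs : s = 0
  · subst hs; simp
  · unfold dev; rw [fc_sub_const hf _ hs]

/-- The differential equations are equivalent to the equations for the Fourier coefficients. -/
theorem isSolution_iff {ω : Fin N → ℝ} {k : ℝ} {D : Coeffs N} {ρ : ℝ} (hρ : 0 < ρ)
    (hD : LocCoeffs ρ D) {g₁ : (Fin N → ℂ) → ℂ} (hg₁ : Loc ρ g₁)
    {g₂ : (Fin N → ℂ) → (Fin 2 → ℂ)} (hg₂ : ∀ a, Loc ρ (fun ξ => g₂ ξ a)) {γ : ℂ}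
    {μ : (Fin N → ℂ) → (Fin N → ℂ)} {lam : (Fin N → ℂ) → (Fin 2 → ℂ)}
    {χ : (Fin N → ℂ) → (Fin N → ℂ)} {p : ℂ} (hμ : MemAVec ρ 0 μ) (hl : MemAVec ρ 0 lam)
    (hχ : MemAVec ρ 0 χ) :
    IsSolution ω k D ρ g₁ g₂ γ μ lam χ p ↔
      FSys ω k D g₁ g₂ μ lam (fun j => mean (fun ξ => μ ξ j)) p (mean (fun ξ => lam ξ 0)) 0 ∧
      FChi ω D μ lam χ (fun j => mean (fun ξ => χ ξ j)) 0 ∧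
      mean (fun ξ => dotProduct ((D.W ξ).mulVec (lam ξ)) e₁)
        + mean (fun ξ => dotProduct (χ ξ) (grad D.w₁ ξ)) = γ ∧
      ∀ i, mean (fun ξ => ((D.V ξ)⁻¹.transpose.mulVec (χ ξ)) i) = 0 := by
  have lμ : ∀ j, Loc ρ (fun ξ => μ ξ j) := fun j => (hμ j).loc
  have ll : ∀ a, Loc ρ (fun ξ => lam ξ a) := fun j => (hl j).loc
  have lχ : ∀ j, Loc ρ (fun ξ => χ ξ j) := fun j => (hχ j).loc
  have lF : ∀ a, Loc ρ (lamF D g₂ μ p a) := hD.lamF hg₂ lμ p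
  have lC : ∀ j, Loc ρ (chiF D μ lam j) := hD.chiF lμ ll
  have zero : ∀ s, fc (fun _ : Fin N → ℂ => (0 : ℂ)) s = 0 := fun s => by simp [fc_const]
  have Eμ : (∀ ξ ∈ stripInt ρ, dirD ω μ ξ = -(p • grad D.w₁ ξ) - grad g₁ ξ) ↔
      ∀ j s, Complex.I * dv ω s * fc (fun ξ => μ ξ j) s =
        -(Complex.I * s j * (p * fc (dev D.w₁) s + fc g₁ s)) := by
    have h1 : ∀ j, (∀ ξ ∈ stripInt ρ, dirD ω μ ξ j = -(p * pd j D.w₁ ξ) - pd j g₁ ξ) ↔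
        ∀ s, Complex.I * dv ω s * fc (fun ξ => μ ξ j) s =
          -(Complex.I * s j * (p * fc (dev D.w₁) s + fc g₁ s)) := by
      intro j
      have l1 : Loc ρ (fun ξ => p * pd j D.w₁ ξ) := (hD.w.pd j).const_mul p
      rw [Loc.eqOn_iff hρ (lμ j).dirD (l1.neg.sub (hg₁.pd j))]
      refine forall_congr' fun s => ?_
      rw [fc_dirD hρ (lμ j), fc_sub (l1.neg.tc hρ) ((hg₁.pd j).tc hρ), fc_neg, fc_const_mul,
        hD.w.fc_pd hρ, hg₁.fc_pd hρ]
      -- The coefficients of `w₁` and of its deviation differ only at `s = 0`, where the factor `s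
      -- j` vanishes.
      have := fc_dev_mul (hD.w.tc hρ) s j
      constructor
      · intro h; rw [h]; linear_combination p * Complex.I * this
      · intro h; rw [h]; linear_combination -p * Complex.I * this
    constructor
    · intro h j
      exact (h1 j).1 fun ξ hξ => by rw [h ξ hξ]; simp [grad]
    · intro h ξ hξ
      funext j
      rw [(h1 j).2 (h j) ξ hξ]; simp [grad]
  have Eχ : (∀ ξ ∈ stripInt ρ,
      -dirD ω χ ξ + (D.S ξ).mulVec (μ ξ) + (D.T ξ).transpose.mulVec (lam ξ) = 0) ↔
      ∀ j s, -(Complex.I * dv ω s * fc (fun ξ => χ ξ j) s) + fc (chiF D μ lam j) s =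
        if s = 0 then (0 : Fin N → ℂ) j else 0 := by
    have h1 : ∀ j, (∀ ξ ∈ stripInt ρ, -dirD ω χ ξ j + chiF D μ lam j ξ = 0) ↔
        ∀ s, -(Complex.I * dv ω s * fc (fun ξ => χ ξ j) s) + fc (chiF D μ lam j) s =
          if s = 0 then (0 : Fin N → ℂ) j else 0 := by
      intro j
      rw [Loc.eqOn_iff hρ ((lχ j).dirD.neg.add (lC j)) (Loc.const 0)]
      refine forall_congr' fun s => ?_
      rw [fc_add ((lχ j).dirD.neg.tc hρ) ((lC j).tc hρ), fc_neg, fc_dirD hρ (lχ j), zero]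
      simp
    have h2 : ∀ ξ j, (-dirD ω χ ξ + (D.S ξ).mulVec (μ ξ) +
        (D.T ξ).transpose.mulVec (lam ξ)) j = -dirD ω χ ξ j + chiF D μ lam j ξ := by
      intro ξ j
      simp only [Pi.add_apply, Pi.neg_apply, chiF, Matrix.mulVec, dotProduct,
        Matrix.transpose_apply]
      ring
    constructor
    · intro h j
      exact (h1 j).1 fun ξ hξ => by rw [← h2, h ξ hξ]; rfl
    · intro h ξ hξ
      funext j
      rw [h2, (h1 j).2 (h j) ξ hξ]; rfl
  have El : (∀ ξ ∈ stripInt ρ, J.mulVec (dirD ω lam ξ) + (Om k).mulVec (lam ξ) +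
      (D.T ξ).mulVec (μ ξ) + p • (D.W ξ).transpose.mulVec e₁ = g₂ ξ) ↔
      (∀ s, Complex.I * dv ω s * fc (fun ξ => lam ξ 1) s - k * fc (fun ξ => lam ξ 0) s +
        fc (lamF D g₂ μ p 0) s = if s = 0 then 0 else 0) ∧
      (∀ s, -(Complex.I * dv ω s * fc (fun ξ => lam ξ 0) s) + fc (fun ξ => lam ξ 1) s +
        fc (lamF D g₂ μ p 1) s = 0) := by
    have l0 := ((ll 1).dirD (ω := ω)).sub ((ll 0).const_mul k)
    have l1 := ((ll 0).dirD (ω := ω)).neg.add (ll 1)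
    have h0 : (∀ ξ ∈ stripInt ρ, dirD ω lam ξ 1 - k * lam ξ 0 + lamF D g₂ μ p 0 ξ = 0) ↔
        ∀ s, Complex.I * dv ω s * fc (fun ξ => lam ξ 1) s - k * fc (fun ξ => lam ξ 0) s +
          fc (lamF D g₂ μ p 0) s = if s = 0 then 0 else 0 := by
      rw [Loc.eqOn_iff hρ (l0.add (lF 0)) (Loc.const 0)]
      refine forall_congr' fun s => ?_
      rw [fc_add (l0.tc hρ) ((lF 0).tc hρ), fc_sub ((ll 1).dirD.tc hρ) (((ll 0).const_mul k).tc hρ),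
        fc_const_mul, fc_dirD hρ (ll 1), zero]
      simp
    have h1 : (∀ ξ ∈ stripInt ρ, -dirD ω lam ξ 0 + lam ξ 1 + lamF D g₂ μ p 1 ξ = 0) ↔
        ∀ s, -(Complex.I * dv ω s * fc (fun ξ => lam ξ 0) s) + fc (fun ξ => lam ξ 1) s +
          fc (lamF D g₂ μ p 1) s = 0 := by
      rw [Loc.eqOn_iff hρ (l1.add (lF 1)) (Loc.const 0)]
      refine forall_congr' fun s => ?_
      rw [fc_add (l1.tc hρ) ((lF 1).tc hρ), fc_add ((ll 0).dirD.neg.tc hρ) ((ll 1).tc hρ),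
        fc_neg, fc_dirD hρ (ll 0), zero]
    rw [← h0, ← h1]
    have h2 : ∀ ξ, (J.mulVec (dirD ω lam ξ) + (Om k).mulVec (lam ξ) +
      (D.T ξ).mulVec (μ ξ) + p • (D.W ξ).transpose.mulVec e₁ = g₂ ξ) ↔
        dirD ω lam ξ 1 - k * lam ξ 0 + lamF D g₂ μ p 0 ξ = 0 ∧
        -dirD ω lam ξ 0 + lam ξ 1 + lamF D g₂ μ p 1 ξ = 0 := by
      intro ξ
      rw [funext_iff, Fin.forall_fin_two]
      have hJ : J.mulVec (dirD ω lam ξ) = ![dirD ω lam ξ 1, -dirD ω lam ξ 0] := by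
        ext a; fin_cases a <;> simp [J, Matrix.mulVec, dotProduct, Fin.sum_univ_two]
      have hO : (Om k).mulVec (lam ξ) = ![-(k * lam ξ 0), lam ξ 1] := by
        ext a; fin_cases a <;> simp [Om, Matrix.mulVec, dotProduct, Fin.sum_univ_two]
      have hW : ∀ a, (D.W ξ).transpose.mulVec e₁ a = D.W ξ 0 a := fun a => by
        simp [e₁, Matrix.mulVec, dotProduct, Fin.sum_univ_two]
      have hT : ∀ a, (D.T ξ).mulVec (μ ξ) a = ∑ j, D.T ξ a j * μ ξ j := fun a => rfl
      rw [hJ, hO]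
      simp only [Pi.add_apply, Pi.smul_apply, hW, hT, smul_eq_mul, Matrix.cons_val_zero,
        Matrix.cons_val_one, lamF]
      refine and_congr ⟨fun h => ?_, fun h => ?_⟩ ⟨fun h => ?_, fun h => ?_⟩ <;>
        linear_combination h
    constructor
    · intro h
      exact ⟨fun ξ hξ => ((h2 ξ).1 (h ξ hξ)).1, fun ξ hξ => ((h2 ξ).1 (h ξ hξ)).2⟩
    · intro h ξ hξ
      exact (h2 ξ).2 ⟨h.1 ξ hξ, h.2 ξ hξ⟩
  constructor
  · intro h
    exact ⟨⟨fun j => (lμ j).tc hρ, fun a => (ll a).tc hρ, fun _ => rfl, rfl, Eμ.1 h.eq_μ,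
      (El.1 h.eq_lam).1, (El.1 h.eq_lam).2⟩,
      ⟨fun j => (lχ j).tc hρ, fun _ => rfl, Eχ.1 h.eq_χ⟩, h.mean_lam, h.mean_χ⟩
  · rintro ⟨h1, h2, h3, h4⟩
    exact ⟨hμ, hl, hχ, Eμ.2 h1.eqμ, El.2 ⟨h1.eq0, h1.eq1⟩, Eχ.2 h2.eqχ, h3, h4⟩

/-! ### Existence for the equations up to constants -/

theorem exists_memA_of_decay {ρ R A : ℝ} (hρ : 0 < ρ) (hR : ρ < R) {a : (Fin N → ℤ) → ℂ}
    (ha : ∀ s, ‖a s‖ ≤ A * Real.exp (-R * l1 s)) :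
    ∃ f : (Fin N → ℂ) → ℂ, MemA ρ 0 f ∧ ∀ s, fc f s = a s :=
  ⟨Ser a, Ser.memA hρ hR ha, fc_Ser (summable_of_decay_pos (hρ.trans hR) ha)⟩

/-- Solving for Fourier coefficients at nonzero frequencies with small divisors. -/
theorem Loc.exists_of_bound {ρ ρ' δ K : ℝ} (hρ' : 0 < ρ') (hδ : 0 < δ) (hK : 0 ≤ K)
    (hρ : ρ' + δ < ρ) {f g : (Fin N → ℂ) → ℂ} (hf : Loc ρ f) (hg : Loc ρ g)
    {a : (Fin N → ℤ) → ℂ} (ha : ∀ s ≠ 0, ‖a s‖ ≤ K * Real.exp (δ * l1 s) *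
      (‖fc f s‖ + ‖fc g s‖)) :
    ∃ u : (Fin N → ℂ) → ℂ, MemA ρ' 0 u ∧ ∀ s, fc u s = a s := by
  obtain ⟨R, h1, h2⟩ := exists_between hρ
  obtain ⟨R', h3, h4⟩ := exists_between h2
  obtain ⟨A, hA⟩ := (hf R' (by linarith) h4).exists_decay (by linarith) h3
  obtain ⟨B, hB⟩ := (hg R' (by linarith) h4).exists_decay (by linarith) h3
  have hA0 : 0 ≤ A := by
    have := (norm_nonneg _).trans (hA 0)
    simpa [l1] using this
  have hB0 : 0 ≤ B := by
    have := (norm_nonneg _).trans (hB 0)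
    simpa [l1] using this
  refine exists_memA_of_decay (R := R - δ) (A := ‖a 0‖ + K * (A + B)) hρ' (by linarith) fun s => ?_
  by_cases hs : s = 0
  · subst hs
    have : 0 ≤ K * (A + B) := by positivity
    simpa [l1] using this
  · calc ‖a s‖ ≤ K * Real.exp (δ * l1 s) * (A * Real.exp (-R * l1 s) + B * Real.exp (-R * l1 s)) :=
        (ha s hs).trans (by
          have := hA s
          have := hB s
          gcongr)
      _ = K * (A + B) * (Real.exp (δ * l1 s) * Real.exp (-R * l1 s)) := by ring
      _ = K * (A + B) * Real.exp (-(R - δ) * l1 s) := by rw [← Real.exp_add]; ring_nf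
      _ ≤ _ := by gcongr; exact le_add_of_nonneg_left (norm_nonneg _)

/-- At zero frequency the `μ`-equation is vacuous, which leaves the mean `m` free; the second
`λ`-equation fixes the mean of `λ₂`, and the first one can only be met up to the residual. All other
modes are solved explicitly, `μ` before `λ`, since `μ` enters the inhomogeneity of the latter. -/
theorem exists_FSys {ω : Fin N → ℝ} (hω : SmallDiv ω) {k : ℝ} (hk : 0 ≤ k) {D : Coeffs N}
    {ρ ρ' : ℝ} (hρ' : 0 < ρ') (hρ : ρ' < ρ) (hD : LocCoeffs ρ D) {g₁ : (Fin N → ℂ) → ℂ}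
    (hg₁ : Loc ρ g₁) {g₂ : (Fin N → ℂ) → (Fin 2 → ℂ)} (hg₂ : ∀ a, Loc ρ (fun ξ => g₂ ξ a))
    (m : Fin N → ℂ) (p b : ℂ) :
    ∃ μ lam r, FSys ω k D g₁ g₂ μ lam m p b r ∧ (∀ j, MemA ρ' 0 (fun ξ => μ ξ j)) ∧
      ∀ a, MemA ρ' 0 (fun ξ => lam ξ a) := by
  have hρ0 : 0 < ρ := hρ'.trans hρ
  -- The width `ρ - ρ' = 8δ` is split in two: `μ` is built on the strip `ρ' + 4δ`, then `λ` on `ρ'`,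
  -- each inversion costing `2δ`.
  set δ := (ρ - ρ') / 8 with hδd
  have hδ : 0 < δ := by rw [hδd]; linarith
  obtain ⟨K, hK, hd⟩ := hω δ hδ
  have hdv0 : dv ω 0 = 0 := by simp [dv]
  have hex1 : ∀ j, ∃ u : (Fin N → ℂ) → ℂ, MemA (ρ' + 4 * δ) 0 u ∧ ∀ s, fc u s =
      if s = 0 then m j else
        -(Complex.I * dv ω s)⁻¹ * (Complex.I * s j * (p * fc D.w₁ s + fc g₁ s)) := by
    intro j
    have hf := (hD.w.const_mul p).add hg₁
    refine hf.exists_of_bound (δ := 2 * δ) (K := K * δ⁻¹) (by linarith) (by linarith)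
      (by positivity) (by rw [hδd]; linarith) (Loc.const 0) fun s hs => ?_
    obtain ⟨h1, h2⟩ := hd s hs
    rw [if_neg hs, fc_add ((hD.w.const_mul p).tc hρ0) (hg₁.tc hρ0), fc_const_mul, norm_mul,
      norm_neg, norm_inv, norm_mul, norm_mul (Complex.I * (s j : ℂ)), Complex.norm_I, one_mul,
      Complex.norm_real, Real.norm_eq_abs]
    have h3 := norm_I_mul_le hδ s j
    calc _ ≤ (K * Real.exp (δ * l1 s)) * ((δ⁻¹ * Real.exp (δ * l1 s)) *
          ‖p * fc D.w₁ s + fc g₁ s‖) := by gcongr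
      _ = K * δ⁻¹ * (Real.exp (δ * l1 s) * Real.exp (δ * l1 s)) *
          ‖p * fc D.w₁ s + fc g₁ s‖ := by ring
      _ = K * δ⁻¹ * Real.exp (2 * δ * l1 s) * ‖p * fc D.w₁ s + fc g₁ s‖ := by
          rw [← Real.exp_add]; ring_nf
      _ ≤ _ := by gcongr; exact le_add_of_nonneg_right (norm_nonneg _)
  choose u hu hfu using hex1
  set μ : (Fin N → ℂ) → (Fin N → ℂ) := fun ξ j => u j ξ with hμd
  have lμ : ∀ j, Loc (ρ' + 4 * δ) (fun ξ => μ ξ j) := fun j => (hu j).loc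
  have hle : ρ' + 4 * δ ≤ ρ := by rw [hδd]; linarith
  have hr0 : 0 < ρ' + 4 * δ := by linarith
  have lF : ∀ a, Loc (ρ' + 4 * δ) (lamF D g₂ μ p a) :=
    (hD.mono hle).lamF (fun a => (hg₂ a).mono hle) lμ p
  set F := lamF D g₂ μ p 0
  set G := lamF D g₂ μ p 1
  have hsol : ∀ s : Fin N → ℤ, ∃ v : ℂ × ℂ,
      (s = 0 → v.1 = b ∧ v.2 = -fc G 0) ∧ (s ≠ 0 →
        Complex.I * dv ω s * v.2 - k * v.1 + fc F s = 0 ∧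
        -(Complex.I * dv ω s * v.1) + v.2 + fc G s = 0) := by
    intro s
    by_cases hs : s = 0
    · exact ⟨(b, -fc G 0), fun _ => ⟨rfl, rfl⟩, fun h => absurd hs h⟩
    · have h1 := (hd s hs).1
      have h2 : ((dv ω s) ^ 2 + k : ℂ) ≠ 0 := by
        have : 0 < (dv ω s) ^ 2 + k := by positivity
        exact_mod_cast this.ne'
      have hI : Complex.I * Complex.I = -1 := Complex.I_mul_I
      refine ⟨((fc F s - Complex.I * dv ω s * fc G s) / ((dv ω s) ^ 2 + k),
        (Complex.I * dv ω s * fc F s - k * fc G s) / ((dv ω s) ^ 2 + k)),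
        fun h => absurd h hs, fun _ => ⟨?_, ?_⟩⟩
      · field_simp
        linear_combination (dv ω s) ^ 2 * fc F s * hI
      · field_simp
        linear_combination (dv ω s) ^ 2 * fc G s * hI
  choose v hv0 hv using hsol
  have key : ∀ s : Fin N → ℤ, s ≠ 0 →
      (1 + |dv ω s|⁻¹) ^ 2 ≤ 4 * K ^ 2 * Real.exp (2 * δ * l1 s) := by
    intro s hs
    have h2 := (hd s hs).2
    have h3 : 1 ≤ K * Real.exp (δ * l1 s) := by
      have := Real.one_le_exp (mul_nonneg hδ.le (l1_nonneg s))
      nlinarith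
    have h4 : Real.exp (2 * δ * l1 s) = Real.exp (δ * l1 s) ^ 2 := by
      rw [← Real.exp_nat_mul]; push_cast; ring_nf
    rw [h4]
    calc _ ≤ (K * Real.exp (δ * l1 s) + K * Real.exp (δ * l1 s)) ^ 2 := by gcongr
      _ = _ := by ring
  obtain ⟨f₀, hf₀, hff₀⟩ := (lF 0).exists_of_bound (a := fun s => (v s).1) (δ := 2 * δ)
    (K := 4 * K ^ 2) hρ' (by linarith) (by positivity) (by linarith) (lF 1) fun s hs => by
      refine (norm_le_of_block (hd s hs).1 hk (hv s hs).1 (hv s hs).2).1.trans ?_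
      have := key s hs
      gcongr
  obtain ⟨f₁, hf₁, hff₁⟩ := (lF 0).exists_of_bound (a := fun s => (v s).2) (δ := 2 * δ)
    (K := 4 * K ^ 2) hρ' (by linarith) (by positivity) (by linarith) (lF 1) fun s hs => by
      refine (norm_le_of_block (hd s hs).1 hk (hv s hs).1 (hv s hs).2).2.trans ?_
      have := key s hs
      gcongr
  have hlm : ∀ a, MemA ρ' 0 (fun ξ => (![f₀ ξ, f₁ ξ] : Fin 2 → ℂ) a) := by
    intro a
    fin_cases a
    · exact hf₀
    · exact hf₁
  have hμm : ∀ j, MemA ρ' 0 (fun ξ => μ ξ j) := fun j => (hu j).mono (by linarith)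
  -- The residual is whatever the zero mode of the first `λ`-equation turns out to be.
  refine ⟨μ, fun ξ => ![f₀ ξ, f₁ ξ], -(k * b) + fc F 0, ⟨fun j => (hμm j).tc hρ',
    fun a => (hlm a).tc hρ', fun j => ?_, ?_, fun j s => ?_, fun s => ?_, fun s => ?_⟩, hμm, hlm⟩
  · rw [← fc_zero]; simpa using hfu j 0
  · rw [← fc_zero]
    exact (hff₀ 0).trans (hv0 0 rfl).1
  · change _ * fc (u j) s = _
    rw [hfu]
    by_cases hs : s = 0
    · subst hs; simp [hdv0]
    · have h1 : (dv ω s : ℂ) ≠ 0 := by exact_mod_cast (hd s hs).1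
      rw [if_neg hs, show dev D.w₁ = fun ξ => D.w₁ ξ - mean D.w₁ from rfl, fc_sub_const (hD.w.tc hρ0) _ hs]
      have := Complex.I_ne_zero
      field_simp
  · change _ * fc f₁ s - _ * fc f₀ s + fc F s = _
    rw [hff₀, hff₁]
    by_cases hs : s = 0
    · subst hs
      rw [(hv0 0 rfl).1, hdv0, if_pos rfl]; push_cast; ring
    · rw [if_neg hs]; exact (hv s hs).1
  · change -(_ * fc f₀ s) + fc f₁ s + fc G s = _
    rw [hff₀, hff₁]
    by_cases hs : s = 0
    · subst hs
      rw [(hv0 0 rfl).2, hdv0]; push_cast; ring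
    · exact (hv s hs).2

/-- The mean of `χ` is free, and the mean of the right-hand side is the obstruction, recorded as
`q`. -/
theorem exists_FChi {ω : Fin N → ℝ} (hω : SmallDiv ω) {D : Coeffs N}
    {ρ ρ' : ℝ} (hρ' : 0 < ρ') (hρ : ρ' < ρ) (hD : LocCoeffs ρ D)
    {μ : (Fin N → ℂ) → (Fin N → ℂ)} (hμ : ∀ j, Loc ρ (fun ξ => μ ξ j))
    {lam : (Fin N → ℂ) → (Fin 2 → ℂ)} (hl : ∀ a, Loc ρ (fun ξ => lam ξ a)) (x : Fin N → ℂ) :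
    ∃ χ q, FChi ω D μ lam χ x q ∧ ∀ j, MemA ρ' 0 (fun ξ => χ ξ j) := by
  have lC : ∀ j, Loc ρ (chiF D μ lam j) := hD.chiF hμ hl
  set δ := (ρ - ρ') / 2 with hδd
  have hδ : 0 < δ := by rw [hδd]; linarith
  obtain ⟨K, hK, hd⟩ := hω δ hδ
  have hdv0 : dv ω 0 = 0 := by simp [dv]
  have hex : ∀ j, ∃ u : (Fin N → ℂ) → ℂ, MemA ρ' 0 u ∧ ∀ s, fc u s =
      if s = 0 then x j else (Complex.I * dv ω s)⁻¹ * fc (chiF D μ lam j) s := by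
    intro j
    refine (lC j).exists_of_bound (δ := δ) (K := K) hρ' hδ (by linarith)
      (by rw [hδd]; linarith) (Loc.const 0) fun s hs => ?_
    have h2 := (hd s hs).2
    rw [if_neg hs, norm_mul, norm_inv, norm_mul, Complex.norm_I, one_mul, Complex.norm_real,
      Real.norm_eq_abs]
    gcongr
    exact le_add_of_nonneg_right (norm_nonneg _)
  choose u hu hfu using hex
  refine ⟨fun ξ j => u j ξ, fun j => fc (chiF D μ lam j) 0, ⟨fun j => (hu j).tc hρ', fun j => ?_,
    fun j s => ?_⟩, hu⟩
  · rw [← fc_zero]; simpa using hfu j 0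
  · rw [hfu]
    by_cases hs : s = 0
    · subst hs; simp [hdv0]
    · have h1 : (dv ω s : ℂ) ≠ 0 := by exact_mod_cast (hd s hs).1
      rw [if_neg hs, if_neg hs]
      have := Complex.I_ne_zero
      field_simp
      ring

end

end JacobiTorus

namespace JacobiTorus

noncomputable section

open MeasureTheory Set Filter Topology

variable {N : ℕ}

/-! ### Linear structure of the system -/

/-- The constants `(m, p, b, x)` that parametrise solutions up to constants; also the space of
residuals `(q, r, γ, y)`. -/
abbrev Cst (N : ℕ) := (Fin N → ℂ) × ℂ × ℂ × (Fin N → ℂ)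

/-- A solution of the system with constants `X = (m, p, b, x)` and residuals `R = (q, r, γ, y)`. -/
structure Full (ω : Fin N → ℝ) (k : ℝ) (D : Coeffs N) (g₁ : (Fin N → ℂ) → ℂ)
    (g₂ : (Fin N → ℂ) → (Fin 2 → ℂ)) (X R : Cst N) (μ : (Fin N → ℂ) → (Fin N → ℂ))
    (lam : (Fin N → ℂ) → (Fin 2 → ℂ)) (χ : (Fin N → ℂ) → (Fin N → ℂ)) : Prop where
  sys : FSys ω k D g₁ g₂ μ lam X.1 X.2.1 X.2.2.1 R.2.1
  chi : FChi ω D μ lam χ X.2.2.2 R.1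
  mean_lam : mean (fun ξ => dotProduct ((D.W ξ).mulVec (lam ξ)) e₁)
    + mean (fun ξ => dotProduct (χ ξ) (grad D.w₁ ξ)) = R.2.2.1
  mean_χ : ∀ i, mean (fun ξ => ((D.V ξ)⁻¹.transpose.mulVec (χ ξ)) i) = R.2.2.2 i

section Linear

variable {ω : Fin N → ℝ} {k ρ : ℝ} {D : Coeffs N} {g₁ g₁' : (Fin N → ℂ) → ℂ}
  {g₂ g₂' : (Fin N → ℂ) → (Fin 2 → ℂ)} {X X' R R' : Cst N}
  {μ μ' : (Fin N → ℂ) → (Fin N → ℂ)} {lam lam' : (Fin N → ℂ) → (Fin 2 → ℂ)}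
  {χ χ' : (Fin N → ℂ) → (Fin N → ℂ)} {m m' x x' q q' : Fin N → ℂ} {p p' b b' r r' : ℂ}

theorem TC.const_mul (c : ℂ) {f : (Fin N → ℂ) → ℂ} (hf : TC f) : TC (fun ξ => c * f ξ) :=
  (TC.const c).mul hf

theorem mean_add_mul (c : ℂ) {f g : (Fin N → ℂ) → ℂ} (hf : TC f) (hg : TC g) :
    mean (fun ξ => f ξ + c * g ξ) = mean f + c * mean g := by
  rw [mean_add hf (hg.const_mul c), mean_const_mul]

theorem fc_add_mul (c : ℂ) {f g : (Fin N → ℂ) → ℂ} (hf : TC f) (hg : TC g) (s : Fin N → ℤ) :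
    fc (fun ξ => f ξ + c * g ξ) s = fc f s + c * fc g s := by
  rw [fc_add hf (hg.const_mul c), fc_const_mul]

theorem LocCoeffs.tc_lamF (hρ : 0 < ρ) (hD : LocCoeffs ρ D) (hg : ∀ a, TC (fun ξ => g₂ ξ a))
    (hμ : ∀ j, TC (fun ξ => μ ξ j)) (p : ℂ) (a : Fin 2) : TC (JacobiTorus.lamF D g₂ μ p a) :=
  ((TC.sum _ fun j => ((hD.T a j).tc hρ).mul (hμ j)).add (((hD.W 0 a).tc hρ).const_mul p)).sub
    (hg a)

theorem LocCoeffs.tc_chiF (hρ : 0 < ρ) (hD : LocCoeffs ρ D)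
    (hμ : ∀ j, TC (fun ξ => μ ξ j)) (hl : ∀ a, TC (fun ξ => lam ξ a)) (j : Fin N) :
    TC (JacobiTorus.chiF D μ lam j) :=
  (TC.sum _ fun l => ((hD.S j l).tc hρ).mul (hμ l)).add
    (TC.sum _ fun a => ((hD.T a j).tc hρ).mul (hl a))

/-- The single combination `f + c g` covers sums, multiples and differences. The sources are
combined as well, so that subtracting two solutions with equal sources gives a homogeneous one. -/
theorem FSys.add_mul (hρ : 0 < ρ) (hD : LocCoeffs ρ D) (hg₁ : TC g₁) (hg₁' : TC g₁')
    (hg₂ : ∀ a, TC (fun ξ => g₂ ξ a)) (hg₂' : ∀ a, TC (fun ξ => g₂' ξ a)) (c : ℂ)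
    (h : FSys ω k D g₁ g₂ μ lam m p b r) (h' : FSys ω k D g₁' g₂' μ' lam' m' p' b' r') :
    FSys ω k D (fun ξ => g₁ ξ + c * g₁' ξ) (fun ξ a => g₂ ξ a + c * g₂' ξ a)
      (fun ξ j => μ ξ j + c * μ' ξ j) (fun ξ a => lam ξ a + c * lam' ξ a)
      (fun j => m j + c * m' j) (p + c * p') (b + c * b') (r + c * r') := by
  have hF : ∀ a s, fc (JacobiTorus.lamF D (fun ξ a => g₂ ξ a + c * g₂' ξ a)
      (fun ξ j => μ ξ j + c * μ' ξ j) (p + c * p') a) s =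
      fc (JacobiTorus.lamF D g₂ μ p a) s + c * fc (JacobiTorus.lamF D g₂' μ' p' a) s := by
    intro a s
    rw [← fc_add_mul c (hD.tc_lamF hρ hg₂ h.tcμ p a) (hD.tc_lamF hρ hg₂' h'.tcμ p' a)]
    refine congrArg (fun f => fc f s) (funext fun ξ => ?_)
    simp only [JacobiTorus.lamF, mul_add, Finset.sum_add_distrib, mul_sub, Finset.mul_sum]
    have : ∑ j, D.T ξ a j * (c * μ' ξ j) = ∑ j, c * (D.T ξ a j * μ' ξ j) :=
      Finset.sum_congr rfl fun j _ => by ring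
    rw [this]
    ring
  refine ⟨fun j => (h.tcμ j).add ((h'.tcμ j).const_mul c),
    fun a => (h.tcl a).add ((h'.tcl a).const_mul c), fun j => ?_, ?_, fun j s => ?_, fun s => ?_,
    fun s => ?_⟩
  · rw [mean_add_mul c (h.tcμ j) (h'.tcμ j), h.meanμ, h'.meanμ]
  · rw [mean_add_mul c (h.tcl 0) (h'.tcl 0), h.meanl, h'.meanl]
  · rw [fc_add_mul c (h.tcμ j) (h'.tcμ j), fc_add_mul c hg₁ hg₁']
    linear_combination h.eqμ j s + c * h'.eqμ j s
  · rw [fc_add_mul c (h.tcl 0) (h'.tcl 0), fc_add_mul c (h.tcl 1) (h'.tcl 1), hF]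
    have e1 := h.eq0 s
    have e2 := h'.eq0 s
    split_ifs at e1 e2 ⊢ <;> linear_combination e1 + c * e2
  · rw [fc_add_mul c (h.tcl 0) (h'.tcl 0), fc_add_mul c (h.tcl 1) (h'.tcl 1), hF]
    linear_combination h.eq1 s + c * h'.eq1 s

theorem FChi.add_mul (hρ : 0 < ρ) (hD : LocCoeffs ρ D)
    (hμ : ∀ j, TC (fun ξ => μ ξ j)) (hμ' : ∀ j, TC (fun ξ => μ' ξ j))
    (hl : ∀ a, TC (fun ξ => lam ξ a)) (hl' : ∀ a, TC (fun ξ => lam' ξ a)) (c : ℂ)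
    (h : FChi ω D μ lam χ x q) (h' : FChi ω D μ' lam' χ' x' q') :
    FChi ω D (fun ξ j => μ ξ j + c * μ' ξ j) (fun ξ a => lam ξ a + c * lam' ξ a)
      (fun ξ j => χ ξ j + c * χ' ξ j) (fun j => x j + c * x' j) (fun j => q j + c * q' j) := by
  refine ⟨fun j => (h.tcχ j).add ((h'.tcχ j).const_mul c), fun j => ?_, fun j s => ?_⟩
  · rw [mean_add_mul c (h.tcχ j) (h'.tcχ j), h.meanχ, h'.meanχ]
  · have hF : fc (JacobiTorus.chiF D (fun ξ j => μ ξ j + c * μ' ξ j)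
        (fun ξ a => lam ξ a + c * lam' ξ a) j) s =
        fc (JacobiTorus.chiF D μ lam j) s + c * fc (JacobiTorus.chiF D μ' lam' j) s := by
      rw [← fc_add_mul c (hD.tc_chiF hρ hμ hl j) (hD.tc_chiF hρ hμ' hl' j)]
      refine congrArg (fun f => fc f s) (funext fun ξ => ?_)
      simp only [JacobiTorus.chiF, mul_add, Finset.sum_add_distrib, Finset.mul_sum]
      have e1 : ∑ l, D.S ξ j l * (c * μ' ξ l) = ∑ l, c * (D.S ξ j l * μ' ξ l) :=
        Finset.sum_congr rfl fun l _ => by ring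
      have e2 : ∑ a, D.T ξ a j * (c * lam' ξ a) = ∑ a, c * (D.T ξ a j * lam' ξ a) :=
        Finset.sum_congr rfl fun l _ => by ring
      rw [e1, e2]
      ring
    rw [fc_add_mul c (h.tcχ j) (h'.tcχ j), hF]
    have e1 := h.eqχ j s
    have e2 := h'.eqχ j s
    split_ifs at e1 e2 ⊢ <;> linear_combination e1 + c * e2

theorem Full.add_mul (hρ : 0 < ρ) (hD : LocCoeffs ρ D) (hg₁ : TC g₁) (hg₁' : TC g₁')
    (hg₂ : ∀ a, TC (fun ξ => g₂ ξ a)) (hg₂' : ∀ a, TC (fun ξ => g₂' ξ a)) (c : ℂ)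
    (h : Full ω k D g₁ g₂ X R μ lam χ) (h' : Full ω k D g₁' g₂' X' R' μ' lam' χ') :
    Full ω k D (fun ξ => g₁ ξ + c * g₁' ξ) (fun ξ a => g₂ ξ a + c * g₂' ξ a) (X + c • X')
      (R + c • R') (fun ξ j => μ ξ j + c * μ' ξ j) (fun ξ a => lam ξ a + c * lam' ξ a)
      (fun ξ j => χ ξ j + c * χ' ξ j) := by
  refine ⟨h.sys.add_mul hρ hD hg₁ hg₁' hg₂ hg₂' c h'.sys,
    h.chi.add_mul hρ hD h.sys.tcμ h'.sys.tcμ h.sys.tcl h'.sys.tcl c h'.chi, ?_, fun j => ?_⟩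
  · have tW : ∀ l : (Fin N → ℂ) → (Fin 2 → ℂ), (∀ a, TC (fun ξ => l ξ a)) →
        TC (fun ξ => dotProduct ((D.W ξ).mulVec (l ξ)) e₁) := by
      intro l hl
      have e : (fun ξ => dotProduct ((D.W ξ).mulVec (l ξ)) e₁) =
          fun ξ => ∑ a, D.W ξ 0 a * l ξ a := by
        ext ξ; simp [dotProduct, Matrix.mulVec, e₁, Fin.sum_univ_two]
      rw [e]
      exact TC.sum _ fun a => ((hD.W 0 a).tc hρ).mul (hl a)
    have tG : ∀ l : (Fin N → ℂ) → (Fin N → ℂ), (∀ a, TC (fun ξ => l ξ a)) →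
        TC (fun ξ => dotProduct (l ξ) (grad D.w₁ ξ)) := fun l hl =>
      TC.sum _ fun a => (hl a).mul ((hD.w.pd a).tc hρ)
    have e1 : (fun ξ => dotProduct ((D.W ξ).mulVec (fun a => lam ξ a + c * lam' ξ a)) e₁) =
        fun ξ => dotProduct ((D.W ξ).mulVec (lam ξ)) e₁ +
          c * dotProduct ((D.W ξ).mulVec (lam' ξ)) e₁ := by
      ext ξ
      rw [show (fun a => lam ξ a + c * lam' ξ a) = lam ξ + c • lam' ξ from rfl, Matrix.mulVec_add,
        Matrix.mulVec_smul, add_dotProduct, smul_dotProduct, smul_eq_mul]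
    have e2 : (fun ξ => dotProduct (fun a => χ ξ a + c * χ' ξ a) (grad D.w₁ ξ)) =
        fun ξ => dotProduct (χ ξ) (grad D.w₁ ξ) + c * dotProduct (χ' ξ) (grad D.w₁ ξ) := by
      ext ξ
      rw [show (fun a => χ ξ a + c * χ' ξ a) = χ ξ + c • χ' ξ from rfl,
        add_dotProduct, smul_dotProduct, smul_eq_mul]
    rw [e1, e2, mean_add_mul c (tW _ h.sys.tcl) (tW _ h'.sys.tcl),
      mean_add_mul c (tG _ h.chi.tcχ) (tG _ h'.chi.tcχ)]
    have e3 : (R + c • R').2.2.1 = R.2.2.1 + c * R'.2.2.1 := rfl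
    rw [e3]
    linear_combination h.mean_lam + c * h'.mean_lam
  · have tV : ∀ l : (Fin N → ℂ) → (Fin N → ℂ), (∀ a, TC (fun ξ => l ξ a)) →
        TC (fun ξ => ((D.V ξ)⁻¹.transpose.mulVec (l ξ)) j) := fun l hl =>
      (TC.sum Finset.univ fun a => ((hD.V a j).tc hρ).mul (hl a) :
        TC fun ξ => ∑ a, (D.V ξ)⁻¹ a j * l ξ a)
    have e : (fun ξ => ((D.V ξ)⁻¹.transpose.mulVec (fun a => χ ξ a + c * χ' ξ a)) j) =
        fun ξ => ((D.V ξ)⁻¹.transpose.mulVec (χ ξ)) j +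
          c * ((D.V ξ)⁻¹.transpose.mulVec (χ' ξ)) j := by
      ext ξ
      rw [show (fun a => χ ξ a + c * χ' ξ a) = χ ξ + c • χ' ξ from rfl, Matrix.mulVec_add,
        Matrix.mulVec_smul]
      rfl
    rw [e, mean_add_mul c (tV _ h.chi.tcχ) (tV _ h'.chi.tcχ), h.mean_χ, h'.mean_χ]
    rfl

/-- For given constants there is a solution with some residuals. -/
theorem exists_Full (hω : SmallDiv ω) (hk : 0 ≤ k) {ρ' : ℝ} (hρ' : 0 < ρ') (hρ : ρ' < ρ)
    (hD : LocCoeffs ρ D) (hg₁ : Loc ρ g₁) (hg₂ : ∀ a, Loc ρ (fun ξ => g₂ ξ a)) (X : Cst N) :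
    ∃ R μ lam χ, Full ω k D g₁ g₂ X R μ lam χ ∧ MemAVec ρ' 0 μ ∧ MemAVec ρ' 0 lam ∧
      MemAVec ρ' 0 χ := by
  obtain ⟨ρ₁, h1, h2⟩ := exists_between hρ
  obtain ⟨μ, lam, r, hs, hμ, hl⟩ :=
    exists_FSys hω hk (hρ'.trans h1) h2 hD hg₁ hg₂ X.1 X.2.1 X.2.2.1
  obtain ⟨χ, q, hc, hχ⟩ := exists_FChi hω hρ' h1 (hD.mono h2.le) (fun j => (hμ j).loc)
    (fun a => (hl a).loc) X.2.2.2
  exact ⟨(q, r, _, _), μ, lam, χ, ⟨hs, hc, rfl, fun _ => rfl⟩, fun j => (hμ j).mono h1.le,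
    fun a => (hl a).mono h1.le, hχ⟩

/-- If the homogeneous system has only trivial solutions, the residuals can be prescribed. -/
theorem exists_Full_residual (hω : SmallDiv ω) (hk : 0 ≤ k) {ρ' : ℝ} (hρ' : 0 < ρ') (hρ : ρ' < ρ)
    (hD : LocCoeffs ρ D) (hg₁ : Loc ρ g₁) (hg₂ : ∀ a, Loc ρ (fun ξ => g₂ ξ a)) {C : ℝ}
    (hC : ∀ X R μ lam χ, Full ω k D (fun _ => 0) (fun _ _ => 0) X R μ lam χ → ‖X‖ ≤ C * ‖R‖)
    (hC' : ∀ R μ lam χ, Full ω k D (fun _ => 0) (fun _ _ => 0) 0 R μ lam χ → R = 0)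
    (R : Cst N) :
    ∃ X μ lam χ, Full ω k D g₁ g₂ X R μ lam χ ∧ MemAVec ρ' 0 μ ∧ MemAVec ρ' 0 lam ∧
      MemAVec ρ' 0 χ := by
  have hρ0 := hρ'.trans hρ
  -- `L` picks a residual for each `X` by choice; the next steps show that the residual does not
  -- depend on the chosen solution, which makes `L` linear.
  choose L μ lam χ hF hμ hl hχ using fun X : Cst N =>
    exists_Full (ω := ω) (k := k) (D := D) (g₁ := fun _ => 0) (g₂ := fun _ _ => 0) hω hk hρ' hρ hD
      (Loc.const 0) (fun _ => Loc.const 0) X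
  have comb : ∀ X X' c R R' μ lam χ μ' lam' χ',
      Full ω k D (fun _ => 0) (fun _ _ => 0) X R μ lam χ →
      Full ω k D (fun _ => 0) (fun _ _ => 0) X' R' μ' lam' χ' →
      Full ω k D (fun _ => 0) (fun _ _ => 0) (X + c • X') (R + c • R')
        (fun ξ j => μ ξ j + c * μ' ξ j) (fun ξ a => lam ξ a + c * lam' ξ a)
        (fun ξ j => χ ξ j + c * χ' ξ j) := by
    intro X X' c R R' μ lam χ μ' lam' χ' h h'
    have := h.add_mul hρ0 hD (TC.const 0) (TC.const 0) (fun _ => TC.const 0) (fun _ => TC.const 0)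
      c h'
    simpa using this
  have uniq : ∀ X R R' μ lam χ μ' lam' χ',
      Full ω k D (fun _ => 0) (fun _ _ => 0) X R μ lam χ →
      Full ω k D (fun _ => 0) (fun _ _ => 0) X R' μ' lam' χ' → R = R' := by
    intro X R R' μ lam χ μ' lam' χ' h h'
    have h1 := comb _ _ (-1) _ _ _ _ _ _ _ _ h h'
    have h2 : X + (-1 : ℂ) • X = 0 := by module
    rw [h2] at h1
    have h3 := hC' _ _ _ _ h1
    rw [neg_one_smul, ← sub_eq_add_neg, sub_eq_zero] at h3
    exact h3
  have hz : L 0 = 0 := hC' _ _ _ _ (hF 0)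
  have hadd : ∀ X c X', L (X + c • X') = L X + c • L X' := fun X c X' =>
    uniq _ _ _ _ _ _ _ _ _ (hF _) (comb _ _ c _ _ _ _ _ _ _ _ (hF X) (hF X'))
  let Lm : Cst N →ₗ[ℂ] Cst N :=
    { toFun := L
      map_add' := fun X X' => by simpa using hadd X 1 X'
      map_smul' := fun c X => by simpa [hz] using hadd 0 c X }
  have hinj : Function.Injective Lm := by
    rw [← LinearMap.ker_eq_bot, LinearMap.ker_eq_bot']
    intro X hX
    have h1 := hC _ _ _ _ _ (hF X)
    have h2 : L X = 0 := hX
    rw [h2, norm_zero, mul_zero] at h1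
    exact norm_le_zero_iff.1 h1
  -- Constants and residuals form the same finite-dimensional space, so injectivity suffices.
  have hsurj := LinearMap.injective_iff_surjective.1 hinj
  obtain ⟨R₀, μ₀, lam₀, χ₀, h0, h1, h2, h3⟩ :=
    exists_Full (ω := ω) (k := k) (D := D) (g₁ := g₁) (g₂ := g₂) hω hk hρ' hρ hD hg₁ hg₂ 0
  -- The inhomogeneous solution with zero constants has some residual `R₀`; a homogeneous solution
  -- makes up the difference.
  obtain ⟨X, hX⟩ := hsurj (R - R₀)
  have hX' : L X = R - R₀ := hX
  have h4 := h0.add_mul hρ0 hD (hg₁.tc hρ0) (TC.const 0) (fun a => (hg₂ a).tc hρ0)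
    (fun _ => TC.const 0) 1 (hF X)
  rw [hX'] at h4
  simp only [mul_zero, add_zero, zero_add, one_smul, add_sub_cancel] at h4
  exact ⟨X, _, _, _, h4, fun j => (h1 j).add ((hμ X j).const_mul 1),
    fun a => (h2 a).add ((hl X a).const_mul 1), fun j => (h3 j).add ((hχ X j).const_mul 1)⟩

end Linear

/-! ### Admissible coefficients are uniformly close to the unperturbed ones -/

section Admissible

variable {H₀ : (Fin N → ℝ) × ℝ → ℝ} {ρ C₀ : ℝ} {d : ℕ}

theorem Loc.of_sub {f : (Fin N → ℂ) → ℂ} {c : ℂ} (h : Loc ρ (fun ξ => f ξ - c)) : Loc ρ f := by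
  simpa using h.add (Loc.const c)

theorem Admissible.locCoeffs {ε α : ℝ} {D : Coeffs N} (h : Admissible H₀ ρ d C₀ ε α D) :
    LocCoeffs ρ D where
  w := h.mem_w₁.zero.loc.of_sub
  W a b := Loc.of_sub (c := (1 : Matrix (Fin 2) (Fin 2) ℂ) a b) (h.mem_W a b).zero.loc
  V a b := Loc.of_sub (c := (1 : Matrix (Fin N) (Fin N) ℂ) a b) (h.mem_V a b).zero.loc
  S a b := Loc.of_sub (c := ((S0 H₀).map Complex.ofReal) a b) (h.mem_S a b).zero.loc
  T a b := Loc.of_sub (c := ((T0 H₀).map Complex.ofReal) a b) (h.mem_T a b).zero.loc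

/-- The absolute value `|C₀|` keeps the bound non-negative, the sign of `C₀` being unrestricted. -/
theorem norm_le_of_nrm_le_ofReal {f : (Fin N → ℂ) → ℂ} {ε : ℝ} {d' : ℕ}
    (h : nrm ρ d' f ≤ ENNReal.ofReal (C₀ * |ε|)) {ξ : Fin N → ℂ} (hξ : ξ ∈ stripInt ρ) :
    ‖f ξ‖ ≤ |C₀| * |ε| :=
  norm_le_of_nrm_le (by positivity) ((nrm_zero_le ρ d' f).trans (h.trans
    (ENNReal.ofReal_le_ofReal (mul_le_mul_of_nonneg_right (le_abs_self _) (abs_nonneg _))))) hξ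

theorem nrm_entry_le {ι κ : Type*} (d' : ℕ) (A : (Fin N → ℂ) → Matrix ι κ ℂ) (i : ι) (j : κ) :
    nrm ρ d' (fun ξ => A ξ i j) ≤ nrmMat ρ d' A :=
  le_iSup₂ (f := fun i j => nrm ρ d' (fun ξ => A ξ i j)) i j

theorem Admissible.bound_w {ε α : ℝ} {D : Coeffs N} (h : Admissible H₀ ρ d C₀ ε α D)
    {ξ : Fin N → ℂ} (hξ : ξ ∈ stripInt ρ) : ‖D.w₁ ξ - (α : ℂ)‖ ≤ |C₀| * |ε| :=
  norm_le_of_nrm_le_ofReal (le_trans (le_trans le_add_self le_self_add) h.bound_VwW) hξ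

theorem Admissible.bound_W {ε α : ℝ} {D : Coeffs N} (h : Admissible H₀ ρ d C₀ ε α D) (a b : Fin 2)
    {ξ : Fin N → ℂ} (hξ : ξ ∈ stripInt ρ) : ‖(D.W ξ - 1) a b‖ ≤ |C₀| * |ε| :=
  norm_le_of_nrm_le_ofReal (f := fun ξ => (D.W ξ - 1) a b)
    ((nrm_entry_le _ _ a b).trans (le_trans le_add_self h.bound_VwW)) hξ

theorem Admissible.bound_V {ε α : ℝ} {D : Coeffs N} (h : Admissible H₀ ρ d C₀ ε α D) (a b : Fin N)
    {ξ : Fin N → ℂ} (hξ : ξ ∈ stripInt ρ) : ‖((D.V ξ)⁻¹ - 1) a b‖ ≤ |C₀| * |ε| :=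
  norm_le_of_nrm_le_ofReal (f := fun ξ => ((D.V ξ)⁻¹ - 1) a b)
    ((nrm_entry_le _ (fun ξ => (D.V ξ)⁻¹ - 1) a b).trans
      (le_trans (le_trans le_self_add le_self_add) h.bound_VwW)) hξ

theorem Admissible.bound_S {ε α : ℝ} {D : Coeffs N} (h : Admissible H₀ ρ d C₀ ε α D) (a b : Fin N)
    {ξ : Fin N → ℂ} (hξ : ξ ∈ stripInt ρ) :
    ‖(D.S ξ - (S0 H₀).map Complex.ofReal) a b‖ ≤ |C₀| * |ε| :=
  norm_le_of_nrm_le_ofReal (f := fun ξ => (D.S ξ - (S0 H₀).map Complex.ofReal) a b)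
    ((nrm_entry_le _ _ a b).trans (le_trans le_self_add h.bound_ST)) hξ

theorem Admissible.bound_T {ε α : ℝ} {D : Coeffs N} (h : Admissible H₀ ρ d C₀ ε α D) (a : Fin 2)
    (b : Fin N) {ξ : Fin N → ℂ} (hξ : ξ ∈ stripInt ρ) :
    ‖(D.T ξ - (T0 H₀).map Complex.ofReal) a b‖ ≤ |C₀| * |ε| :=
  norm_le_of_nrm_le_ofReal (f := fun ξ => (D.T ξ - (T0 H₀).map Complex.ofReal) a b)
    ((nrm_entry_le _ _ a b).trans (le_trans le_add_self h.bound_ST)) hξ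

/-- Makes the deviation of `w₁` independent of `α`, hence all constants as well: only `w₁ - α` is
known to be small. -/
theorem dev_sub_const {f : (Fin N → ℂ) → ℂ} (hf : TC f) (c : ℂ) :
    dev (fun ξ => f ξ - c) = dev f := by
  funext ξ
  simp only [dev, mean_sub hf (TC.const c), mean_const]
  ring

variable {I : Type*}

/-- The passage from sup norms on the strip to decay of coefficients at any smaller rate. -/
theorem Bd.of_bound {r M : ℝ} (hr : 0 ≤ r) (hrρ : r < ρ) (hM : 0 ≤ M) {A : I → ℝ}
    {f : I → (Fin N → ℂ) → ℂ} (hf : ∀ i, MemA ρ 0 (f i))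
    (h : ∀ i, ∀ ξ ∈ stripInt ρ, ‖f i ξ‖ ≤ M * A i) : Bd r A f :=
  ⟨fun i => (hf i).tc (hr.trans_lt hrρ), M, hM, fun i s => (hf i).norm_fc_le hr hrρ (h i) s⟩

theorem Bd.dev {r : ℝ} {A : I → ℝ} {f : I → (Fin N → ℂ) → ℂ} (hf : Bd r A f) :
    Bd r A (fun i => JacobiTorus.dev (f i)) :=
  (hf.sub (Bd.const hf.mean r)).congr fun _ _ => rfl

theorem near_of_admissible {r : ℝ} (hr : 0 ≤ r) (hrρ : r < ρ) {ε α : I → ℝ} {D : I → Coeffs N}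
    (h : ∀ i, Admissible H₀ ρ d C₀ (ε i) (α i) (D i)) :
    Near r (fun i => |ε i|) ((S0 H₀).map Complex.ofReal) (fun j => (t0 H₀ j : ℂ)) D where
  w := by
    have h1 : Bd r (fun i => |ε i|) (fun i ξ => (D i).w₁ ξ - (α i : ℂ)) :=
      Bd.of_bound hr hrρ (abs_nonneg C₀) (fun i => (h i).mem_w₁.zero)
        fun i ξ hξ => (h i).bound_w hξ
    have h2 := h1.dev
    simpa only [dev_sub_const ((h _).locCoeffs.w.tc (hr.trans_lt hrρ))] using h2
  W a b := Bd.of_bound hr hrρ (abs_nonneg C₀) (fun i => ((h i).mem_W a b).zero)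
    fun i ξ hξ => (h i).bound_W a b hξ
  V a b := Bd.of_bound hr hrρ (abs_nonneg C₀) (fun i => ((h i).mem_V a b).zero)
    fun i ξ hξ => (h i).bound_V a b hξ
  S a b := Bd.of_bound hr hrρ (abs_nonneg C₀) (fun i => ((h i).mem_S a b).zero)
    fun i ξ hξ => (h i).bound_S a b hξ
  T0 j := (Bd.of_bound hr hrρ (abs_nonneg C₀) (fun i => ((h i).mem_T 0 j).zero)
    fun i ξ hξ => (h i).bound_T 0 j hξ).congr fun i ξ => by simp [JacobiTorus.T0]
  T1 j := (Bd.of_bound hr hrρ (abs_nonneg C₀) (fun i => ((h i).mem_T 1 j).zero)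
    fun i ξ hξ => (h i).bound_T 1 j hξ).congr fun i ξ => by simp [JacobiTorus.T0]

/-- The gap between `r` and an intermediate rate `R` pays for the factor `s j`, so the gradient of
`w₁` inherits the factor `ε` from the sup bound on `w₁ - α`. -/
theorem bd_pd_of_admissible {r : ℝ} (hr : 0 ≤ r) (hrρ : r < ρ) {ε α : I → ℝ} {D : I → Coeffs N}
    (h : ∀ i, Admissible H₀ ρ d C₀ (ε i) (α i) (D i)) (j : Fin N) :
    Bd r (fun i => |ε i|) (fun i => pd j (D i).w₁) := by
  obtain ⟨R, h1, h2⟩ := exists_between hrρ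
  have hρ := hr.trans_lt hrρ
  have hw := (near_of_admissible (hr.trans h1.le) h2 h).w
  have h3 := Bd.of_multiplier (δ := R - r) (K := (R - r)⁻¹) (by
      have := sub_pos.2 h1
      positivity) (g := fun i => pd j (D i).w₁)
    (fun i => ((h i).locCoeffs.w.pd j).tc hρ) (by
      have : ∀ i, mean (pd j (D i).w₁) = 0 := fun i => by
        rw [← fc_zero, (h i).locCoeffs.w.fc_pd hρ]; simp
      simp only [this]
      exact Bc.zero) hw Bd.zero fun i s hs => by
        rw [(h i).locCoeffs.w.fc_pd hρ, norm_mul,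
          show JacobiTorus.dev (D i).w₁ = fun ξ => (D i).w₁ ξ - mean (D i).w₁ from rfl,
          fc_sub_const ((h i).locCoeffs.w.tc hρ) _ hs]
        have h4 := norm_I_mul_le (sub_pos.2 h1) s j
        gcongr
        exact le_add_of_nonneg_right (norm_nonneg _)
  rwa [sub_sub_cancel] at h3

end Admissible

end

end JacobiTorus

namespace JacobiTorus

noncomputable section

open MeasureTheory Set Filter Topology

variable {N : ℕ} {I : Type*}

/-! ### Estimates with uniform constants -/

/-- The sum of finitely many constants serves for all. Non-negativity of the estimated quantities
gives the sign of each `K j * A s`, so that no sign condition on `A` is needed. -/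
theorem exists_uniform_bound {κ : Type*} [Fintype κ] {S : Type*} {F : κ → S → ℝ} {A : S → ℝ}
    (h : ∀ j, ∃ K, 0 ≤ K ∧ ∀ s, F j s ≤ K * A s) (h0 : ∀ j s, 0 ≤ F j s) :
    ∃ K, 0 ≤ K ∧ ∀ s, 0 ≤ K * A s ∧ ∀ j, F j s ≤ K * A s := by
  choose K hK hF using h
  refine ⟨∑ j, K j, Finset.sum_nonneg fun j _ => hK j, fun s => ?_⟩
  have h1 : ∀ j, 0 ≤ K j * A s := fun j => (h0 j s).trans (hF j s)
  rw [Finset.sum_mul]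
  exact ⟨Finset.sum_nonneg fun j _ => h1 j, fun j => (hF j s).trans
    (Finset.single_le_sum (f := fun j => K j * A s) (fun j _ => h1 j) (Finset.mem_univ j))⟩

theorem Bc.norm_pi {κ : Type*} [Fintype κ] {A : I → ℝ} {x : I → κ → ℂ}
    (h : ∀ j, Bc A (fun i => x i j)) : ∃ K, 0 ≤ K ∧ ∀ i, ‖x i‖ ≤ K * A i := by
  obtain ⟨K, hK, h1⟩ := exists_uniform_bound h fun j i => norm_nonneg _
  exact ⟨K, hK, fun i => (pi_norm_le_iff_of_nonneg (h1 i).1).2 (h1 i).2⟩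

theorem Bd.uniform {κ : Type*} [Fintype κ] {r : ℝ} {A : I → ℝ} {f : κ → I → (Fin N → ℂ) → ℂ}
    (h : ∀ j, Bd r A (f j)) :
    ∃ K, 0 ≤ K ∧ ∀ i s j, ‖fc (f j i) s‖ ≤ K * A i * Real.exp (-r * l1 s) := by
  obtain ⟨K, hK, h1⟩ := exists_uniform_bound (S := I × (Fin N → ℤ))
    (F := fun j t => ‖fc (f j t.1) t.2‖) (A := fun t => A t.1 * Real.exp (-r * l1 t.2))
    (fun j => by
      obtain ⟨K, hK, h1⟩ := (h j).2
      exact ⟨K, hK, fun t => by simpa only [mul_assoc] using h1 t.1 t.2⟩) fun j t => norm_nonneg _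
  exact ⟨K, hK, fun i s j => by simpa only [mul_assoc] using (h1 (i, s)).2 j⟩

/-- The complexification of `K₀`. -/
def K0c (H₀ : (Fin N → ℝ) × ℝ → ℝ) : Matrix (Fin N) (Fin N) ℂ := (K0 H₀).map Complex.ofReal

theorem K0c_isUnit {H₀ : (Fin N → ℝ) × ℝ → ℝ} (h : (K0 H₀).det ≠ 0) : IsUnit (K0c H₀).det := by
  have : (K0c H₀).det = ((K0 H₀).det : ℂ) := by
    rw [K0c]
    exact ((Complex.ofRealHom).map_det (K0 H₀)).symm
  rw [this, isUnit_iff_ne_zero]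
  exact_mod_cast h

theorem K0c_mulVec (H₀ : (Fin N → ℝ) × ℝ → ℝ) (m : Fin N → ℂ) (j : Fin N) :
    (K0c H₀).mulVec m j = (∑ l, ((S0 H₀).map Complex.ofReal) j l * m l) -
      (t0 H₀ j : ℂ) * ∑ l, (t0 H₀ l : ℂ) * m l := by
  simp only [Matrix.mulVec, dotProduct, K0c, K0, Matrix.map_apply, Matrix.sub_apply,
    Matrix.vecMulVec_apply, Finset.mul_sum, ← Finset.sum_sub_distrib]
  refine Finset.sum_congr rfl fun l _ => ?_
  push_cast
  ring

/-- Here the invertibility of `K₀` enters the estimates: bounds on `K₀ m` give bounds on `m`. -/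
theorem Bc.of_mulVec {H₀ : (Fin N → ℝ) × ℝ → ℝ} (h : (K0 H₀).det ≠ 0) {A : I → ℝ}
    {m : I → Fin N → ℂ} (hm : ∀ j, Bc A (fun i => (K0c H₀).mulVec (m i) j)) (j : Fin N) :
    Bc A (fun i => m i j) := by
  have h1 : ∀ i, m i j = ∑ l, (K0c H₀)⁻¹ j l * (K0c H₀).mulVec (m i) l := by
    intro i
    have h2 : (K0c H₀)⁻¹.mulVec ((K0c H₀).mulVec (m i)) = m i := by
      rw [Matrix.mulVec_mulVec, Matrix.nonsing_inv_mul _ (K0c_isUnit h), Matrix.one_mulVec]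
    exact (congrFun h2 j).symm
  simp only [h1]
  exact Bc.sum _ fun l => (hm l).const_mul _

/-- Admissible data together with a solution of the system up to constants. -/
structure FullData (ω : Fin N → ℝ) (H₀ : (Fin N → ℝ) × ℝ → ℝ) (ρ : ℝ) (d : ℕ) (C₀ r : ℝ) where
  (ε α k : ℝ)
  D : Coeffs N
  hε : |ε| ≤ 1
  hk : k ∈ Icc (0 : ℝ) 1
  adm : Admissible H₀ ρ d C₀ ε α D
  g₁ : (Fin N → ℂ) → ℂ
  g₂ : (Fin N → ℂ) → (Fin 2 → ℂ)
  (A₁ A₂ : ℝ)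
  hA₁ : 0 ≤ A₁
  hA₂ : 0 ≤ A₂
  tg₁ : TC g₁
  tg₂ : ∀ a, TC (fun ξ => g₂ ξ a)
  bg₁ : ∀ s, ‖fc g₁ s‖ ≤ A₁ * Real.exp (-r * l1 s)
  bg₂ : ∀ a s, ‖fc (fun ξ => g₂ ξ a) s‖ ≤ A₂ * Real.exp (-r * l1 s)
  mg₂ : ∀ a, ‖mean (fun ξ => g₂ ξ a)‖ ≤ A₁
  (X R : Cst N)
  μ : (Fin N → ℂ) → (Fin N → ℂ)
  lam : (Fin N → ℂ) → (Fin 2 → ℂ)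
  χ : (Fin N → ℂ) → (Fin N → ℂ)
  full : Full ω k D g₁ g₂ X R μ lam χ

/-- Bounds for the constants and for the Fourier coefficients of solutions. -/
theorem full_estimate {ω : Fin N → ℝ} (hω : SmallDiv ω) {H₀ : (Fin N → ℝ) × ℝ → ℝ}
    (hK : (K0 H₀).det ≠ 0) {ρ ρ' : ℝ} (d : ℕ) (C₀ : ℝ) {r δ : ℝ} (hδ : 0 < δ) (hδ1 : δ ≤ 1)
    (hρ' : ρ' < ρ) (hr0 : r ≤ ρ') (hr2 : |r - 2 * δ| < ρ') (hr4 : |r - 4 * δ| < ρ')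
    (hr6 : |r - 6 * δ| < ρ') :
    ∃ C, 0 ≤ C ∧ ∀ P : FullData ω H₀ ρ d C₀ r,
      ‖P.X‖ ≤ C * (‖P.R‖ + |P.ε| * ‖P.X‖ + |P.ε| * P.A₂ + P.A₁) ∧
      ‖P.R.2.2.1 - P.X.2.2.1‖ ≤ C * (|P.ε| * ‖P.X‖ + |P.ε| * P.A₂ + P.A₁) ∧
      ∀ s, (∀ j, ‖fc (fun ξ => P.μ ξ j) s‖ ≤
          C * (‖P.X‖ + P.A₁ + P.A₂) * Real.exp (-(r - 6 * δ) * l1 s)) ∧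
        (∀ j, ‖fc (fun ξ => P.lam ξ j) s‖ ≤
          C * (‖P.X‖ + P.A₁ + P.A₂) * Real.exp (-(r - 6 * δ) * l1 s)) ∧
        ∀ j, ‖fc (fun ξ => P.χ ξ j) s‖ ≤
          C * (‖P.X‖ + P.A₁ + P.A₂) * Real.exp (-(r - 6 * δ) * l1 s) := by
  -- The data themselves are the index set, so one constant for the family is a constant uniform
  -- over all data.
  set I := FullData ω H₀ ρ d C₀ r
  have hρ0 : 0 ≤ ρ' := (abs_nonneg _).trans hr2.le
  set E : I → ℝ := fun P => |P.ε|
  set Z : I → ℝ := fun P => ‖P.X‖ + P.A₁ + P.A₂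
  -- In `Y` the constants and the oscillating source carry a factor `ε`; only `A₁`, which bounds
  -- `g₁` and the means of `g₂`, enters without it.
  set Y : I → ℝ := fun P => |P.ε| * ‖P.X‖ + |P.ε| * P.A₂ + P.A₁
  have hZ0 : ∀ P : I, 0 ≤ Z P := fun P => by
    have := P.hA₁
    have := P.hA₂
    positivity
  have hY0 : ∀ P : I, 0 ≤ Y P := fun P => by
    have := P.hA₁
    have := P.hA₂
    positivity
  have hEZ : Le (fun P => E P * Z P) Y := Le.of_le fun P => by
    have h1 := P.hA₁
    have h2 := P.hε
    simp only [E, Z, Y]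
    nlinarith
  have hYZ : Le Y Z := Le.of_le fun P => by
    have h2 := P.hε
    have h3 := P.hA₂
    have h4 := norm_nonneg P.X
    simp only [Z, Y]
    nlinarith
  have hX : ∀ P : I, ‖P.X‖ ≤ Z P := fun P => by
    have := P.hA₁
    have := P.hA₂
    simp only [Z]; linarith
  have hD : Near ρ' E ((S0 H₀).map Complex.ofReal) (fun j => (t0 H₀ j : ℂ)) fun P : I => P.D :=
    near_of_admissible hρ0 hρ' fun P => P.adm
  have hm : ∀ j, Bc Z (fun P : I => P.X.1 j) := fun j =>
    ⟨1, zero_le_one, fun P => by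
      rw [one_mul]
      exact (norm_le_pi_norm _ j).trans ((norm_fst_le P.X).trans (hX P))⟩
  have hp : Bc Z (fun P : I => P.X.2.1) := ⟨1, zero_le_one, fun P => by
    rw [one_mul]
    exact (norm_fst_le _).trans ((norm_snd_le P.X).trans (hX P))⟩
  have hb : Bc Z (fun P : I => P.X.2.2.1) := ⟨1, zero_le_one, fun P => by
    rw [one_mul]
    exact (norm_fst_le _).trans ((norm_snd_le _).trans ((norm_snd_le P.X).trans (hX P)))⟩
  have hx : ∀ j, Bc Z (fun P : I => P.X.2.2.2 j) := fun j => ⟨1, zero_le_one, fun P => by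
    rw [one_mul]
    exact (norm_le_pi_norm _ j).trans
      ((norm_snd_le _).trans ((norm_snd_le _).trans ((norm_snd_le P.X).trans (hX P))))⟩
  have hg₁ : Bd r Y (fun P : I => P.g₁) := ⟨fun P => P.tg₁, 1, zero_le_one, fun P s => by
    rw [one_mul]
    refine (P.bg₁ s).trans ?_
    have := P.hA₂
    have : P.A₁ ≤ Y P := by simp only [Y]; exact le_add_of_nonneg_left (by positivity)
    gcongr⟩
  have hg₂ : ∀ a, Bd r Z (fun (P : I) ξ => P.g₂ ξ a) := fun a => ⟨fun P => P.tg₂ a, 1, zero_le_one,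
    fun P s => by
      rw [one_mul]
      refine (P.bg₂ a s).trans ?_
      have := P.hA₁
      have : P.A₂ ≤ Z P := by simp only [Z]; exact le_add_of_nonneg_left (by positivity)
      gcongr⟩
  have hg₂m : ∀ a, Bc Y (fun P : I => mean (fun ξ => P.g₂ ξ a)) := fun a => ⟨1, zero_le_one,
    fun P => by
      rw [one_mul]
      refine (P.mg₂ a).trans ?_
      have := P.hA₂
      exact le_add_of_nonneg_left (by positivity)⟩
  have hwY : Bd r Y (fun (P : I) ξ => P.X.2.1 * dev P.D.w₁ ξ) := by
    refine (Bd.smul hp (hD.w.anti hr0)).mono ?_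
    simpa only [mul_comm] using hEZ
  have hμ := FSys.mu_estimate hω hδ hwY hg₁ fun P : I => P.full.sys
  obtain ⟨e1, e2, e3, e4, e5⟩ := FSys.estimate hω hδ hr2
    (by rwa [show r - 2 * δ - 2 * δ = r - 4 * δ by ring]) hD (fun P => P.hk.1) hEZ hYZ
    (Le.of_le fun _ => le_rfl) hm hp hb hμ (fun a => (hg₂ a).anti (by linarith)) hg₂m
    fun P : I => P.full.sys
  rw [show r - 2 * δ - 2 * δ = r - 4 * δ by ring] at e2 e3 e4 e5
  obtain ⟨f1, f2, f3⟩ := FChi.estimate hω hδ hr4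
    (by rwa [show r - 4 * δ - 2 * δ = r - 6 * δ by ring]) hδ1
    (by rwa [show r - 4 * δ - 2 * δ = r - 6 * δ by ring]) hD
    (fun j => bd_pd_of_admissible hρ0 hρ' (fun P : I => P.adm) j) hEZ e4
    (fun P : I => P.full.sys.meanl) (fun j => (e5 j).1) hx fun P : I => P.full.chi
  rw [show r - 4 * δ - 2 * δ = r - 6 * δ by ring] at f1
  set RY : I → ℝ := fun P => ‖P.R‖ + Y P
  have hYR : Le Y RY := Le.of_le fun P => le_add_of_nonneg_left (norm_nonneg _)
  have hRR : ∀ P : I, ‖P.R‖ ≤ RY P := fun P => le_add_of_nonneg_right (hY0 P)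
  have gq : ∀ j, Bc RY (fun P : I => P.R.1 j) := fun j => ⟨1, zero_le_one, fun P => by
    rw [one_mul]; exact (norm_le_pi_norm _ j).trans ((norm_fst_le P.R).trans (hRR P))⟩
  have gr : Bc RY (fun P : I => P.R.2.1) := ⟨1, zero_le_one, fun P => by
    rw [one_mul]
    exact (norm_fst_le _).trans ((norm_snd_le P.R).trans (hRR P))⟩
  have gc : Bc RY (fun P : I => P.R.2.2.1) := ⟨1, zero_le_one, fun P => by
    rw [one_mul]
    exact (norm_fst_le _).trans ((norm_snd_le _).trans ((norm_snd_le P.R).trans (hRR P)))⟩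
  have gy : ∀ j, Bc RY (fun P : I => P.R.2.2.2 j) := fun j => ⟨1, zero_le_one, fun P => by
    rw [one_mul]
    exact (norm_le_pi_norm _ j).trans
      ((norm_snd_le _).trans ((norm_snd_le _).trans ((norm_snd_le P.R).trans (hRR P))))⟩
  -- The leading part of `X ↦ R` is triangular: `b` is read off from `γ`, then `p` from `r` using `k
  -- ≤ 1`, while `m` comes from `q` through `K₀⁻¹` and `x` from `y`. All corrections are of order
  -- `Y`.
  have xb : Bc RY (fun P : I => P.X.2.2.1) := (gc.sub (f2.mono hYR)).congr' fun P => by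
    rw [P.full.mean_lam]; ring
  have xkb : Bc RY (fun P : I => (P.k : ℂ) * P.X.2.2.1) := by
    obtain ⟨K, hK, h1⟩ := xb
    refine ⟨K, hK, fun P => le_trans ?_ (h1 P)⟩
    rw [norm_mul, Complex.norm_real, Real.norm_eq_abs, abs_of_nonneg P.hk.1]
    exact mul_le_of_le_one_left (norm_nonneg _) P.hk.2
  have xp : Bc RY (fun P : I => P.X.2.1) :=
    ((gr.sub (e1.mono hYR)).add xkb).congr' fun P => by ring
  have xm : ∀ j, Bc RY (fun P : I => P.X.1 j) := by
    refine Bc.of_mulVec hK fun j => ((gq j).sub ((e5 j).2.mono hYR)).congr' fun P => ?_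
    have h1 := P.full.chi.eqχ j 0
    simp only [fc_zero, dv, Pi.zero_apply, Int.cast_zero, mul_zero, Finset.sum_const_zero,
      Complex.ofReal_zero, zero_mul, neg_zero, zero_add, if_true] at h1
    rw [K0c_mulVec, h1]
    ring
  have xx : ∀ j, Bc RY (fun P : I => P.X.2.2.2 j) := fun j =>
    ((gy j).sub ((f3 j).mono hYR)).congr' fun P => by
      rw [P.full.mean_χ]; ring
  obtain ⟨K₁, hK₁, k1⟩ := Bc.norm_pi xm
  obtain ⟨K₂, hK₂, k2⟩ := xp
  obtain ⟨K₃, hK₃, k3⟩ := xb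
  obtain ⟨K₄, hK₄, k4⟩ := Bc.norm_pi xx
  have hmuZ : ∀ j, Bd (r - 6 * δ) Z (fun (P : I) ξ => P.μ ξ j) := fun j =>
    ((((hμ j).anti (by linarith : r - 6 * δ ≤ r - 2 * δ)).mono hYZ).add
      (Bd.const (hm j) _)).congr fun P ξ => by ring
  obtain ⟨K₅, hK₅, k5⟩ := Bd.uniform hmuZ
  obtain ⟨K₆, hK₆, k6⟩ := Bd.uniform fun a => (e4 a).anti (by linarith : r - 6 * δ ≤ r - 4 * δ)
  obtain ⟨K₇, hK₇, k7⟩ := Bd.uniform f1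
  obtain ⟨K₈, hK₈, k8⟩ := f2
  refine ⟨K₁ + K₂ + K₃ + K₄ + K₅ + K₆ + K₇ + K₈, by positivity, fun P => ⟨?_, ?_,
    fun s => ⟨fun j => ?_, fun j => ?_, fun j => ?_⟩⟩⟩
  · have e : ‖P.R‖ + |P.ε| * ‖P.X‖ + |P.ε| * P.A₂ + P.A₁ = RY P := by simp only [RY, Y]; ring
    have hRY0 : 0 ≤ RY P := add_nonneg (norm_nonneg _) (hY0 P)
    have q1 := mul_nonneg hK₁ hRY0
    have q2 := mul_nonneg hK₂ hRY0
    have q3 := mul_nonneg hK₃ hRY0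
    have q4 := mul_nonneg hK₄ hRY0
    have q5 := mul_nonneg (add_nonneg (add_nonneg (add_nonneg hK₅ hK₆) hK₇) hK₈) hRY0
    have := k1 P
    have := k2 P
    have := k3 P
    have := k4 P
    rw [e]
    refine max_le ?_ (max_le ?_ (max_le ?_ ?_)) <;> linarith
  · have h1 := k8 P
    beta_reduce at h1
    rw [P.full.mean_lam] at h1
    have := hY0 P
    refine h1.trans ?_
    change K₈ * Y P ≤ _ * Y P
    gcongr
    linarith
  · refine (k5 P s j).trans ?_
    have := hZ0 P
    change K₅ * Z P * _ ≤ _ * Z P * _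
    gcongr
    linarith
  · refine (k6 P s j).trans ?_
    have := hZ0 P
    change K₆ * Z P * _ ≤ _ * Z P * _
    gcongr
    linarith
  · refine (k7 P s j).trans ?_
    have := hZ0 P
    change K₇ * Z P * _ ≤ _ * Z P * _
    gcongr
    linarith

/-- Admissible data and a source-free solution of the `(μ, λ)`-system with `k = 0` and with mean
value zero of the first component of `λ`. -/
structure SysData (ω : Fin N → ℝ) (H₀ : (Fin N → ℝ) × ℝ → ℝ) (ρ : ℝ) (d : ℕ) (C₀ : ℝ) where
  (ε α : ℝ)
  D : Coeffs N
  hε : |ε| ≤ 1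
  adm : Admissible H₀ ρ d C₀ ε α D
  m : Fin N → ℂ
  (p r : ℂ)
  μ : (Fin N → ℂ) → (Fin N → ℂ)
  lam : (Fin N → ℂ) → (Fin 2 → ℂ)
  sys : FSys ω 0 D (fun _ => 0) (fun _ _ => 0) μ lam m p 0 r

/-- Without sources and with `b = 0`, the oscillation of `λ` is also perturbative. So every
deviation from the leading constants is `O(ε(|m| + |p|))`, a bound relative to `m` and `p` that
`full_estimate` does not give. -/
theorem sys_estimate {ω : Fin N → ℝ} (hω : SmallDiv ω) (H₀ : (Fin N → ℝ) × ℝ → ℝ)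
    {ρ ρ' : ℝ} (d : ℕ) (C₀ : ℝ) {r δ : ℝ} (hδ : 0 < δ)
    (hρ' : ρ' < ρ) (hr0 : r ≤ ρ') (hr2 : |r - 2 * δ| < ρ') (hr4 : |r - 4 * δ| < ρ') :
    ∃ C, 0 ≤ C ∧ ∀ P : SysData ω H₀ ρ d C₀,
      ‖P.r - P.p‖ ≤ C * (|P.ε| * (‖P.m‖ + ‖P.p‖)) ∧
      (∀ j, ‖mean (chiF P.D P.μ P.lam j) - (K0c H₀).mulVec P.m j‖ ≤
        C * (|P.ε| * (‖P.m‖ + ‖P.p‖))) ∧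
      ∀ s, (∀ j, ‖fc (fun ξ => P.μ ξ j - P.m j) s‖ ≤
          C * (|P.ε| * (‖P.m‖ + ‖P.p‖)) * Real.exp (-(r - 4 * δ) * l1 s)) ∧
        ‖fc (fun ξ => P.lam ξ 0) s‖ ≤
          C * (|P.ε| * (‖P.m‖ + ‖P.p‖)) * Real.exp (-(r - 4 * δ) * l1 s) ∧
        ‖fc (fun ξ => P.lam ξ 1 + ∑ j, (t0 H₀ j : ℂ) * P.m j) s‖ ≤
          C * (|P.ε| * (‖P.m‖ + ‖P.p‖)) * Real.exp (-(r - 4 * δ) * l1 s) := by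
  set I := SysData ω H₀ ρ d C₀
  have hρ0 : 0 ≤ ρ' := (abs_nonneg _).trans hr2.le
  set E : I → ℝ := fun P => |P.ε|
  set Z : I → ℝ := fun P => ‖P.m‖ + ‖P.p‖
  set Y : I → ℝ := fun P => |P.ε| * (‖P.m‖ + ‖P.p‖)
  have hY0 : ∀ P : I, 0 ≤ Y P := fun P => by positivity
  have hEZ : Le (fun P => E P * Z P) Y := Le.of_le fun P => le_rfl
  have hYZ : Le Y Z := Le.of_le fun P =>
    mul_le_of_le_one_left (add_nonneg (norm_nonneg _) (norm_nonneg _)) P.hε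
  have hD : Near ρ' E ((S0 H₀).map Complex.ofReal) (fun j => (t0 H₀ j : ℂ)) fun P : I => P.D :=
    near_of_admissible hρ0 hρ' fun P => P.adm
  have hm : ∀ j, Bc Z (fun P : I => P.m j) := fun j => ⟨1, zero_le_one, fun P => by
    rw [one_mul]
    exact (norm_le_pi_norm _ j).trans (le_add_of_nonneg_right (norm_nonneg _))⟩
  have hp : Bc Z (fun P : I => P.p) := ⟨1, zero_le_one, fun P => by
    rw [one_mul]
    exact le_add_of_nonneg_left (norm_nonneg _)⟩
  have hwY : Bd r Y (fun (P : I) ξ => P.p * dev P.D.w₁ ξ) := by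
    refine (Bd.smul hp (hD.w.anti hr0)).mono ?_
    simpa only [mul_comm] using hEZ
  have hμ := FSys.mu_estimate hω hδ hwY Bd.zero fun P : I => P.sys
  obtain ⟨e1, e2, e3, -, e5⟩ := FSys.estimate hω hδ hr2
    (by rwa [show r - 2 * δ - 2 * δ = r - 4 * δ by ring]) hD (fun _ => le_rfl) hEZ
    (Le.of_le fun _ => le_rfl) hYZ hm hp Bc.zero hμ (fun a => Bd.zero)
    (fun a => by simpa only [mean_const] using Bc.zero) fun P : I => P.sys
  rw [show r - 2 * δ - 2 * δ = r - 4 * δ by ring] at e2 e3 e5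
  obtain ⟨K₁, hK₁, k1⟩ := e1
  obtain ⟨K₂, hK₂, k2⟩ := exists_uniform_bound (fun j => (e5 j).2) fun j P => norm_nonneg _
  obtain ⟨K₃, hK₃, k3⟩ := Bd.uniform fun j =>
    (hμ j).anti (by linarith : r - 4 * δ ≤ r - 2 * δ)
  obtain ⟨K₄, hK₄, k4⟩ := e2.2
  obtain ⟨K₅, hK₅, k5⟩ := e3.2
  refine ⟨K₁ + K₂ + K₃ + K₄ + K₅, by positivity, fun P => ⟨?_, fun j => ?_,
    fun s => ⟨fun j => ?_, ?_, ?_⟩⟩⟩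
  · have h1 := k1 P
    simp only [mul_zero, sub_zero] at h1
    have := hY0 P
    refine h1.trans ?_
    change K₁ * Y P ≤ _ * Y P
    gcongr
    linarith
  · have h1 := (k2 P).2 j
    have := hY0 P
    rw [K0c_mulVec]
    refine h1.trans ?_
    change K₂ * Y P ≤ _ * Y P
    gcongr
    linarith
  · have := hY0 P
    refine (k3 P s j).trans ?_
    change K₃ * Y P * _ ≤ _ * Y P * _
    gcongr
    linarith
  · have h1 := k4 P s
    have := hY0 P
    simp only [sub_zero] at h1
    refine h1.trans ?_
    change K₄ * Y P * _ ≤ _ * Y P * _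
    gcongr
    linarith
  · have := hY0 P
    refine (k5 P s).trans ?_
    change K₅ * Y P * _ ≤ _ * Y P * _
    gcongr
    linarith

end

end JacobiTorus

namespace JacobiTorus

noncomputable section

open MeasureTheory Set Filter Topology

variable {N : ℕ} {I : Type*}

/-! ### Sobolev norms in terms of Fourier coefficients -/

/-- The weight `1 + |s|²`. -/
def wt (s : Fin N → ℤ) : ℝ := 1 + ∑ j, (s j : ℝ) ^ 2

theorem one_le_wt (s : Fin N → ℤ) : 1 ≤ wt s :=
  le_add_of_nonneg_right (Finset.sum_nonneg fun _ _ => sq_nonneg _)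

theorem wt_pos (s : Fin N → ℤ) : 0 < wt s := zero_lt_one.trans_le (one_le_wt s)

/-- Peetre's inequality, in the form suited to negative Sobolev order. -/
theorem wt_sub_le (s t : Fin N → ℤ) : wt (s - t) ≤ 2 * wt t * wt s := by
  have h1 : ∑ j, ((s - t) j : ℝ) ^ 2 ≤ 2 * ∑ j, (s j : ℝ) ^ 2 + 2 * ∑ j, (t j : ℝ) ^ 2 := by
    rw [Finset.mul_sum, Finset.mul_sum, ← Finset.sum_add_distrib]
    refine Finset.sum_le_sum fun j _ => ?_
    rw [Pi.sub_apply, Int.cast_sub]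
    nlinarith [sq_nonneg ((s j : ℝ) + t j)]
  have h2 : 0 ≤ ∑ j, (s j : ℝ) ^ 2 := Finset.sum_nonneg fun _ _ => sq_nonneg _
  have h3 : 0 ≤ ∑ j, (t j : ℝ) ^ 2 := Finset.sum_nonneg fun _ _ => sq_nonneg _
  unfold wt
  nlinarith [mul_nonneg h2 h3]

theorem wt_le (s : Fin N → ℤ) : wt s ≤ (1 + l1 s) ^ 2 := by
  have := Finset.sum_sq_le_sq_sum_of_nonneg (s := Finset.univ) (f := fun j => |(s j : ℝ)|)
    fun j _ => abs_nonneg _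
  simp only [sq_abs] at this
  have h := l1_nonneg s
  unfold wt
  unfold l1 at *
  nlinarith

theorem one_add_l1_le {δ : ℝ} (hδ : 0 < δ) (s : Fin N → ℤ) :
    1 + l1 s ≤ (1 + δ⁻¹) * Real.exp (δ * l1 s) := by
  have h1 := l1_mul_exp_le hδ s
  have h2 := Real.one_le_exp (mul_nonneg hδ.le (l1_nonneg s))
  linarith

theorem sq_dv_le (ω : Fin N → ℝ) (s : Fin N → ℤ) : dv ω s ^ 2 ≤ (∑ j, ω j ^ 2) * wt s := by
  refine (Finset.sum_mul_sq_le_sq_mul_sq _ _ _).trans ?_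
  refine mul_le_mul_of_nonneg_left ?_ (Finset.sum_nonneg fun _ _ => sq_nonneg _)
  unfold wt
  linarith

/-- The two normalisations differ by `(2π)^{N/2}`. -/
theorem norm_fourierCoef_sq (f : (Fin N → ℂ) → ℂ) (m : Fin N → ℤ) :
    ‖fourierCoef f m‖ ^ 2 = (2 * Real.pi) ^ N * ‖fc f m‖ ^ 2 := by
  have h2 : (0 : ℝ) < 2 * Real.pi := by positivity
  have e : (fun ξ : Fin N → ℂ => Complex.exp (-Complex.I * ∑ j, (m j : ℂ) * ξ j) * f ξ) =
      fun ξ => chr (-m) ξ * f ξ := by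
    funext ξ
    simp [chr, Finset.sum_neg_distrib]
  have h3 : ((2 * Real.pi) ^ (-(N : ℝ) / 2) : ℝ) ^ 2 = ((2 * Real.pi) ^ N)⁻¹ := by
    rw [← Real.rpow_natCast, ← Real.rpow_mul h2.le, ← Real.rpow_natCast (2 * Real.pi) N,
      ← Real.rpow_neg h2.le]
    congr 1
    push_cast
    ring
  rw [fourierCoef, e, fc, mean, norm_mul, norm_mul, mul_pow ‖_‖, mul_pow ‖_‖, Complex.norm_real,
    Real.norm_eq_abs, sq_abs, h3]
  have h4 : ‖(2 * (Real.pi : ℂ))⁻¹ ^ N‖ = ((2 * Real.pi) ^ N)⁻¹ := by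
    rw [norm_pow, norm_inv, norm_mul, Complex.norm_ofNat, Complex.norm_real, Real.norm_eq_abs,
      abs_of_pos Real.pi_pos, inv_pow]
  rw [h4]
  have h5 : (2 * Real.pi) ^ N ≠ 0 := by positivity
  generalize (2 * Real.pi) ^ N = c at h5
  field_simp

theorem sobSq_eq (σ : ℝ) (f : (Fin N → ℂ) → ℂ) :
    sobSq σ f = ENNReal.ofReal ((2 * Real.pi) ^ N) *
      ∑' m, ENNReal.ofReal (wt m ^ σ * ‖fc f m‖ ^ 2) := by
  rw [sobSq, ← ENNReal.tsum_mul_left]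
  refine tsum_congr fun m => ?_
  rw [norm_fourierCoef_sq, ← ENNReal.ofReal_mul (by positivity), wt]
  congr 1
  ring

theorem sobSq_le_of_decay {r : ℝ} (hr : 0 < r) : ∃ C, 0 ≤ C ∧ ∀ (f : (Fin N → ℂ) → ℂ) (A : ℝ),
    (∀ s, ‖fc f s‖ ≤ A * Real.exp (-r * l1 s)) → sobSq 0 f ≤ ENNReal.ofReal (C * A ^ 2) := by
  have hs := summable_exp_l1 (N := N) (show 0 < 2 * r by positivity)
  have h0 : 0 ≤ ∑' s : Fin N → ℤ, Real.exp (-(2 * r) * l1 s) :=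
    tsum_nonneg fun _ => (Real.exp_pos _).le
  refine ⟨(2 * Real.pi) ^ N * ∑' s : Fin N → ℤ, Real.exp (-(2 * r) * l1 s), by positivity,
    fun f A hf => ?_⟩
  rw [sobSq_eq, mul_assoc, ENNReal.ofReal_mul (by positivity), ← tsum_mul_right,
    ENNReal.ofReal_tsum_of_nonneg (fun _ => by positivity) (hs.mul_right _)]
  gcongr ENNReal.ofReal _ * ?_
  refine ENNReal.tsum_le_tsum fun m => ENNReal.ofReal_le_ofReal ?_
  rw [Real.rpow_zero, one_mul]
  calc ‖fc f m‖ ^ 2 ≤ (A * Real.exp (-r * l1 m)) ^ 2 := by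
        have := hf m
        gcongr
    _ = Real.exp (-(2 * r) * l1 m) * A ^ 2 := by
        rw [mul_pow, ← Real.exp_nat_mul]
        push_cast
        ring_nf

theorem sobSq_neg_one_le (f : (Fin N → ℂ) → ℂ) : sobSq (-1) f ≤ sobSq 0 f := by
  rw [sobSq_eq, sobSq_eq]
  gcongr with m
  · exact one_le_wt m
  · norm_num

/-- The `H⁻¹` norm as a real number. -/
def sobR (f : (Fin N → ℂ) → ℂ) : ℝ := (sob (-1) f).toReal

theorem sobR_nonneg (f : (Fin N → ℂ) → ℂ) : 0 ≤ sobR f := ENNReal.toReal_nonneg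

theorem sobSq_neg_one_eq {f : (Fin N → ℂ) → ℂ} (h : sobSq (-1) f ≠ ⊤) :
    sobSq (-1) f = ENNReal.ofReal (sobR f ^ 2) ∧ sob (-1) f = ENNReal.ofReal (sobR f) := by
  have h1 : sob (-1) f = ENNReal.ofReal (sobR f) :=
    (ENNReal.ofReal_toReal (ENNReal.rpow_ne_top_of_nonneg (by norm_num) h)).symm
  refine ⟨?_, h1⟩
  rw [ENNReal.ofReal_pow (sobR_nonneg f), ← h1, sob, ← ENNReal.rpow_natCast, ← ENNReal.rpow_mul]
  norm_num

/-- A single term of the series is at most the whole sum. Thus the `H⁻¹` norm allows linear growth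
of coefficients, which fits into `Bd` with an arbitrarily small negative rate. -/
theorem norm_fc_le_sobR {f : (Fin N → ℂ) → ℂ} (h : sobSq (-1) f ≠ ⊤) (s : Fin N → ℤ) :
    ‖fc f s‖ ≤ (1 + l1 s) * sobR f := by
  have h1 := (sobSq_neg_one_eq h).1
  have h2 : ENNReal.ofReal (wt s ^ (-1 : ℝ) * ‖fc f s‖ ^ 2) ≤ ENNReal.ofReal (sobR f ^ 2) := by
    rw [← h1, sobSq_eq]
    refine (ENNReal.le_tsum s).trans (le_mul_of_one_le_left zero_le ?_)
    rw [ENNReal.one_le_ofReal]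
    exact one_le_pow₀ (by linarith [Real.pi_gt_three])
  rw [ENNReal.ofReal_le_ofReal_iff (sq_nonneg _), Real.rpow_neg_one,
    inv_mul_le_iff₀ (wt_pos s)] at h2
  refine abs_le_of_sq_le_sq' ?_ (mul_nonneg (by linarith [l1_nonneg s]) (sobR_nonneg f)) |>.2
  rw [mul_pow]
  exact h2.trans (mul_le_mul_of_nonneg_right (wt_le s) (sq_nonneg _))

/-! ### Multiplication in `H⁻¹` -/

theorem ennreal_mul_le_sq_add_sq (x y : ENNReal) : x * y ≤ x ^ 2 + y ^ 2 := by
  rcases le_total x y with h | h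
  · calc x * y ≤ y ^ 2 := by rw [sq]; gcongr
      _ ≤ _ := le_add_self
  · calc x * y ≤ x ^ 2 := by rw [sq]; gcongr
      _ ≤ _ := le_self_add

/-- Weighted Cauchy–Schwarz with the constant `2`, obtained from `xy ≤ x² + y²` after expanding the
square as a double sum; in `[0,∞]` no summability has to be discussed. -/
theorem ennreal_sq_tsum_mul_le {κ : Type*} (h x : κ → ENNReal) :
    (∑' a, h a * x a) ^ 2 ≤ 2 * (∑' a, h a) * ∑' a, h a * x a ^ 2 := by
  calc (∑' a, h a * x a) ^ 2 = ∑' a, ∑' b, (h a * x a) * (h b * x b) := by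
        simp only [ENNReal.tsum_mul_left, ENNReal.tsum_mul_right, sq]
    _ ≤ ∑' a, ∑' b, ((h a * x a ^ 2) * h b + h a * (h b * x b ^ 2)) := by
        gcongr with a b
        calc (h a * x a) * (h b * x b) = h a * h b * (x a * x b) := by ring
          _ ≤ h a * h b * (x a ^ 2 + x b ^ 2) := by
              gcongr
              exact ennreal_mul_le_sq_add_sq _ _
          _ = _ := by ring
    _ = _ := by
        simp only [ENNReal.tsum_add, ENNReal.tsum_mul_left, ENNReal.tsum_mul_right]
        ring

theorem ofReal_norm_sq (z : ℂ) (c : ℝ) (hc : 0 ≤ c) :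
    ENNReal.ofReal (c * ‖z‖ ^ 2) = ENNReal.ofReal c * ‖z‖ₑ ^ 2 := by
  rw [ENNReal.ofReal_mul hc, ENNReal.ofReal_pow (norm_nonneg _), ofReal_norm]

/-- The product is a convolution with a summable kernel. Cauchy–Schwarz with that kernel as weight,
Peetre's inequality and an exchange of sums give boundedness on `H⁻¹`, with norm proportional to the
amplitude `A`. -/
theorem sobSq_mul_le {R : ℝ} (hR : 0 < R) : ∃ C, 0 ≤ C ∧ ∀ (h f : (Fin N → ℂ) → ℂ) (A : ℝ),
    TC h → TC f → 0 ≤ A → (∀ s, ‖fc h s‖ ≤ A * Real.exp (-R * l1 s)) →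
    sobSq (-1) (fun ξ => h ξ * f ξ) ≤ ENNReal.ofReal (C * A ^ 2) * sobSq (-1) f := by
  -- The Peetre weight is at most quadratic in `1 + l1 t`, so it costs `2δ = R / 2`, leaving the
  -- rate `R / 2` for summation.
  set δ := R / 4 with hδ
  have hδ0 : 0 < δ := by positivity
  set L := (1 + δ⁻¹) ^ 2 with hL
  have hs := summable_exp_l1 (N := N) (show 0 < R / 2 by positivity)
  set H := ∑' s : Fin N → ℤ, Real.exp (-(R / 2) * l1 s) with hH
  have hH0 : 0 ≤ H := tsum_nonneg fun _ => (Real.exp_pos _).le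
  have hHt : ∀ A : ℝ, 0 ≤ A → ∑' s : Fin N → ℤ, ENNReal.ofReal (A * Real.exp (-(R / 2) * l1 s)) =
      ENNReal.ofReal (A * H) := fun A hA => by
    rw [hH, ← tsum_mul_left, ENNReal.ofReal_tsum_of_nonneg (fun _ => by positivity) (hs.mul_left _)]
  have hw : ∀ s : Fin N → ℤ, wt s * Real.exp (-R * l1 s) ≤ L * Real.exp (-(R / 2) * l1 s) := by
    intro s
    have h1 : wt s ≤ L * Real.exp (R / 2 * l1 s) := by
      refine (wt_le s).trans ((pow_le_pow_left₀ (by linarith [l1_nonneg s])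
        (one_add_l1_le hδ0 s) 2).trans (le_of_eq ?_))
      rw [mul_pow, ← Real.exp_nat_mul, hL, hδ]
      push_cast
      ring_nf
    calc _ ≤ L * Real.exp (R / 2 * l1 s) * Real.exp (-R * l1 s) := by gcongr
      _ = _ := by rw [mul_assoc, ← Real.exp_add]; ring_nf
  have hL0 : 0 ≤ L := by positivity
  refine ⟨4 * L * H ^ 2, by positivity, fun h f A th tf hA hh => ?_⟩
  rw [sobSq_eq, sobSq_eq, mul_left_comm]
  gcongr ENNReal.ofReal _ * ?_
  have h1 : ∀ s, ‖fc (fun ξ => h ξ * f ξ) s‖ₑ ^ 2 ≤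
      2 * ENNReal.ofReal (A * H) * ∑' t, ‖fc h t‖ₑ * ‖fc f (s - t)‖ₑ ^ 2 := by
    intro s
    have h2 := hasSum_fc_mul th (summable_of_decay_pos hR hh) tf s
    have h3 : ‖fc (fun ξ => h ξ * f ξ) s‖ₑ ≤ ∑' t, ‖fc h t‖ₑ * ‖fc f (s - t)‖ₑ := by
      rw [← h2.tsum_eq]
      simp only [← enorm_mul]
      exact enorm_tsum_le_tsum_enorm
    refine (pow_le_pow_left' h3 2).trans ((ennreal_sq_tsum_mul_le _ _).trans ?_)
    gcongr
    rw [← hHt A hA]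
    refine ENNReal.tsum_le_tsum fun t => ?_
    rw [← ofReal_norm]
    refine ENNReal.ofReal_le_ofReal ((hh t).trans ?_)
    have := l1_nonneg t
    gcongr
    linarith
  calc ∑' m, ENNReal.ofReal (wt m ^ (-1 : ℝ) * ‖fc (fun ξ => h ξ * f ξ) m‖ ^ 2)
      ≤ ∑' m, ∑' t, 2 * ENNReal.ofReal (A * H) *
          (ENNReal.ofReal (2 * A * L * Real.exp (-(R / 2) * l1 t)) *
            ENNReal.ofReal (wt (m - t) ^ (-1 : ℝ) * ‖fc f (m - t)‖ ^ 2)) := by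
        gcongr with m
        have hwm := (wt_pos m).le
        rw [ofReal_norm_sq _ _ (by positivity), ENNReal.tsum_mul_left]
        refine (mul_le_mul_right (h1 m) _).trans ?_
        rw [mul_left_comm, ← ENNReal.tsum_mul_left]
        refine mul_le_mul_right (ENNReal.tsum_le_tsum fun t => ?_) _
        have hwt := (wt_pos (m - t)).le
        rw [ofReal_norm_sq _ _ (by positivity), ← mul_assoc, ← mul_assoc, ← ofReal_norm,
          ← ENNReal.ofReal_mul (by positivity), ← ENNReal.ofReal_mul (by positivity)]
        refine mul_le_mul_left (ENNReal.ofReal_le_ofReal ?_) _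
        rw [Real.rpow_neg_one, Real.rpow_neg_one, inv_mul_le_iff₀ (wt_pos m), ← div_eq_mul_inv,
          mul_div_assoc', le_div_iff₀ (wt_pos _)]
        calc ‖fc h t‖ * wt (m - t) ≤ (A * Real.exp (-R * l1 t)) * (2 * wt t * wt m) :=
              mul_le_mul (hh t) (wt_sub_le m t) hwt (by positivity)
          _ = wt m * (2 * A * (wt t * Real.exp (-R * l1 t))) := by ring
          _ ≤ wt m * (2 * A * (L * Real.exp (-(R / 2) * l1 t))) := by
              have := hw t
              gcongr
          _ = _ := by ring
    _ = 2 * ENNReal.ofReal (A * H) * (ENNReal.ofReal (2 * A * L * H) *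
          ∑' m, ENNReal.ofReal (wt m ^ (-1 : ℝ) * ‖fc f m‖ ^ 2)) := by
        -- After exchanging the sums, the inner sum over `m` is translation invariant and no longer
        -- depends on `t`.
        rw [ENNReal.tsum_comm, ← hHt (2 * A * L) (by positivity),
          ← ENNReal.tsum_mul_right, ← ENNReal.tsum_mul_left]
        refine tsum_congr fun t => ?_
        rw [ENNReal.tsum_mul_left, ENNReal.tsum_mul_left]
        congr 2
        exact (Equiv.subRight t).tsum_eq
          (fun m => ENNReal.ofReal (wt m ^ (-1 : ℝ) * ‖fc f m‖ ^ 2))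
    _ = _ := by
        rw [← mul_assoc]
        congr 1
        rw [show (2 : ENNReal) = ENNReal.ofReal 2 by simp, ← ENNReal.ofReal_mul (by norm_num),
          ← ENNReal.ofReal_mul (by positivity)]
        congr 1
        ring

/-- A function is controlled in `H⁻¹` through the equation for the second component of `λ`. -/
theorem sobSq_le_of_eq {ω : Fin N → ℝ} {k : ℝ} {w u v f g : (Fin N → ℂ) → ℂ}
    (h : ∀ s, fc w s = -(Complex.I * dv ω s * fc v s - k * fc u s) - fc f s - fc g s) :
    sobSq (-1) w ≤ ENNReal.ofReal (4 * ∑ j, ω j ^ 2) * sobSq 0 v +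
      ENNReal.ofReal (4 * k ^ 2) * sobSq 0 u + ENNReal.ofReal 4 * sobSq (-1) f +
      ENNReal.ofReal 4 * sobSq 0 g := by
  have hω0 : 0 ≤ ∑ j, ω j ^ 2 := Finset.sum_nonneg fun _ _ => sq_nonneg _
  simp only [sobSq_eq]
  simp only [mul_left_comm (ENNReal.ofReal _) (ENNReal.ofReal ((2 * Real.pi) ^ N)), ← mul_add]
  gcongr
  simp only [← ENNReal.tsum_mul_left, ← ENNReal.tsum_add]
  gcongr with m
  have hm := wt_pos m
  have hi : (wt m)⁻¹ ≤ 1 := inv_le_one_of_one_le₀ (one_le_wt m)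
  rw [← ENNReal.ofReal_mul (by positivity), ← ENNReal.ofReal_mul (by positivity),
    ← ENNReal.ofReal_mul (by positivity), ← ENNReal.ofReal_mul (by positivity),
    ← ENNReal.ofReal_add (by positivity) (by positivity),
    ← ENNReal.ofReal_add (by positivity) (by positivity),
    ← ENNReal.ofReal_add (by positivity) (by positivity)]
  refine ENNReal.ofReal_le_ofReal ?_
  simp only [Real.rpow_zero, Real.rpow_neg_one, one_mul]
  have h1 : ‖fc w m‖ ≤ |dv ω m| * ‖fc v m‖ + |k| * ‖fc u m‖ + ‖fc f m‖ + ‖fc g m‖ := by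
    rw [h m]
    refine (norm_sub_le _ _).trans (add_le_add_left ((norm_sub_le _ _).trans
      (add_le_add_left ?_ _)) _)
    rw [norm_neg]
    refine (norm_sub_le _ _).trans (le_of_eq ?_)
    simp
  have h2 : ‖fc w m‖ ^ 2 ≤ 4 * (dv ω m ^ 2 * ‖fc v m‖ ^ 2) + 4 * (k ^ 2 * ‖fc u m‖ ^ 2) +
      4 * ‖fc f m‖ ^ 2 + 4 * ‖fc g m‖ ^ 2 := by
    refine (pow_le_pow_left₀ (norm_nonneg _) h1 2).trans ?_
    rw [← sq_abs (dv ω m), ← sq_abs k, ← mul_pow, ← mul_pow]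
    generalize |dv ω m| * ‖fc v m‖ = a
    generalize |k| * ‖fc u m‖ = b
    generalize ‖fc f m‖ = c
    generalize ‖fc g m‖ = e
    nlinarith [sq_nonneg (a - b), sq_nonneg (a - c), sq_nonneg (a - e), sq_nonneg (b - c),
      sq_nonneg (b - e), sq_nonneg (c - e)]
  calc (wt m)⁻¹ * ‖fc w m‖ ^ 2 ≤ (wt m)⁻¹ * (4 * (dv ω m ^ 2 * ‖fc v m‖ ^ 2) +
        4 * (k ^ 2 * ‖fc u m‖ ^ 2) + 4 * ‖fc f m‖ ^ 2 + 4 * ‖fc g m‖ ^ 2) := by gcongr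
    _ = 4 * ((wt m)⁻¹ * dv ω m ^ 2) * ‖fc v m‖ ^ 2 + (wt m)⁻¹ * (4 * k ^ 2 * ‖fc u m‖ ^ 2) +
        4 * ((wt m)⁻¹ * ‖fc f m‖ ^ 2) + (wt m)⁻¹ * (4 * ‖fc g m‖ ^ 2) := by ring
    _ ≤ _ := by
        -- Boundedness of `ω·∇` from `L²` to `H⁻¹`.
        have h3 : (wt m)⁻¹ * dv ω m ^ 2 ≤ ∑ j, ω j ^ 2 := by
          rw [inv_mul_le_iff₀ hm, mul_comm]
          exact sq_dv_le ω m
        have h4 := mul_le_of_le_one_left (by positivity : 0 ≤ 4 * k ^ 2 * ‖fc u m‖ ^ 2) hi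
        have h5 := mul_le_of_le_one_left (by positivity : 0 ≤ 4 * ‖fc g m‖ ^ 2) hi
        gcongr

/-! ### Squares -/

/-- In each product of coefficients at `t` and `s - t`, the strong decay is used at the longer
frequency and the weak growth bound at the shorter one. The resulting rate `(R - δ)/2` in `l1 t + l1
(s - t)` is shared between decay in `s` and summation over `t`. The amplitude is the mixed product
of the two, which is what gives `ε |w₁*|_{-1}` for the quadratic source. -/
theorem Bd.sq {R δ : ℝ} (hδ : 0 ≤ δ) (hR : δ < R) {E A : I → ℝ} {f : I → (Fin N → ℂ) → ℂ}
    (h : Bd R E f) (h' : Bd (-δ) A f) :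
    Bd ((R - δ) / 4) (fun i => E i * A i) (fun i ξ => f i ξ ^ 2) := by
  obtain ⟨K, hK, h1⟩ := h.2
  obtain ⟨L, hL, h2⟩ := h'.2
  have hR0 : 0 < R := hδ.trans_lt hR
  have hq : 0 < (R - δ) / 4 := by linarith
  have hS := summable_exp_l1 (N := N) hq
  refine ⟨fun i => by simpa only [pow_two] using (h.1 i).mul (h.1 i),
    K * L * ∑' t : Fin N → ℤ, Real.exp (-((R - δ) / 4) * l1 t),
    mul_nonneg (by positivity) (tsum_nonneg fun _ => (Real.exp_pos _).le), fun i s => ?_⟩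
  have hKE : 0 ≤ K * E i := by
    have := (norm_nonneg _).trans (h1 i 0)
    simpa [l1] using this
  have hLA : 0 ≤ L * A i := by
    have := (norm_nonneg _).trans (h2 i 0)
    simpa [l1] using this
  have key : ∀ a b : Fin N → ℤ, l1 b ≤ l1 a → ‖fc (f i) a‖ * ‖fc (f i) b‖ ≤
      K * E i * (L * A i) * Real.exp (-(R - δ) * ((l1 a + l1 b) / 2)) := by
    intro a b hab
    calc _ ≤ (K * E i * Real.exp (-R * l1 a)) * (L * A i * Real.exp (-(-δ) * l1 b)) :=
          mul_le_mul (h1 i a) (h2 i b) (norm_nonneg _) (by positivity)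
      _ = (K * E i * (L * A i)) * (Real.exp (-R * l1 a) * Real.exp (-(-δ) * l1 b)) := by ring
      _ = (K * E i * (L * A i)) * Real.exp (-R * l1 a + δ * l1 b) := by
          rw [← Real.exp_add, neg_neg]
      _ ≤ _ := by
          gcongr
          nlinarith
  have h4 : ∀ t, ‖fc (f i) t * fc (f i) (s - t)‖ ≤
      (K * E i * (L * A i) * Real.exp (-((R - δ) / 4) * l1 s)) *
        Real.exp (-((R - δ) / 4) * l1 t) := by
    intro t
    rw [norm_mul]
    have h5 : ‖fc (f i) t‖ * ‖fc (f i) (s - t)‖ ≤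
        K * E i * (L * A i) * Real.exp (-(R - δ) * ((l1 t + l1 (s - t)) / 2)) := by
      rcases le_total (l1 (s - t)) (l1 t) with hle | hle
      · exact key _ _ hle
      · rw [mul_comm, add_comm (l1 t)]; exact key _ _ hle
    refine h5.trans ?_
    rw [mul_assoc _ (Real.exp _) (Real.exp _), ← Real.exp_add]
    have h6 := l1_add_le t (s - t)
    rw [add_sub_cancel] at h6
    have h7 := l1_nonneg (s - t)
    gcongr
    nlinarith
  have h3 := hasSum_fc_mul (h.1 i) (summable_of_decay_pos hR0 (h1 i)) (h.1 i) s
  have h5 := tsum_of_norm_bounded (hS.mul_left _).hasSum h4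
  rw [h3.tsum_eq, tsum_mul_left] at h5
  simp only [pow_two]
  refine h5.trans (le_of_eq ?_)
  ring

end

end JacobiTorus

namespace JacobiTorus

noncomputable section

open MeasureTheory Set Filter Topology

variable {N : ℕ} {I : Type*}

/-! ### From Fourier estimates to solutions -/

theorem TC.eq_zero {f : (Fin N → ℂ) → ℂ} (hf : TC f) (h : ∀ s, fc f s = 0) (x : Fin N → ℝ) :
    f (realPt x) = 0 := by
  have h0 : fc f = 0 := funext h
  have h1 := hf.hasSum (by rw [h0]; exact summable_zero) x
  simp only [h, zero_mul] at h1
  exact h1.unique hasSum_zero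

theorem nrm_le_of_decay {ρ R A : ℝ} (hρ : 0 < ρ) (hR : ρ < R) {f : (Fin N → ℂ) → ℂ}
    (hf : MemA ρ 0 f) (h : ∀ s, ‖fc f s‖ ≤ A * Real.exp (-R * l1 s)) :
    nrm ρ 0 f ≤ ENNReal.ofReal (A * ∑' s : Fin N → ℤ, Real.exp (-(R - ρ) * l1 s)) :=
  nrm_le_of_bound fun ξ hξ => by
    rw [hf.eqOn_Ser hρ hξ]
    exact Ser.norm_le hR h (stripInt_subset_strip hξ)

section Solutions

variable {ω : Fin N → ℝ} {k ρ ρ' : ℝ} {D : Coeffs N} {g₁ : (Fin N → ℂ) → ℂ}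
  {g₂ : (Fin N → ℂ) → (Fin 2 → ℂ)} {X R : Cst N} {γ : ℂ}
  {μ : (Fin N → ℂ) → (Fin N → ℂ)} {lam : (Fin N → ℂ) → (Fin 2 → ℂ)}
  {χ : (Fin N → ℂ) → (Fin N → ℂ)} {p : ℂ}

theorem IsSolution.full (hρ : 0 < ρ) (hD : LocCoeffs ρ D) (hg₁ : Loc ρ g₁)
    (hg₂ : ∀ a, Loc ρ (fun ξ => g₂ ξ a)) (h : IsSolution ω k D ρ g₁ g₂ γ μ lam χ p) :
    ∃ m b x, Full ω k D g₁ g₂ (m, p, b, x) (0, 0, γ, 0) μ lam χ := by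
  obtain ⟨h1, h2, h3, h4⟩ := (isSolution_iff hρ hD hg₁ hg₂ h.mem_μ h.mem_lam h.mem_χ).1 h
  exact ⟨_, _, _, h1, h2, h3, h4⟩

theorem Full.isSolution (hρ : 0 < ρ) (hD : LocCoeffs ρ D) (hg₁ : Loc ρ g₁)
    (hg₂ : ∀ a, Loc ρ (fun ξ => g₂ ξ a)) (hμ : MemAVec ρ 0 μ) (hl : MemAVec ρ 0 lam)
    (hχ : MemAVec ρ 0 χ) (h : Full ω k D g₁ g₂ X (0, 0, γ, 0) μ lam χ) :
    IsSolution ω k D ρ g₁ g₂ γ μ lam χ X.2.1 := by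
  refine (isSolution_iff hρ hD hg₁ hg₂ hμ hl hχ).2 ⟨?_, ?_, h.mean_lam, h.mean_χ⟩
  · have h1 := h.sys
    rwa [← funext h1.meanμ, ← h1.meanl] at h1
  · have h1 := h.chi
    rwa [← funext h1.meanχ] at h1

/-- If all coefficients vanish then so do the functions on the real torus, and every component of
the residual is a mean there. Together with the estimates, this makes the residual a function of the
constants. -/
theorem Full.residual_eq_zero (h : Full ω k D (fun _ => 0) (fun _ _ => 0) 0 R μ lam χ)
    (hμ : ∀ j s, fc (fun ξ => μ ξ j) s = 0) (hl : ∀ a s, fc (fun ξ => lam ξ a) s = 0)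
    (hχ : ∀ j s, fc (fun ξ => χ ξ j) s = 0) : R = 0 := by
  have zμ : ∀ x, μ (realPt x) = 0 := fun x => funext fun j => (h.sys.tcμ j).eq_zero (hμ j) x
  have zl : ∀ x, lam (realPt x) = 0 := fun x => funext fun a => (h.sys.tcl a).eq_zero (hl a) x
  have zχ : ∀ x, χ (realPt x) = 0 := fun x => funext fun j => (h.chi.tcχ j).eq_zero (hχ j) x
  have e1 : R.1 = 0 := funext fun j => by
    have h1 := h.chi.eqχ j 0
    rw [if_pos rfl, hχ, fc_congr (g := fun _ => 0) fun x => by simp [chiF, zμ, zl]] at h1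
    simpa [fc_const] using h1.symm
  have e2 : R.2.1 = 0 := by
    have h1 := h.sys.eq0 0
    rw [if_pos rfl, hl, hl, fc_congr (g := fun _ => 0) fun x => by simp [lamF, zμ]] at h1
    simpa [fc_const] using h1.symm
  have e3 : R.2.2.1 = 0 := by
    rw [← h.mean_lam, mean_congr (g := fun _ => 0) fun x => by simp [zl],
      mean_congr (g := fun _ => 0) (f := fun ξ => dotProduct (χ ξ) (grad D.w₁ ξ)) fun x => by
        simp [zχ], mean_const, add_zero]
  have e4 : R.2.2.2 = 0 := funext fun j => by
    rw [← h.mean_χ, mean_congr (g := fun _ => 0) fun x => by simp [zχ], mean_const]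
    rfl
  exact Prod.ext e1 (Prod.ext e2 (Prod.ext e3 e4))

/-- Solvability and uniqueness, given estimates for the homogeneous system. -/
theorem exists_unique_solution (hω : SmallDiv ω) (hk : 0 ≤ k) (hρ' : 0 < ρ') (hρ : ρ' < ρ)
    (hD : LocCoeffs ρ D) (hg₁ : Loc ρ g₁) (hg₂ : ∀ a, Loc ρ (fun ξ => g₂ ξ a)) {C : ℝ}
    (hC : ∀ X R μ lam χ, Full ω k D (fun _ => 0) (fun _ _ => 0) X R μ lam χ →
      ‖X‖ ≤ C * ‖R‖ ∧ ∀ s, (∀ j, ‖fc (fun ξ => μ ξ j) s‖ ≤ C * ‖X‖) ∧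
        (∀ a, ‖fc (fun ξ => lam ξ a) s‖ ≤ C * ‖X‖) ∧ ∀ j, ‖fc (fun ξ => χ ξ j) s‖ ≤ C * ‖X‖)
    (γ : ℂ) :
    ∃ X μ lam χ, Full ω k D g₁ g₂ X (0, 0, γ, 0) μ lam χ ∧
      IsSolution ω k D ρ' g₁ g₂ γ μ lam χ X.2.1 ∧
      ∀ μ' lam' χ' p', IsSolution ω k D ρ' g₁ g₂ γ μ' lam' χ' p' →
        EqOn μ' μ (strip ρ') ∧ EqOn lam' lam (strip ρ') ∧ EqOn χ' χ (strip ρ') ∧ p' = X.2.1 := by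
  -- Zero constants force all Fourier coefficients to vanish; this serves both the existence
  -- argument and uniqueness.
  have van : ∀ R μ lam χ, Full ω k D (fun _ => 0) (fun _ _ => 0) 0 R μ lam χ →
      (∀ j s, fc (fun ξ => μ ξ j) s = 0) ∧ (∀ a s, fc (fun ξ => lam ξ a) s = 0) ∧
        ∀ j s, fc (fun ξ => χ ξ j) s = 0 := by
    intro R μ lam χ h
    have h1 := (hC _ _ _ _ _ h).2
    simp only [norm_zero, mul_zero, norm_le_zero_iff] at h1
    exact ⟨fun j s => (h1 s).1 j, fun j s => (h1 s).2.1 j, fun j s => (h1 s).2.2 j⟩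
  obtain ⟨X, μ, lam, χ, hF, hμ, hl, hχ⟩ := exists_Full_residual hω hk hρ' hρ hD hg₁ hg₂
    (fun X R μ lam χ h => (hC X R μ lam χ h).1)
    (fun R μ lam χ h => h.residual_eq_zero (van _ _ _ _ h).1 (van _ _ _ _ h).2.1 (van _ _ _ _ h).2.2)
    (0, 0, γ, 0)
  have hD' := hD.mono hρ.le
  have hg₁' := hg₁.mono hρ.le
  have hg₂' := fun a => (hg₂ a).mono hρ.le
  refine ⟨X, μ, lam, χ, hF, hF.isSolution hρ' hD' hg₁' hg₂' hμ hl hχ, fun μ' lam' χ' p' h' => ?_⟩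
  obtain ⟨m, b, x, hF'⟩ := h'.full hρ' hD' hg₁' hg₂'
  -- The difference of two solutions is homogeneous with zero residual, so its constants vanish by
  -- the estimate and then the functions do.
  have h1 := hF'.add_mul hρ' hD' (hg₁'.tc hρ') (hg₁'.tc hρ') (fun a => (hg₂' a).tc hρ')
    (fun a => (hg₂' a).tc hρ') (-1) hF
  have hR : ((0, 0, γ, 0) : Cst N) + (-1 : ℂ) • (0, 0, γ, 0) = 0 := by module
  simp only [hR, neg_one_mul, ← sub_eq_add_neg, sub_self] at h1
  have hX := (hC _ _ _ _ _ h1).1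
  rw [norm_zero, mul_zero, norm_le_zero_iff, neg_one_smul, ← sub_eq_add_neg] at hX
  rw [neg_one_smul, ← sub_eq_add_neg, hX] at h1
  obtain ⟨vμ, vl, vχ⟩ := van _ _ _ _ h1
  have eq : ∀ {κ : Type} {u v : (Fin N → ℂ) → κ → ℂ}, MemAVec ρ' 0 u → MemAVec ρ' 0 v →
      (∀ j s, fc (fun ξ => u ξ j - v ξ j) s = 0) → EqOn u v (strip ρ') := by
    intro κ u v hu hv h ξ hξ
    funext j
    refine (hu j).eqOn_of_fc_eq hρ' (hv j) (fun s => ?_) hξ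
    have h2 := h j s
    rwa [fc_sub ((hu j).tc hρ') ((hv j).tc hρ'), sub_eq_zero] at h2
  exact ⟨eq h'.mem_μ hμ vμ, eq h'.mem_lam hl vl, eq h'.mem_χ hχ vχ,
    sub_eq_zero.1 (congrArg (fun Y : Cst N => Y.2.1) hX)⟩

end Solutions

/-! ### Uniform estimates for the two problems -/

section Uniform

variable {ω : Fin N → ℝ} {H₀ : (Fin N → ℝ) × ℝ → ℝ} {ρ : ℝ} {d : ℕ} {C₀ : ℝ}

/-- `full_estimate` without sources; the term `ε ‖X‖` on the right is absorbed once `C ε ≤ 1/2`. -/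
theorem hom_estimate (hω : SmallDiv ω) (hK : (K0 H₀).det ≠ 0) (hρ : 0 < ρ) (d : ℕ) (C₀ : ℝ) :
    ∃ C, 0 ≤ C ∧ ∃ ε₁ : ℝ, 0 < ε₁ ∧ ε₁ ≤ 1 ∧ ∀ ε α k : ℝ, ∀ D : Coeffs N, |ε| ≤ ε₁ →
      k ∈ Icc (0 : ℝ) 1 → Admissible H₀ ρ d C₀ ε α D → ∀ X R μ lam χ,
      Full ω k D (fun _ => 0) (fun _ _ => 0) X R μ lam χ →
      ‖X‖ ≤ C * ‖R‖ ∧ ‖R.2.2.1 - X.2.2.1‖ ≤ C * (|ε| * ‖X‖) ∧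
      ∀ s, (∀ j, ‖fc (fun ξ => μ ξ j) s‖ ≤ C * ‖X‖ * Real.exp (-(3 / 4 * ρ) * l1 s)) ∧
        (∀ a, ‖fc (fun ξ => lam ξ a) s‖ ≤ C * ‖X‖ * Real.exp (-(3 / 4 * ρ) * l1 s)) ∧
        ∀ j, ‖fc (fun ξ => χ ξ j) s‖ ≤ C * ‖X‖ * Real.exp (-(3 / 4 * ρ) * l1 s) := by
  -- The starting rate `3ρ/4 + 6δ` is at most `13ρ/16`, below the rate `7ρ/8` of the coefficients.
  -- After the loss of `6δ` the rate `3ρ/4` is left, still larger than the width `ρ/2` of the target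
  -- strip.
  set δ := min 1 (ρ / 96) with hδ
  have hδ0 : 0 < δ := by positivity
  have hδ1 : δ ≤ 1 := min_le_left _ _
  have hδρ : δ ≤ ρ / 96 := min_le_right _ _
  obtain ⟨C, hC, h⟩ := full_estimate hω hK d C₀ (ρ := ρ) (ρ' := 7 / 8 * ρ) (r := 3 / 4 * ρ + 6 * δ)
    hδ0 hδ1 (by linarith) (by linarith) (by rw [abs_lt]; constructor <;> linarith)
    (by rw [abs_lt]; constructor <;> linarith) (by rw [abs_lt]; constructor <;> linarith)
  refine ⟨2 * C, by positivity, min 1 (2 * (C + 1))⁻¹, by positivity, min_le_left _ _,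
    fun ε α k D hε hk hD X R μ lam χ hF => ?_⟩
  have hε1 : |ε| ≤ 1 := hε.trans (min_le_left _ _)
  have hε2 : C * |ε| ≤ 1 / 2 := by
    have h1 : |ε| ≤ (2 * (C + 1))⁻¹ := hε.trans (min_le_right _ _)
    calc C * |ε| ≤ (C + 1) * (2 * (C + 1))⁻¹ := by gcongr; linarith
      _ = 1 / 2 := by field_simp
  obtain ⟨h1, h2, h3⟩ := h
    { ε := ε, α := α, k := k, D := D, hε := hε1, hk := hk, adm := hD, g₁ := fun _ => 0,
      g₂ := fun _ _ => 0, A₁ := 0, A₂ := 0, hA₁ := le_rfl, hA₂ := le_rfl, tg₁ := TC.const 0,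
      tg₂ := fun _ => TC.const 0, bg₁ := fun s => by simp [fc_const],
      bg₂ := fun a s => by simp [fc_const], mg₂ := fun a => by simp [mean_const],
      X := X, R := R, μ := μ, lam := lam, χ := χ, full := hF }
  simp only [mul_zero, add_zero] at h1 h2 h3
  have hX := norm_nonneg X
  have hle : C * ‖X‖ ≤ 2 * C * ‖X‖ := by nlinarith [mul_nonneg hC hX]
  refine ⟨?_, h2.trans ?_, fun s => ⟨fun j => ((h3 s).1 j).trans ?_,
    fun j => ((h3 s).2.1 j).trans ?_, fun j => ((h3 s).2.2 j).trans ?_⟩⟩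
  · have : C * (|ε| * ‖X‖) ≤ 1 / 2 * ‖X‖ := by rw [← mul_assoc]; gcongr
    nlinarith
  · gcongr
    linarith
  all_goals
    rw [add_sub_cancel_right]
    gcongr

/-- Admissible coefficients. -/
structure Adm (H₀ : (Fin N → ℝ) × ℝ → ℝ) (ρ : ℝ) (d : ℕ) (C₀ : ℝ) where
  (ε α : ℝ)
  D : Coeffs N
  hε : |ε| ≤ 1
  adm : Admissible H₀ ρ d C₀ ε α D

/-- The sources of the second problem. -/
def src₁ (D : Coeffs N) : (Fin N → ℂ) → ℂ := fun ξ => 1 / 2 * (dev D.w₁ ξ) ^ 2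

def src₂ (D : Coeffs N) : (Fin N → ℂ) → (Fin 2 → ℂ) :=
  fun ξ => -(dev D.w₁ ξ • (D.W ξ).transpose.mulVec e₁)

theorem src₂_apply (D : Coeffs N) (ξ : Fin N → ℂ) (a : Fin 2) :
    src₂ D ξ a = -(dev D.w₁ ξ * D.W ξ 0 a) := by
  fin_cases a <;> simp [src₂, e₁]

theorem Loc.dev {f : (Fin N → ℂ) → ℂ} (hf : Loc ρ f) : Loc ρ (dev f) := hf.sub (Loc.const _)

theorem LocCoeffs.src₁ {D : Coeffs N} (hD : LocCoeffs ρ D) : Loc ρ (src₁ D) := by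
  have h := (hD.w.dev.mul hD.w.dev).const_mul (1 / 2)
  simp only [← pow_two] at h
  exact h

theorem LocCoeffs.src₂ {D : Coeffs N} (hD : LocCoeffs ρ D) (a : Fin 2) :
    Loc ρ (fun ξ => src₂ D ξ a) := by
  simpa only [src₂_apply] using (hD.w.dev.mul (hD.W 0 a)).neg

theorem mean_dev {f : (Fin N → ℂ) → ℂ} (hf : TC f) : mean (dev f) = 0 := by
  unfold dev
  rw [mean_sub hf (TC.const _), mean_const, sub_self]

theorem Adm.near {r : ℝ} (hr : 0 ≤ r) (hrρ : r < ρ) :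
    Near r (fun P : Adm H₀ ρ d C₀ => |P.ε|) ((S0 H₀).map Complex.ofReal)
      (fun j => (t0 H₀ j : ℂ)) fun P => P.D :=
  near_of_admissible hr hrρ fun P => P.adm

/-- Relative to the amplitude `A` of `w₁*`, the quadratic source and the means of `g₂` gain a factor
`ε`. For the means this is because `w₁*` has mean zero, so only `W - I` contributes. -/
theorem src_bounds {r ρ' : ℝ} (hr : |r| < ρ') (hρ' : ρ' < ρ) {A : Adm H₀ ρ d C₀ → ℝ}
    (hA : ∀ P, 0 ≤ A P) (hw : Bd r A fun P => dev P.D.w₁) :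
    Bd r (fun P => |P.ε| * A P) (fun P => src₁ P.D) ∧
      (∀ a, Bd r A (fun P ξ => src₂ P.D ξ a)) ∧
      ∀ a, Bc (fun P => |P.ε| * A P) (fun P => mean (fun ξ => src₂ P.D ξ a)) := by
  have hρ0 : 0 ≤ ρ' := (abs_nonneg r).trans hr.le
  have hD := Adm.near (H₀ := H₀) (d := d) (C₀ := C₀) hρ0 hρ'
  have h1 : ∀ a, Bd r (fun P : Adm H₀ ρ d C₀ => |P.ε| * A P) (fun P ξ =>
      (P.D.W ξ 0 a - (1 : Matrix (Fin 2) (Fin 2) ℂ) 0 a) * dev P.D.w₁ ξ) :=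
    fun a => Bd.mul hr (hD.W 0 a) hw
  have e : ∀ (P : Adm H₀ ρ d C₀) ξ a, src₂ P.D ξ a =
      -((P.D.W ξ 0 a - (1 : Matrix (Fin 2) (Fin 2) ℂ) 0 a) * dev P.D.w₁ ξ +
        (1 : Matrix (Fin 2) (Fin 2) ℂ) 0 a * dev P.D.w₁ ξ) := fun P ξ a => by
    rw [src₂_apply]; ring
  refine ⟨((Bd.mul hr hD.w hw).const_mul (1 / 2)).congr fun P ξ => by rw [src₁, pow_two],
    fun a => (((h1 a).mono (Le.of_le fun P => mul_le_of_le_one_left (hA P) P.hε)).add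
      (hw.const_mul _)).neg.congr fun P ξ => e P ξ a, fun a => (h1 a).mean.neg.congr' fun P => ?_⟩
  have h2 : mean (dev P.D.w₁) = 0 :=
    mean_dev (P.adm.locCoeffs.w.tc ((abs_nonneg r).trans_lt (hr.trans hρ')))
  simp only [e]
  rw [mean_neg, mean_add ((h1 a).tc P) ((hw.const_mul _).tc P), mean_const_mul, h2, mul_zero,
    add_zero]

/-- The amplitude and the rate, possibly negative, are left free so that the same argument serves
the sup norm and the `H⁻¹` norm. Since only `A₁` enters the bound for the constants without `ε`, and
it is itself `O(ε A)`, the constants are `O(ε A)`. -/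
theorem src_estimate (hω : SmallDiv ω) (hK : (K0 H₀).det ≠ 0) {ρ' r δ : ℝ} (hδ : 0 < δ) (hδ1 : δ ≤ 1)
    (hr : |r| < ρ') (hρ' : ρ' < ρ) (hr2 : |r - 2 * δ| < ρ') (hr4 : |r - 4 * δ| < ρ')
    (hr6 : |r - 6 * δ| < ρ') {A : Adm H₀ ρ d C₀ → ℝ} (hA : ∀ P, 0 ≤ A P)
    (hw : Bd r A fun P => dev P.D.w₁) :
    ∃ C, 0 ≤ C ∧ ∃ ε₁ : ℝ, 0 < ε₁ ∧ ∀ P : Adm H₀ ρ d C₀, |P.ε| ≤ ε₁ → ∀ k ∈ Icc (0 : ℝ) 1,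
      ∀ X μ lam χ, Full ω k P.D (src₁ P.D) (src₂ P.D) X 0 μ lam χ →
      ‖X‖ ≤ C * (|P.ε| * A P) ∧
      ∀ s, (∀ j, ‖fc (fun ξ => μ ξ j) s‖ ≤ C * A P * Real.exp (-(r - 6 * δ) * l1 s)) ∧
        (∀ a, ‖fc (fun ξ => lam ξ a) s‖ ≤ C * A P * Real.exp (-(r - 6 * δ) * l1 s)) ∧
        ∀ j, ‖fc (fun ξ => χ ξ j) s‖ ≤ C * A P * Real.exp (-(r - 6 * δ) * l1 s) := by
  obtain ⟨C, hC, h⟩ := full_estimate hω hK d C₀ hδ hδ1 hρ' ((le_abs_self r).trans hr.le) hr2 hr4 hr6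
  obtain ⟨b1, b2, b3⟩ := src_bounds hr hρ' hA hw
  obtain ⟨K₁, hK₁, k1⟩ := b1.2
  obtain ⟨K₂, hK₂, k2⟩ := Bd.uniform b2
  obtain ⟨K₃, hK₃, k3⟩ := exists_uniform_bound b3 fun a P => norm_nonneg _
  set K := K₁ + K₂ + K₃ with hKdef
  have hK0 : 0 ≤ K := by positivity
  refine ⟨4 * C * K + 4 * C * C * K + 2 * C * K, by positivity, (2 * (C + 1))⁻¹, by positivity,
    fun P hε k hk X μ lam χ hF => ?_⟩
  have hε2 : C * |P.ε| ≤ 1 / 2 := by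
    calc C * |P.ε| ≤ (C + 1) * (2 * (C + 1))⁻¹ := by gcongr; linarith
      _ = 1 / 2 := by field_simp
  have hAP := hA P
  have hA₁ : 0 ≤ |P.ε| * A P := by positivity
  have tg₂ : ∀ a, TC (fun ξ => src₂ P.D ξ a) := fun a => (b2 a).tc P
  obtain ⟨h1, -, h3⟩ := h
    { ε := P.ε, α := P.α, k := k, D := P.D, hε := P.hε, hk := hk, adm := P.adm, g₁ := src₁ P.D,
      g₂ := src₂ P.D, A₁ := K * (|P.ε| * A P), A₂ := K * A P, hA₁ := by positivity,
      hA₂ := by positivity, tg₁ := b1.tc P, tg₂ := tg₂,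
      bg₁ := fun s => (k1 P s).trans (by gcongr; linarith),
      bg₂ := fun a s => (k2 P s a).trans (by gcongr; linarith),
      mg₂ := fun a => ((k3 P).2 a).trans (by gcongr; linarith),
      X := X, R := 0, μ := μ, lam := lam, χ := χ, full := hF }
  simp only [norm_zero, zero_add] at h1 h3
  have hX := norm_nonneg X
  have h5 : ‖X‖ ≤ 4 * C * K * (|P.ε| * A P) := by
    have : C * (|P.ε| * ‖X‖) ≤ 1 / 2 * ‖X‖ := by rw [← mul_assoc]; gcongr
    nlinarith
  have h6 : |P.ε| * A P ≤ A P := mul_le_of_le_one_left hAP P.hε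
  have h7 : C * (‖X‖ + K * (|P.ε| * A P) + K * A P) ≤
      (4 * C * K + 4 * C * C * K + 2 * C * K) * A P := by
    calc _ ≤ C * (4 * C * K * A P + K * A P + K * A P) := by
          have h8 : 4 * C * K * (|P.ε| * A P) ≤ 4 * C * K * A P := by gcongr
          gcongr
          exact h5.trans h8
      _ ≤ _ := by nlinarith [mul_nonneg (mul_nonneg hC hK0) hAP]
  refine ⟨h5.trans ?_, fun s => ⟨fun j => ((h3 s).1 j).trans ?_,
    fun j => ((h3 s).2.1 j).trans ?_, fun j => ((h3 s).2.2 j).trans ?_⟩⟩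
  · have h8 : 0 ≤ 4 * C * C * K + 2 * C * K := by positivity
    gcongr
    linarith
  all_goals gcongr

end Uniform

end

end JacobiTorus

namespace JacobiTorus

noncomputable section

open MeasureTheory Set Filter Topology

variable {N : ℕ} {I : Type*}

/-! ### The second problem -/

theorem Bd.comp {r : ℝ} {A : I → ℝ} {f : I → (Fin N → ℂ) → ℂ} (hf : Bd r A f) {κ : Type*}
    (φ : κ → I) : Bd r (fun i => A (φ i)) (fun i => f (φ i)) := by
  obtain ⟨K, hK, h⟩ := hf.2
  exact ⟨fun i => hf.1 (φ i), K, hK, fun i => h (φ i)⟩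

theorem sq_sob (σ : ℝ) (f : (Fin N → ℂ) → ℂ) : sob σ f ^ 2 = sobSq σ f := by
  rw [sob, ← ENNReal.rpow_natCast, ← ENNReal.rpow_mul]
  norm_num

section SecondProblem

variable {ω : Fin N → ℝ} {H₀ : (Fin N → ℝ) × ℝ → ℝ} {ρ : ℝ} {d : ℕ} {C₀ : ℝ}

theorem Admissible.memA_dev {ε α : ℝ} {D : Coeffs N} (hρ : 0 < ρ)
    (h : Admissible H₀ ρ d C₀ ε α D) : MemA ρ 0 (dev D.w₁) := by
  have h1 := h.mem_w₁.zero.sub (MemA.const (mean fun ξ => D.w₁ ξ - (α : ℂ)))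
  have h2 := dev_sub_const (h.locCoeffs.w.tc hρ) α
  rw [← h2]
  exact h1

theorem Admissible.nrm_dev_le {ε α : ℝ} {D : Coeffs N} (hρ : 0 < ρ)
    (h : Admissible H₀ ρ d C₀ ε α D) :
    nrm ρ 0 (dev D.w₁) ≤ ENNReal.ofReal (2 * |C₀| * |ε|) := by
  rw [← dev_sub_const (h.locCoeffs.w.tc hρ) α]
  refine nrm_le_of_bound fun ξ hξ => (norm_sub_le _ _).trans ?_
  have h1 := h.bound_w hξ
  have h2 : ‖mean fun ξ => D.w₁ ξ - (α : ℂ)‖ ≤ |C₀| * |ε| :=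
    norm_mean_le fun x => h.bound_w (realPt_mem_stripInt hρ x)
  linarith

theorem Adm.bd_dev_nrm {r : ℝ} (hr : 0 ≤ r) (hrρ : r < ρ) :
    Bd r (fun P : Adm H₀ ρ d C₀ => (nrm ρ 0 (dev P.D.w₁)).toReal) (fun P => dev P.D.w₁) := by
  have hρ := hr.trans_lt hrρ
  refine Bd.of_bound hr hrρ zero_le_one (fun P => P.adm.memA_dev hρ) fun P ξ hξ => ?_
  rw [one_mul]
  refine norm_le_of_nrm_le ENNReal.toReal_nonneg ?_ hξ
  rw [ENNReal.ofReal_toReal (P.adm.memA_dev hρ).finite.ne]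

theorem Admissible.sobSq_dev_ne_top {ε α : ℝ} {D : Coeffs N} (hρ : 0 < ρ)
    (h : Admissible H₀ ρ d C₀ ε α D) : sobSq (-1) (dev D.w₁) ≠ ⊤ := by
  obtain ⟨A, hA⟩ := (h.memA_dev hρ).exists_decay (half_pos hρ).le (half_lt_self hρ)
  obtain ⟨C, -, hC⟩ := sobSq_le_of_decay (N := N) (half_pos hρ)
  exact ((sobSq_neg_one_le _).trans_lt ((hC _ A hA).trans_lt ENNReal.ofReal_lt_top)).ne

theorem Adm.bd_dev_sobR (hρ : 0 < ρ) {δ : ℝ} (hδ : 0 < δ) :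
    Bd (-δ) (fun P : Adm H₀ ρ d C₀ => sobR (dev P.D.w₁)) (fun P => dev P.D.w₁) := by
  refine ⟨fun P => (P.adm.memA_dev hρ).tc hρ, 1 + δ⁻¹, by positivity, fun P s => ?_⟩
  refine (norm_fc_le_sobR (P.adm.sobSq_dev_ne_top hρ) s).trans ?_
  rw [neg_neg, mul_right_comm]
  exact mul_le_mul_of_nonneg_right (one_add_l1_le hδ s) (sobR_nonneg _)

/-- Admissible coefficients together with a solution of the second problem. -/
structure SrcData (ω : Fin N → ℝ) (H₀ : (Fin N → ℝ) × ℝ → ℝ) (ρ : ℝ) (d : ℕ) (C₀ ε₁ : ℝ)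
    extends Adm H₀ ρ d C₀ where
  hε₁ : |ε| ≤ ε₁
  k : ℝ
  hk : k ∈ Icc (0 : ℝ) 1
  X : Cst N
  μ : (Fin N → ℂ) → (Fin N → ℂ)
  lam : (Fin N → ℂ) → (Fin 2 → ℂ)
  χ : (Fin N → ℂ) → (Fin N → ℂ)
  full : Full ω k D (src₁ D) (src₂ D) X 0 μ lam χ

theorem src_strong_estimate (hω : SmallDiv ω) (hK : (K0 H₀).det ≠ 0) (hρ : 0 < ρ) (d : ℕ) (C₀ : ℝ) :
    ∃ C, 0 ≤ C ∧ ∃ ε₁ : ℝ, 0 < ε₁ ∧ ∀ P : SrcData ω H₀ ρ d C₀ ε₁,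
      ‖P.X‖ ≤ C * (nrm ρ 0 (dev P.D.w₁)).toReal ∧
      ∀ s, (∀ j, ‖fc (fun ξ => P.μ ξ j) s‖ ≤
          C * (nrm ρ 0 (dev P.D.w₁)).toReal * Real.exp (-(3 / 4 * ρ) * l1 s)) ∧
        (∀ a, ‖fc (fun ξ => P.lam ξ a) s‖ ≤
          C * (nrm ρ 0 (dev P.D.w₁)).toReal * Real.exp (-(3 / 4 * ρ) * l1 s)) ∧
        ∀ j, ‖fc (fun ξ => P.χ ξ j) s‖ ≤
          C * (nrm ρ 0 (dev P.D.w₁)).toReal * Real.exp (-(3 / 4 * ρ) * l1 s) := by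
  set δ := min 1 (ρ / 96) with hδ
  have hδ0 : 0 < δ := by positivity
  have hδ1 : δ ≤ 1 := min_le_left _ _
  have hδρ : δ ≤ ρ / 96 := min_le_right _ _
  obtain ⟨C, hC, ε₁, hε₁, h⟩ := src_estimate (d := d) (C₀ := C₀) hω hK (ρ := ρ) (ρ' := 7 / 8 * ρ)
    (r := 3 / 4 * ρ + 6 * δ) hδ0 hδ1 (by rw [abs_lt]; constructor <;> linarith) (by linarith)
    (by rw [abs_lt]; constructor <;> linarith)
    (by rw [abs_lt]; constructor <;> linarith) (by rw [abs_lt]; constructor <;> linarith)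
    (fun P => ENNReal.toReal_nonneg) (Adm.bd_dev_nrm (by linarith) (by linarith))
  refine ⟨C, hC, ε₁, hε₁, fun P => ?_⟩
  obtain ⟨h1, h2⟩ := h P.toAdm P.hε₁ P.k P.hk _ _ _ _ P.full
  rw [add_sub_cancel_right] at h2
  refine ⟨h1.trans ?_, h2⟩
  gcongr
  exact mul_le_of_le_one_left ENNReal.toReal_nonneg P.hε

/-- In the weak norm, the functions `μ` and the perturbative terms of the `λ`-equation are of higher
order. -/
theorem src_weak_estimate (hω : SmallDiv ω) (hK : (K0 H₀).det ≠ 0) (hρ : 0 < ρ) (d : ℕ) (C₀ : ℝ) :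
    ∃ r : ℝ, 0 < r ∧ r < 7 / 8 * ρ ∧ ∃ ε₁ : ℝ, 0 < ε₁ ∧
      Bc (fun P : SrcData ω H₀ ρ d C₀ ε₁ => |P.ε| * sobR (dev P.D.w₁)) (fun P => P.X.2.1) ∧
      ∀ j, Bd r (fun P : SrcData ω H₀ ρ d C₀ ε₁ => |P.ε| * sobR (dev P.D.w₁))
        (fun P ξ => P.μ ξ j) := by
  set δ := min 1 (ρ / 96) with hδ
  have hδ0 : 0 < δ := by positivity
  have hδ1 : δ ≤ 1 := min_le_left _ _
  have hδρ : δ ≤ ρ / 96 := min_le_right _ _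
  -- The negative rate `-δ` admits `w₁*` with amplitude `|w₁*|_{-1}`. Of the outcome only the bound
  -- on the constants is kept, since the bounds on the functions would allow exponential growth.
  obtain ⟨C, hC, ε₁, hε₁, h⟩ := src_estimate (d := d) (C₀ := C₀) hω hK (ρ := ρ) (ρ' := 7 / 8 * ρ)
    (r := -δ) hδ0 hδ1 (by rw [abs_lt]; constructor <;> linarith) (by linarith)
    (by rw [abs_lt]; constructor <;> linarith)
    (by rw [abs_lt]; constructor <;> linarith) (by rw [abs_lt]; constructor <;> linarith)
    (fun P => sobR_nonneg _) (Adm.bd_dev_sobR hρ hδ0)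
  set Y : SrcData ω H₀ ρ d C₀ ε₁ → ℝ := fun P => |P.ε| * sobR (dev P.D.w₁)
  have hY0 : ∀ P, 0 ≤ Y P := fun P => mul_nonneg (abs_nonneg _) (sobR_nonneg _)
  have hX : ∀ P : SrcData ω H₀ ρ d C₀ ε₁, ‖P.X‖ ≤ C * Y P := fun P =>
    (h P.toAdm P.hε₁ P.k P.hk _ _ _ _ P.full).1
  have hp : Bc Y (fun P => P.X.2.1) :=
    ⟨C, hC, fun P => ((norm_fst_le _).trans (norm_snd_le P.X)).trans (hX P)⟩
  have hm : ∀ j, Bc Y (fun P => P.X.1 j) := fun j =>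
    ⟨C, hC, fun P => ((norm_le_pi_norm _ j).trans (norm_fst_le P.X)).trans (hX P)⟩
  have hw : Bd (7 / 8 * ρ) (fun P : SrcData ω H₀ ρ d C₀ ε₁ => |P.ε|) (fun P => dev P.D.w₁) :=
    (Adm.near (by positivity) (by linarith)).w.comp fun P : SrcData ω H₀ ρ d C₀ ε₁ => P.toAdm
  have hw' : Bd (-δ) (fun P : SrcData ω H₀ ρ d C₀ ε₁ => sobR (dev P.D.w₁))
      (fun P => dev P.D.w₁) :=
    (Adm.bd_dev_sobR hρ hδ0).comp fun P : SrcData ω H₀ ρ d C₀ ε₁ => P.toAdm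
  -- The mixed estimate of the square restores a positive rate with amplitude `ε |w₁*|_{-1}`.
  have hg₁ : Bd ((7 / 8 * ρ - δ) / 4) Y (fun P => src₁ P.D) :=
    (Bd.sq hδ0.le (by linarith) hw hw').const_mul (1 / 2)
  -- Here `p` already carries the amplitude, so `w₁*` may be measured in the strong class.
  have hpw : Bd ((7 / 8 * ρ - δ) / 4) Y (fun P ξ => P.X.2.1 * dev P.D.w₁ ξ) :=
    (Bd.smul hp (hw.anti (by linarith))).mono
      (Le.of_le fun P => mul_le_of_le_one_right (hY0 P) P.hε)
  have hμ := FSys.mu_estimate hω hδ0 hpw hg₁ fun P => P.full.sys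
  exact ⟨(7 / 8 * ρ - δ) / 4 - 2 * δ, by linarith, by linarith, ε₁, hε₁, hp, fun j =>
    ((hμ j).add (Bd.const (hm j) _)).congr fun P ξ => by ring⟩

/-- The first `λ`-equation is solved for `w₁*`: up to sign it is `ω·∇λ₂ - kλ₁`, plus `(W₁₁ - 1) w₁*`
and the terms in `μ` and `p`. In `H⁻¹` the latter are `O(ε)|w₁*|_{-1}` by `sobSq_mul_le` and
`src_weak_estimate`, and can be absorbed. -/
theorem src_sob_estimate (hω : SmallDiv ω) (hK : (K0 H₀).det ≠ 0) (hρ : 0 < ρ) (d : ℕ) (C₀ : ℝ) :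
    ∃ C, 0 ≤ C ∧ ∃ ε₁ : ℝ, 0 < ε₁ ∧ ∀ P : SrcData ω H₀ ρ d C₀ ε₁,
      sobVec 0 P.μ ≤ ENNReal.ofReal (C * |P.ε|) * sob (-1) (dev P.D.w₁) ∧
      sob (-1) (dev P.D.w₁) ≤ ENNReal.ofReal C *
        (sob 0 (fun ξ => P.lam ξ 1) + ENNReal.ofReal |P.k| * sob 0 (fun ξ => P.lam ξ 0)) := by
  obtain ⟨r, hr, hrρ, ε₂, hε₂, hp, hμ⟩ := src_weak_estimate hω hK hρ d C₀
  set Y : SrcData ω H₀ ρ d C₀ ε₂ → ℝ := fun P => |P.ε| * sobR (dev P.D.w₁) with hY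
  have hY0 : ∀ P, 0 ≤ Y P := fun P => mul_nonneg (abs_nonneg _) (sobR_nonneg _)
  have hEY : Le (fun P : SrcData ω H₀ ρ d C₀ ε₂ => |P.ε| * Y P) Y :=
    Le.of_le fun P => mul_le_of_le_one_left (hY0 P) P.hε
  have habs : |r| < 7 / 8 * ρ := by rwa [abs_of_pos hr]
  have hD := Adm.near (H₀ := H₀) (ρ := ρ) (d := d) (C₀ := C₀) (r := 7 / 8 * ρ) (by positivity)
    (by linarith)
  have hT : ∀ j, Bd r Y (fun P ξ => P.D.T ξ 0 j * P.μ ξ j) := fun j =>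
    Bd.mul_le habs ((hD.T0 j).comp fun P : SrcData ω H₀ ρ d C₀ ε₂ => P.toAdm) (hμ j) hEY
  have hW : Bd (7 / 8 * ρ) (fun P : SrcData ω H₀ ρ d C₀ ε₂ => |P.ε|)
      (fun P ξ => P.D.W ξ 0 0 - (1 : Matrix (Fin 2) (Fin 2) ℂ) 0 0) :=
    (hD.W 0 0).comp fun P : SrcData ω H₀ ρ d C₀ ε₂ => P.toAdm
  have hpW : Bd r Y (fun P ξ => P.X.2.1 * P.D.W ξ 0 0) :=
    ((Bd.mul_le habs hW (Bd.const hp r) hEY).add (Bd.const hp r)).congr fun P ξ => by simp; ring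
  have hg : Bd r Y (fun P ξ => (∑ j, P.D.T ξ 0 j * P.μ ξ j) + P.X.2.1 * P.D.W ξ 0 0) :=
    (Bd.sum Finset.univ hT).add hpW
  obtain ⟨K₁, hK₁, k1⟩ := Bd.uniform hμ
  obtain ⟨K₂, hK₂, k2⟩ := hg.2
  obtain ⟨K₃, hK₃, k3⟩ := hW.2
  obtain ⟨S, hS, hSob⟩ := sobSq_le_of_decay (N := N) hr
  obtain ⟨S', hS', hMul⟩ := sobSq_mul_le (N := N) (R := 7 / 8 * ρ) (by positivity)
  set B := 4 * (S' * K₃ ^ 2) + 4 * (S * K₂ ^ 2) with hB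
  have hB0 : 0 ≤ B := by positivity
  set a := 4 * ∑ j, ω j ^ 2 with ha
  have ha0 : 0 ≤ a := mul_nonneg (by norm_num) (Finset.sum_nonneg fun _ _ => sq_nonneg _)
  set C₁ := Real.sqrt (N * (S * K₁ ^ 2)) with hC₁
  set C₂ := Real.sqrt (2 * (a + 4)) with hC₂
  refine ⟨C₁ + C₂, by positivity, min ε₂ (min 1 (2 * (B + 1))⁻¹), by positivity, fun P₀ => ?_⟩
  set P : SrcData ω H₀ ρ d C₀ ε₂ := { P₀ with hε₁ := P₀.hε₁.trans (min_le_left _ _) }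
  change sobVec 0 P.μ ≤ ENNReal.ofReal ((C₁ + C₂) * |P.ε|) * sob (-1) (dev P.D.w₁) ∧
      sob (-1) (dev P.D.w₁) ≤ ENNReal.ofReal (C₁ + C₂) *
        (sob 0 (fun ξ => P.lam ξ 1) + ENNReal.ofReal |P.k| * sob 0 (fun ξ => P.lam ξ 0))
  have hεB : B * |P.ε| ^ 2 ≤ 1 / 2 := by
    have h1 : |P.ε| ≤ (2 * (B + 1))⁻¹ := P₀.hε₁.trans ((min_le_right _ _).trans (min_le_right _ _))
    have h2 := P.hε
    have h3 := abs_nonneg P.ε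
    -- This fixes the size of `ε`: the perturbative terms take up at most half of `|w₁*|²_{-1}`.
    calc B * |P.ε| ^ 2 ≤ (B + 1) * |P.ε| := by
          have := pow_le_of_le_one h3 h2 two_ne_zero
          gcongr
          linarith
      _ ≤ (B + 1) * (2 * (B + 1))⁻¹ := by gcongr
      _ = 1 / 2 := by field_simp
  set w := dev P.D.w₁ with hw
  obtain ⟨hsq, hsob⟩ := sobSq_neg_one_eq (P.adm.sobSq_dev_ne_top hρ)
  have hη := sobR_nonneg w
  have hYP : Y P = |P.ε| * sobR w := rfl
  constructor
  · rw [hsob, ← ENNReal.ofReal_mul (by positivity)]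
    have h1 : ∑ j, sobSq 0 (fun ξ => P.μ ξ j) ≤
        ENNReal.ofReal ((C₁ * |P.ε| * sobR w) ^ 2) := by
      calc _ ≤ ∑ j : Fin N, ENNReal.ofReal (S * (K₁ * Y P) ^ 2) :=
            Finset.sum_le_sum fun j _ => hSob _ _ fun s => k1 P s j
        _ = ENNReal.ofReal ((C₁ * |P.ε| * sobR w) ^ 2) := by
            have e : C₁ ^ 2 = N * (S * K₁ ^ 2) := Real.sq_sqrt (by positivity)
            rw [Finset.sum_const, Finset.card_univ, Fintype.card_fin, nsmul_eq_mul,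
              ← ENNReal.ofReal_natCast, ← ENNReal.ofReal_mul (by positivity), hYP]
            congr 1
            linear_combination (-(|P.ε| ^ 2 * sobR w ^ 2)) * e
    have h2 : sobVec 0 P.μ ≤ ENNReal.ofReal (C₁ * |P.ε| * sobR w) := by
      rw [← ENNReal.pow_le_pow_left_iff two_ne_zero, ← ENNReal.ofReal_pow (by positivity), sobVec,
        ← ENNReal.rpow_natCast, ← ENNReal.rpow_mul]
      norm_num
      exact h1
    refine h2.trans (ENNReal.ofReal_le_ofReal ?_)
    gcongr
    exact le_add_of_nonneg_right (Real.sqrt_nonneg _)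
  · have hwtc : TC w := (P.adm.memA_dev hρ).tc hρ
    set f : (Fin N → ℂ) → ℂ := fun ξ =>
      (P.D.W ξ 0 0 - (1 : Matrix (Fin 2) (Fin 2) ℂ) 0 0) * w ξ with hf
    have htf : TC f := (hW.tc P).mul hwtc
    set g : (Fin N → ℂ) → ℂ := fun ξ =>
      (∑ j, P.D.T ξ 0 j * P.μ ξ j) + P.X.2.1 * P.D.W ξ 0 0 with hgdef
    have hlamF : lamF P.D (src₂ P.D) P.μ P.X.2.1 0 = fun ξ => (w ξ + f ξ) + g ξ := by
      funext ξ
      simp only [lamF, src₂_apply, hf, hgdef, Matrix.one_apply_eq]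
      ring
    have hfc : ∀ s, fc w s = -(Complex.I * dv ω s * fc (fun ξ => P.lam ξ 1) s -
        P.k * fc (fun ξ => P.lam ξ 0) s) - fc f s - fc g s := by
      intro s
      have h1 := P.full.sys.eq0 s
      rw [hlamF, fc_add (hwtc.add htf) (hg.tc P), fc_add hwtc htf] at h1
      have h2 : (if s = 0 then (0 : Cst N).2.1 else 0) = 0 := by split_ifs <;> rfl
      rw [h2] at h1
      linear_combination h1
    have h1 := sobSq_le_of_eq hfc
    have h2 : sobSq (-1) f ≤ ENNReal.ofReal (S' * (K₃ * |P.ε|) ^ 2) * sobSq (-1) w :=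
      hMul _ _ _ (hW.tc P) hwtc (by positivity) (k3 P)
    have h3 : sobSq 0 g ≤ ENNReal.ofReal (S * (K₂ * Y P) ^ 2) := hSob _ _ (k2 P)
    have h4 : ENNReal.ofReal 4 * sobSq (-1) f + ENNReal.ofReal 4 * sobSq 0 g ≤
        ENNReal.ofReal (sobR w ^ 2 / 2) := by
      rw [hsq, ← ENNReal.ofReal_mul (by positivity)] at h2
      refine (add_le_add (mul_le_mul_right h2 _) (mul_le_mul_right h3 _)).trans ?_
      rw [← ENNReal.ofReal_mul (by norm_num), ← ENNReal.ofReal_mul (by norm_num),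
        ← ENNReal.ofReal_add (by positivity) (by positivity)]
      refine ENNReal.ofReal_le_ofReal ?_
      calc _ = B * |P.ε| ^ 2 * sobR w ^ 2 := by rw [hYP, hB]; ring
        _ ≤ 1 / 2 * sobR w ^ 2 := by gcongr
        _ = _ := by ring
    have h5 : ENNReal.ofReal (sobR w ^ 2 / 2) ≤ ENNReal.ofReal a * sobSq 0 (fun ξ => P.lam ξ 1) +
        ENNReal.ofReal (4 * P.k ^ 2) * sobSq 0 (fun ξ => P.lam ξ 0) := by
      -- Absorption: half of `|w₁*|²_{-1}` is cancelled on both sides, which is legitimate because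
      -- it is finite.
      refine ENNReal.le_of_add_le_add_right (a := ENNReal.ofReal (sobR w ^ 2 / 2))
        ENNReal.ofReal_ne_top ?_
      rw [← ENNReal.ofReal_add (by positivity) (by positivity), add_halves, ← hsq]
      refine h1.trans ?_
      rw [add_assoc]
      exact add_le_add_right h4 _
    set v := sob 0 (fun ξ => P.lam ξ 1) with hv
    set u := sob 0 (fun ξ => P.lam ξ 0) with hu
    have h6 : ENNReal.ofReal (sobR w ^ 2 / 2) ≤
        ENNReal.ofReal (a + 4) * (v + ENNReal.ofReal |P.k| * u) ^ 2 := by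
      refine h5.trans ?_
      rw [← sq_sob, ← sq_sob, ← hv, ← hu]
      calc ENNReal.ofReal a * v ^ 2 + ENNReal.ofReal (4 * P.k ^ 2) * u ^ 2
          ≤ ENNReal.ofReal (a + 4) * v ^ 2 +
            ENNReal.ofReal (a + 4) * (ENNReal.ofReal |P.k| * u) ^ 2 := by
            rw [mul_pow, ← ENNReal.ofReal_pow (abs_nonneg _), sq_abs, ← mul_assoc,
              ← ENNReal.ofReal_mul (by positivity)]
            gcongr
            · linarith
            · linarith
        _ = ENNReal.ofReal (a + 4) * (v ^ 2 + (ENNReal.ofReal |P.k| * u) ^ 2) := by ring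
        _ ≤ _ := by
            gcongr
            rw [add_sq]
            calc v ^ 2 + (ENNReal.ofReal |P.k| * u) ^ 2 ≤
                  v ^ 2 + (ENNReal.ofReal |P.k| * u) ^ 2 + 2 * v * (ENNReal.ofReal |P.k| * u) :=
                  le_self_add
              _ = _ := by ring
    have h7 : sob (-1) w ≤ ENNReal.ofReal C₂ * (v + ENNReal.ofReal |P.k| * u) := by
      rw [← ENNReal.pow_le_pow_left_iff two_ne_zero, sq_sob, hsq, mul_pow,
        ← ENNReal.ofReal_pow (Real.sqrt_nonneg _), Real.sq_sqrt (by positivity),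
        ENNReal.ofReal_mul (by norm_num), mul_assoc]
      calc ENNReal.ofReal (sobR w ^ 2) = ENNReal.ofReal 2 * ENNReal.ofReal (sobR w ^ 2 / 2) := by
            rw [← ENNReal.ofReal_mul (by norm_num)]
            congr 1
            ring
        _ ≤ _ := mul_le_mul_right h6 _
    refine h7.trans ?_
    gcongr
    exact le_add_of_nonneg_left (Real.sqrt_nonneg _)

end SecondProblem

end

end JacobiTorus

namespace JacobiTorus

noncomputable section

open MeasureTheory Set Filter Topology

variable {N : ℕ}

/-! ### The first problem for `k = 0` -/

section FirstProblem

variable {ω : Fin N → ℝ} {H₀ : (Fin N → ℝ) × ℝ → ℝ} {ρ : ℝ} {d : ℕ} {C₀ : ℝ}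

/-- For `k = 0` the vector `e₁` is in the kernel of `Ω`, and constants are annihilated by `ω·∇`, so
removing `b e₁` leaves the system intact. -/
theorem FSys.sub_mean_lam {D : Coeffs N} {μ : (Fin N → ℂ) → (Fin N → ℂ)}
    {lam : (Fin N → ℂ) → (Fin 2 → ℂ)} {m : Fin N → ℂ} {p b r : ℂ}
    (h : FSys ω 0 D (fun _ => 0) (fun _ _ => 0) μ lam m p b r) :
    FSys ω 0 D (fun _ => 0) (fun _ _ => 0) μ (fun ξ => ![lam ξ 0 - b, lam ξ 1]) m p 0 r := by
  refine ⟨h.tcμ, fun a => ?_, h.meanμ, ?_, h.eqμ, fun s => ?_, fun s => ?_⟩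
  · fin_cases a
    · exact (h.tcl 0).sub (TC.const b)
    · exact h.tcl 1
  · simp only [Matrix.cons_val_zero]
    rw [mean_sub (h.tcl 0) (TC.const b), mean_const, h.meanl, sub_self]
  · have h1 := h.eq0 s
    simp only [Matrix.cons_val_zero, Matrix.cons_val_one, Complex.ofReal_zero, zero_mul,
      sub_zero] at h1 ⊢
    exact h1
  · have h1 := h.eq1 s
    simp only [Matrix.cons_val_zero, Matrix.cons_val_one]
    by_cases hs : s = 0
    · subst hs
      simp only [dv, Pi.zero_apply, Int.cast_zero, mul_zero, Finset.sum_const_zero,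
        Complex.ofReal_zero, zero_mul] at h1 ⊢
      exact h1
    · rw [fc_sub_const (h.tcl 0) _ hs]
      exact h1

theorem K0c_mulVec_mu0 (h : (K0 H₀).det ≠ 0) (D : Coeffs N) (j : Fin N) :
    (K0c H₀).mulVec (mu0 H₀ D) j = mean (fun ξ => D.T ξ 0 j) := by
  have h1 : (K0c H₀).mulVec (mu0 H₀ D) = fun j => mean (fun ξ => D.T ξ 0 j) := by
    rw [mu0, ← K0c, Matrix.mulVec_mulVec, Matrix.mul_nonsing_inv _ (K0c_isUnit h),
      Matrix.one_mulVec]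
  exact congrFun h1 j

/-- The family bound `Bc.of_mulVec` with all pairs `(v, A)` satisfying the hypothesis as index set.
-/
theorem exists_norm_le_of_mulVec (h : (K0 H₀).det ≠ 0) : ∃ C, 0 ≤ C ∧ ∀ (v : Fin N → ℂ) (A : ℝ),
    (∀ j, ‖(K0c H₀).mulVec v j‖ ≤ A) → ‖v‖ ≤ C * |A| := by
  obtain ⟨C, hC, h1⟩ := Bc.norm_pi (Bc.of_mulVec h
    (I := {q : (Fin N → ℂ) × ℝ // ∀ j, ‖(K0c H₀).mulVec q.1 j‖ ≤ q.2}) (A := fun q => |q.1.2|)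
    (m := fun q => q.1.1) fun j => ⟨1, zero_le_one, fun q => by
      rw [one_mul]; exact (q.2 j).trans (le_abs_self _)⟩)
  exact ⟨C, hC, fun v A hv => h1 ⟨(v, A), hv⟩⟩

theorem norm_fc_const_le (c : ℂ) (R : ℝ) (s : Fin N → ℤ) :
    ‖fc (fun _ : Fin N → ℂ => c) s‖ ≤ ‖c‖ * Real.exp (-R * l1 s) := by
  rw [fc_const]
  split_ifs with h
  · subst h; simp [l1]
  · rw [norm_zero]; positivity

/-- The estimates have to be relative to `|μ₀|`, so `hom_estimate` is used only for `b - 1 = O(ε)`.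
The rest comes from `sys_estimate` after removing `b e₁`: first `p` is dominated by `m`, then `K₀ m
+ b t̄₁ = O(ε |m|)` gives `m ≈ -b μ₀`, and so `|m|` is dominated by `|μ₀|`. -/
theorem first_problem_k_zero (hω : SmallDiv ω) (hK : (K0 H₀).det ≠ 0) (hρ : 0 < ρ) (d : ℕ) (C₀ : ℝ) :
    ∃ C, 0 ≤ C ∧ ∃ ε₁ : ℝ, 0 < ε₁ ∧ ∀ ε α : ℝ, ∀ D : Coeffs N, |ε| ≤ ε₁ →
      Admissible H₀ ρ d C₀ ε α D → ∀ X μ lam χ,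
      Full ω 0 D (fun _ => 0) (fun _ _ => 0) X (0, 0, 1, 0) μ lam χ →
      ‖X.2.2.1 - 1‖ ≤ C * |ε| ∧
      ∀ s, (∀ j, ‖fc (fun ξ => μ ξ j + mu0 H₀ D j) s‖ ≤
          C * |ε| * ‖mu0 H₀ D‖ * Real.exp (-(3 / 4 * ρ) * l1 s)) ∧
        ‖fc (fun ξ => lam ξ 0 - X.2.2.1) s‖ ≤
          C * |ε| * ‖mu0 H₀ D‖ * Real.exp (-(3 / 4 * ρ) * l1 s) ∧
        ‖fc (fun ξ => lam ξ 1 - dotProduct (mu0 H₀ D) (fun j => (t0 H₀ j : ℂ))) s‖ ≤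
          C * |ε| * ‖mu0 H₀ D‖ * Real.exp (-(3 / 4 * ρ) * l1 s) := by
  obtain ⟨C₁, hC₁, ε₁, hε₁, hε₁1, H⟩ := hom_estimate hω hK hρ d C₀
  obtain ⟨C₂, hC₂, G⟩ := sys_estimate (ρ := ρ) (ρ' := 7 / 8 * ρ) (r := 3 / 4 * ρ + 4 * (ρ / 96))
    (δ := ρ / 96) hω H₀ d C₀ (by positivity) (by linarith) (by linarith)
    (by rw [abs_lt]; constructor <;> linarith) (by rw [abs_lt]; constructor <;> linarith)
  rw [add_sub_cancel_right] at G
  obtain ⟨κ, hκ, hinv⟩ := exists_norm_le_of_mulVec hK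
  set τ := ∑ j, ‖(t0 H₀ j : ℂ)‖ with hτ
  have hτ0 : 0 ≤ τ := Finset.sum_nonneg fun _ _ => norm_nonneg _
  -- The one condition `M ε ≤ 1/4` supplies the three smallness conditions used for `b`, `p` and
  -- `m`.
  set M := C₁ * C₁ + C₂ + κ * C₂ with hM
  have hM0 : 0 ≤ M := by positivity
  set C := C₁ * C₁ + (8 * C₂ + (1 + τ) * (8 * (κ * C₂) + C₁ * C₁)) with hC
  refine ⟨C, by positivity, min ε₁ (4 * (M + 1))⁻¹, by positivity,
    fun ε α D hε hD X μ lam χ hF => ?_⟩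
  have hεM : M * |ε| ≤ 1 / 4 := by
    calc M * |ε| ≤ (M + 1) * (4 * (M + 1))⁻¹ := by
          gcongr
          · linarith
          · exact hε.trans (min_le_right _ _)
      _ = 1 / 4 := by field_simp
  have hε0 := abs_nonneg ε
  have s1 : C₁ * C₁ * |ε| ≤ 1 / 4 := by
    refine le_trans ?_ hεM
    gcongr
    rw [hM, add_assoc]
    exact le_add_of_nonneg_right (by positivity)
  have s2 : C₂ * |ε| ≤ 1 / 4 := by
    refine le_trans ?_ hεM
    gcongr
    have := mul_nonneg hκ hC₂
    have := mul_nonneg hC₁ hC₁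
    linarith
  have s3 : κ * C₂ * |ε| ≤ 1 / 4 := by
    refine le_trans ?_ hεM
    gcongr
    exact le_add_of_nonneg_left (by positivity)
  obtain ⟨hX, hb, -⟩ := H ε α 0 D (hε.trans (min_le_left _ _)) ⟨le_rfl, zero_le_one⟩ hD _ _ _ _ _ hF
  set m := X.1
  set p := X.2.1
  set b := X.2.2.1
  have hR : ‖((0, 0, 1, 0) : Cst N)‖ = 1 := by simp [Prod.norm_def]
  rw [hR, mul_one] at hX
  have hb1 : ‖b - 1‖ ≤ C₁ * C₁ * |ε| := by
    rw [norm_sub_rev]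
    refine hb.trans ?_
    calc C₁ * (|ε| * ‖X‖) ≤ C₁ * (|ε| * C₁) := by gcongr
      _ = _ := by ring
  have hb2 : ‖b‖ ≤ 2 := by
    have := norm_sub_norm_le b 1
    rw [norm_one] at this
    linarith
  have hsys := hF.sys.sub_mean_lam
  obtain ⟨g1, g2, g3⟩ := G
    { ε := ε, α := α, D := D, hε := (hε.trans (min_le_left _ _)).trans hε₁1, adm := hD, m := m,
      p := p, r := 0, μ := μ, lam := fun ξ => ![lam ξ 0 - b, lam ξ 1], sys := hsys }
  simp only [zero_sub, norm_neg, Matrix.cons_val_zero, Matrix.cons_val_one] at g1 g2 g3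
  have hm0 := norm_nonneg m
  have hp0 := norm_nonneg p
  -- The residual in the first `λ`-equation is zero, so `p` itself is `O(ε(|m| + |p|))` and can be
  -- absorbed.
  have hpm : ‖p‖ ≤ ‖m‖ := by
    have : C₂ * (|ε| * (‖m‖ + ‖p‖)) ≤ 1 / 4 * (‖m‖ + ‖p‖) := by rw [← mul_assoc]; gcongr
    linarith
  have hZ : C₂ * (|ε| * (‖m‖ + ‖p‖)) ≤ 2 * C₂ * |ε| * ‖m‖ := by
    calc _ ≤ C₂ * (|ε| * (‖m‖ + ‖m‖)) := by gcongr
      _ = _ := by ring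
  set ν := mu0 H₀ D with hν
  have hν0 := norm_nonneg ν
  have hloc := hD.locCoeffs
  -- For the original `λ` this mean vanishes; subtracting `b e₁` leaves `-b` times the mean of the
  -- first row of `T`, the origin of `μ₀`.
  have hchi : ∀ j, mean (chiF D μ (fun ξ => ![lam ξ 0 - b, lam ξ 1]) j) =
      -(b * mean (fun ξ => D.T ξ 0 j)) := by
    intro j
    have e : chiF D μ (fun ξ => ![lam ξ 0 - b, lam ξ 1]) j =
        fun ξ => chiF D μ lam j ξ - b * D.T ξ 0 j := by
      funext ξ
      simp only [chiF, Fin.sum_univ_two, Matrix.cons_val_zero, Matrix.cons_val_one]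
      ring
    have h1 := hF.chi.eqχ j 0
    simp only [fc_zero, dv, Pi.zero_apply, Int.cast_zero, mul_zero, Finset.sum_const_zero,
      Complex.ofReal_zero, zero_mul, neg_zero, zero_add, if_true] at h1
    rw [e, mean_sub (hloc.tc_chiF hρ hF.sys.tcμ hF.sys.tcl j)
      (((hloc.T 0 j).tc hρ).const_mul b), mean_const_mul, h1, zero_sub]
  have hmb : ‖m + b • ν‖ ≤ 2 * (κ * C₂) * |ε| * ‖m‖ := by
    have h1 := hinv (m + b • ν) (2 * C₂ * |ε| * ‖m‖) fun j => by
      rw [Matrix.mulVec_add, Matrix.mulVec_smul, Pi.add_apply, Pi.smul_apply, smul_eq_mul, hν,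
        K0c_mulVec_mu0 hK]
      have h2 := g2 j
      rw [hchi, ← norm_neg] at h2
      refine le_trans (le_of_eq (congrArg norm ?_)) (h2.trans hZ)
      ring
    rw [abs_of_nonneg (by positivity)] at h1
    refine h1.trans (le_of_eq ?_)
    ring
  -- The error in `m ≈ -b μ₀` is at most half of `‖m‖` and `|b| ≤ 2`, so every bound in terms of `m`
  -- becomes one in terms of `μ₀`.
  have hmν : ‖m‖ ≤ 4 * ‖ν‖ := by
    have h1 : ‖m‖ ≤ ‖m + b • ν‖ + ‖b‖ * ‖ν‖ := by
      rw [← norm_smul]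
      have := norm_sub_le (m + b • ν) (b • ν)
      rwa [add_sub_cancel_right] at this
    have h2 : ‖b‖ * ‖ν‖ ≤ 2 * ‖ν‖ := by gcongr
    have h3 : 2 * (κ * C₂) * |ε| * ‖m‖ ≤ 1 / 2 * ‖m‖ := by
      gcongr
      linarith
    linarith
  have hmm : ‖m + ν‖ ≤ (8 * (κ * C₂) + C₁ * C₁) * |ε| * ‖ν‖ := by
    have e : m + ν = (m + b • ν) - (b - 1) • ν := by module
    have h1 : ‖m + ν‖ ≤ ‖m + b • ν‖ + ‖b - 1‖ * ‖ν‖ := by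
      rw [e, ← norm_smul]; exact norm_sub_le _ _
    have h2 : 2 * (κ * C₂) * |ε| * ‖m‖ ≤ 2 * (κ * C₂) * |ε| * (4 * ‖ν‖) := by gcongr
    have h3 : ‖b - 1‖ * ‖ν‖ ≤ C₁ * C₁ * |ε| * ‖ν‖ := by gcongr
    linarith
  have hZ' : C₂ * (|ε| * (‖m‖ + ‖p‖)) ≤ 8 * C₂ * |ε| * ‖ν‖ := by
    refine hZ.trans ?_
    calc _ ≤ 2 * C₂ * |ε| * (4 * ‖ν‖) := by gcongr
      _ = _ := by ring
  set L := 8 * (κ * C₂) + C₁ * C₁ with hL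
  have hL0 : 0 ≤ L := by positivity
  have hcomb : ∀ (q : ℝ), q ≤ (1 + τ) * L * |ε| * ‖ν‖ →
      C₂ * (|ε| * (‖m‖ + ‖p‖)) + q ≤ C * |ε| * ‖ν‖ := by
    intro q hq
    have h1 : 0 ≤ C₁ * C₁ * |ε| * ‖ν‖ := by positivity
    calc _ ≤ 8 * C₂ * |ε| * ‖ν‖ + (1 + τ) * L * |ε| * ‖ν‖ := add_le_add hZ' hq
      _ ≤ C₁ * C₁ * |ε| * ‖ν‖ + (8 * C₂ * |ε| * ‖ν‖ + (1 + τ) * L * |ε| * ‖ν‖) :=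
          le_add_of_nonneg_left h1
      _ = _ := by rw [hC]; ring
  have hLν : 0 ≤ L * |ε| * ‖ν‖ := by positivity
  refine ⟨hb1.trans ?_, fun s => ⟨fun j => ?_, ?_, ?_⟩⟩
  · gcongr
    exact le_add_of_nonneg_right (by positivity)
  · have e : (fun ξ => μ ξ j + ν j) = fun ξ => (μ ξ j - m j) + (m j + ν j) := by
      funext ξ; ring
    rw [e, fc_add ((hF.sys.tcμ j).sub (TC.const _)) (TC.const _)]
    refine (norm_add_le _ _).trans ((add_le_add ((g3 s).1 j)
      (norm_fc_const_le _ (3 / 4 * ρ) s)).trans ?_)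
    rw [← add_mul]
    refine mul_le_mul_of_nonneg_right (hcomb _ ?_) (Real.exp_pos _).le
    refine ((norm_le_pi_norm (m + ν) j).trans hmm).trans ?_
    have := mul_nonneg hτ0 hLν
    linarith
  · refine (g3 s).2.1.trans (mul_le_mul_of_nonneg_right ?_ (Real.exp_pos _).le)
    have := hcomb 0 (by positivity)
    rwa [add_zero] at this
  · have e : (fun ξ => lam ξ 1 - dotProduct ν (fun j => (t0 H₀ j : ℂ))) =
        fun ξ => (lam ξ 1 + ∑ j, (t0 H₀ j : ℂ) * m j) - ∑ j, (t0 H₀ j : ℂ) * (m + ν) j := by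
      funext ξ
      simp only [dotProduct, Pi.add_apply, mul_add, Finset.sum_add_distrib, mul_comm (ν _)]
      ring
    rw [e, fc_sub ((hF.sys.tcl 1).add (TC.const _)) (TC.const _)]
    refine (norm_sub_le _ _).trans ((add_le_add (g3 s).2.2
      (norm_fc_const_le _ (3 / 4 * ρ) s)).trans ?_)
    rw [← add_mul]
    refine mul_le_mul_of_nonneg_right (hcomb _ ?_) (Real.exp_pos _).le
    calc ‖∑ j, (t0 H₀ j : ℂ) * (m + ν) j‖ ≤ ∑ j, ‖(t0 H₀ j : ℂ)‖ * ‖m + ν‖ := by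
          refine (norm_sum_le _ _).trans (Finset.sum_le_sum fun j _ => ?_)
          rw [norm_mul]
          exact mul_le_mul_of_nonneg_left (norm_le_pi_norm _ j) (norm_nonneg _)
      _ = τ * ‖m + ν‖ := by rw [Finset.sum_mul]
      _ ≤ τ * (L * |ε| * ‖ν‖) := by gcongr
      _ ≤ _ := by linarith

end FirstProblem

end

end JacobiTorus

namespace JacobiTorus

noncomputable section

open MeasureTheory Set Filter Topology

variable {N : ℕ}

/-! ### The two problems -/

theorem nrmVec_le_of_decay {ι : Type*} {ρ R A : ℝ} (hρ : 0 < ρ) (hR : ρ < R)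
    {u : (Fin N → ℂ) → ι → ℂ} (hu : MemAVec ρ 0 u)
    (h : ∀ s j, ‖fc (fun ξ => u ξ j) s‖ ≤ A * Real.exp (-R * l1 s)) :
    nrmVec ρ 0 u ≤ ENNReal.ofReal (A * ∑' s : Fin N → ℤ, Real.exp (-(R - ρ) * l1 s)) :=
  iSup_le fun j => nrm_le_of_decay hρ hR (hu j) fun s => h s j

theorem norm_le_vabs (v : Fin N → ℂ) : ‖v‖ ≤ vabs v := by
  refine (pi_norm_le_iff_of_nonneg (Real.sqrt_nonneg _)).2 fun j => Real.le_sqrt_of_sq_le ?_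
  exact Finset.single_le_sum (f := fun j => ‖v j‖ ^ 2) (fun j _ => sq_nonneg _) (Finset.mem_univ j)

section Problems

variable {ω : Fin N → ℝ} {H₀ : (Fin N → ℝ) × ℝ → ℝ} {ρ : ℝ}

/-- Existence and uniqueness for both problems. -/
theorem exists_unique_of_admissible (hω : SmallDiv ω) (hK : (K0 H₀).det ≠ 0) (hρ : 0 < ρ) (d : ℕ)
    (C₀ : ℝ) : ∃ ε₁ : ℝ, 0 < ε₁ ∧ ε₁ ≤ 1 ∧ ∀ ε α k : ℝ, ∀ D : Coeffs N, |ε| ≤ ε₁ →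
      k ∈ Icc (0 : ℝ) 1 → Admissible H₀ ρ d C₀ ε α D → ∀ g₁ g₂, Loc ρ g₁ →
      (∀ a, Loc ρ (fun ξ => g₂ ξ a)) → ∀ γ,
      ∃ X μ lam χ, Full ω k D g₁ g₂ X (0, 0, γ, 0) μ lam χ ∧
        IsSolution ω k D (ρ / 2) g₁ g₂ γ μ lam χ X.2.1 ∧
        ∀ μ' lam' χ' p', IsSolution ω k D (ρ / 2) g₁ g₂ γ μ' lam' χ' p' →
          EqOn μ' μ (strip (ρ / 2)) ∧ EqOn lam' lam (strip (ρ / 2)) ∧ EqOn χ' χ (strip (ρ / 2)) ∧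
            p' = X.2.1 := by
  obtain ⟨C, hC, ε₁, hε₁, hε₁1, H⟩ := hom_estimate hω hK hρ d C₀
  refine ⟨ε₁, hε₁, hε₁1, fun ε α k D hε hk hD g₁ g₂ hg₁ hg₂ γ => ?_⟩
  refine exists_unique_solution (C := C) hω hk.1 (half_pos hρ) (half_lt_self hρ) hD.locCoeffs hg₁ hg₂
    (fun X R μ lam χ hF => ?_) γ
  obtain ⟨h1, -, h2⟩ := H ε α k D hε hk hD X R μ lam χ hF
  have h3 : ∀ s : Fin N → ℤ, C * ‖X‖ * Real.exp (-(3 / 4 * ρ) * l1 s) ≤ C * ‖X‖ := fun s => by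
    refine mul_le_of_le_one_right (by positivity) (Real.exp_le_one_iff.2 ?_)
    have := mul_nonneg hρ.le (l1_nonneg s)
    linarith
  exact ⟨h1, fun s => ⟨fun j => ((h2 s).1 j).trans (h3 s), fun j => ((h2 s).2.1 j).trans (h3 s),
    fun j => ((h2 s).2.2 j).trans (h3 s)⟩⟩

/-- The surplus `3ρ/4 - ρ/2` of decay over the half-width of the strip makes the series of suprema
converge to a constant depending only on `ρ` and the dimension. -/
theorem solution_norm_le {ω : Fin N → ℝ} {k : ℝ} {D : Coeffs N} {g₁ : (Fin N → ℂ) → ℂ}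
    {g₂ : (Fin N → ℂ) → (Fin 2 → ℂ)} {X : Cst N} {γ : ℂ} {μ : (Fin N → ℂ) → (Fin N → ℂ)}
    {lam : (Fin N → ℂ) → (Fin 2 → ℂ)} {χ : (Fin N → ℂ) → (Fin N → ℂ)} (hρ : 0 < ρ)
    (hs : IsSolution ω k D (ρ / 2) g₁ g₂ γ μ lam χ X.2.1) {C A : ℝ} (hC : 0 ≤ C) (hA : 0 ≤ A)
    (hX : ‖X‖ ≤ C * A)
    (h : ∀ s, (∀ j, ‖fc (fun ξ => μ ξ j) s‖ ≤ C * A * Real.exp (-(3 / 4 * ρ) * l1 s)) ∧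
      (∀ a, ‖fc (fun ξ => lam ξ a) s‖ ≤ C * A * Real.exp (-(3 / 4 * ρ) * l1 s)) ∧
      ∀ j, ‖fc (fun ξ => χ ξ j) s‖ ≤ C * A * Real.exp (-(3 / 4 * ρ) * l1 s)) :
    nrmVec (ρ / 2) 0 μ + nrmVec (ρ / 2) 0 lam + nrmVec (ρ / 2) 0 χ + ENNReal.ofReal ‖X.2.1‖ ≤
      ENNReal.ofReal (C * (3 * ∑' s : Fin N → ℤ, Real.exp (-(3 / 4 * ρ - ρ / 2) * l1 s) + 1) * A) := by
  have hρ2 : 0 < ρ / 2 := half_pos hρ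
  have hR : ρ / 2 < 3 / 4 * ρ := by linarith
  have hS : 0 ≤ ∑' s : Fin N → ℤ, Real.exp (-(3 / 4 * ρ - ρ / 2) * l1 s) :=
    tsum_nonneg fun _ => (Real.exp_pos _).le
  have h1 := nrmVec_le_of_decay hρ2 hR hs.mem_μ fun s => (h s).1
  have h2 := nrmVec_le_of_decay hρ2 hR hs.mem_lam fun s => (h s).2.1
  have h3 := nrmVec_le_of_decay hρ2 hR hs.mem_χ fun s => (h s).2.2
  have h4 : ENNReal.ofReal ‖X.2.1‖ ≤ ENNReal.ofReal (C * A) :=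
    ENNReal.ofReal_le_ofReal (((norm_fst_le _).trans (norm_snd_le X)).trans hX)
  refine (add_le_add (add_le_add (add_le_add h1 h2) h3) h4).trans ?_
  rw [← ENNReal.ofReal_add (by positivity) (by positivity),
    ← ENNReal.ofReal_add (by positivity) (by positivity),
    ← ENNReal.ofReal_add (by positivity) (by positivity)]
  refine ENNReal.ofReal_le_ofReal (le_of_eq ?_)
  ring

/-- Every `c ≥ c₁` is admitted so that both problems can share one constant, which enters once
through its inverse. -/
theorem second_problem (hω : SmallDiv ω) (hK : (K0 H₀).det ≠ 0) (hρ : 0 < ρ) (d : ℕ) (C₀ : ℝ) :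
    ∃ c₁ : ℝ, 0 < c₁ ∧ ∃ ε₁ : ℝ, 0 < ε₁ ∧ ∀ c, c₁ ≤ c → ∀ ε₀ : ℝ, ε₀ ≤ ε₁ → ∀ ε : ℝ, |ε| ≤ ε₀ →
      ∀ α k : ℝ, k ∈ Icc (0 : ℝ) 1 → ∀ D : Coeffs N, Admissible H₀ ρ d C₀ ε α D →
      ∃ μ lam χ p, IsSolution₂ ω k D (ρ / 2) μ lam χ p ∧
        (∀ μ' lam' χ' p', IsSolution₂ ω k D (ρ / 2) μ' lam' χ' p' →
          EqOn μ' μ (strip (ρ / 2)) ∧ EqOn lam' lam (strip (ρ / 2)) ∧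
            EqOn χ' χ (strip (ρ / 2)) ∧ p' = p) ∧
        nrmVec (ρ / 2) 0 μ + nrmVec (ρ / 2) 0 lam + nrmVec (ρ / 2) 0 χ + ENNReal.ofReal ‖p‖ ≤
          ENNReal.ofReal c * nrm ρ 0 (dev D.w₁) ∧
        nrm ρ 0 (dev D.w₁) ≤ ENNReal.ofReal (c * |ε|) ∧
        sobVec 0 μ ≤ ENNReal.ofReal (c * ε₀) * sob (-1) (dev D.w₁) ∧
        ENNReal.ofReal c⁻¹ * sob (-1) (dev D.w₁) ≤
          sob 0 (fun ξ => lam ξ 1) + ENNReal.ofReal |k| * sob 0 (fun ξ => lam ξ 0) := by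
  obtain ⟨ε₂, hε₂, hε₂1, hex⟩ := exists_unique_of_admissible hω hK hρ d C₀
  obtain ⟨C₃, hC₃, ε₃, hε₃, h3⟩ := src_strong_estimate hω hK hρ d C₀
  obtain ⟨C₄, hC₄, ε₄, hε₄, h4⟩ := src_sob_estimate hω hK hρ d C₀
  set S := ∑' s : Fin N → ℤ, Real.exp (-(3 / 4 * ρ - ρ / 2) * l1 s) with hSdef
  have hS : 0 ≤ S := tsum_nonneg fun _ => (Real.exp_pos _).le
  refine ⟨C₃ * (3 * S + 1) + 2 * |C₀| + C₄ + 1, by positivity, min ε₂ (min ε₃ ε₄), by positivity,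
    fun c hc ε₀ hε₀ ε hε α k hk D hD => ?_⟩
  have q1 : 0 ≤ C₃ * (3 * S + 1) := by positivity
  have q2 := abs_nonneg C₀
  have hc0 : 0 < c := by linarith
  have hε2 : |ε| ≤ ε₂ := (hε.trans hε₀).trans (min_le_left _ _)
  have hε3 : |ε| ≤ ε₃ := (hε.trans hε₀).trans ((min_le_right _ _).trans (min_le_left _ _))
  have hε4 : |ε| ≤ ε₄ := (hε.trans hε₀).trans ((min_le_right _ _).trans (min_le_right _ _))
  obtain ⟨X, μ, lam, χ, hF, hsol, huniq⟩ := hex ε α k D hε2 hk hD (src₁ D) (src₂ D)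
    hD.locCoeffs.src₁ hD.locCoeffs.src₂ 0
  obtain ⟨e1, e2⟩ := h3
    { ε := ε, α := α, D := D, hε := hε2.trans hε₂1, adm := hD, hε₁ := hε3, k := k, hk := hk,
      X := X, μ := μ, lam := lam, χ := χ, full := hF }
  obtain ⟨e3, e4⟩ := h4
    { ε := ε, α := α, D := D, hε := hε2.trans hε₂1, adm := hD, hε₁ := hε4, k := k, hk := hk,
      X := X, μ := μ, lam := lam, χ := χ, full := hF }
  refine ⟨μ, lam, χ, X.2.1, hsol, huniq, ?_, ?_, ?_, ?_⟩
  · refine (solution_norm_le hρ hsol hC₃ ENNReal.toReal_nonneg e1 e2).trans ?_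
    rw [ENNReal.ofReal_mul q1, ENNReal.ofReal_toReal (hD.memA_dev hρ).finite.ne]
    gcongr
    linarith
  · refine (hD.nrm_dev_le hρ).trans (ENNReal.ofReal_le_ofReal ?_)
    gcongr
    linarith
  · refine e3.trans ?_
    gcongr
    linarith
  · calc ENNReal.ofReal c⁻¹ * sob (-1) (dev D.w₁) ≤ ENNReal.ofReal c⁻¹ * (ENNReal.ofReal c *
          (sob 0 (fun ξ => lam ξ 1) + ENNReal.ofReal |k| * sob 0 (fun ξ => lam ξ 0))) := by
          refine mul_le_mul_right (e4.trans ?_) _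
          gcongr
          linarith
      _ = _ := by
          rw [← mul_assoc, ← ENNReal.ofReal_mul (by positivity), inv_mul_cancel₀ hc0.ne',
            ENNReal.ofReal_one, one_mul]

theorem first_problem (hω : SmallDiv ω) (hK : (K0 H₀).det ≠ 0) (hρ : 0 < ρ) (d : ℕ) (C₀ : ℝ) :
    ∃ c₁ : ℝ, 0 < c₁ ∧ ∃ ε₁ : ℝ, 0 < ε₁ ∧ ∀ c, c₁ ≤ c → ∀ ε : ℝ, |ε| ≤ ε₁ →
      ∀ α k : ℝ, k ∈ Icc (0 : ℝ) 1 → ∀ D : Coeffs N, Admissible H₀ ρ d C₀ ε α D →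
      ∃ μ lam χ p, IsSolution₁ ω k D (ρ / 2) μ lam χ p ∧
        (∀ μ' lam' χ' p', IsSolution₁ ω k D (ρ / 2) μ' lam' χ' p' →
          EqOn μ' μ (strip (ρ / 2)) ∧ EqOn lam' lam (strip (ρ / 2)) ∧
            EqOn χ' χ (strip (ρ / 2)) ∧ p' = p) ∧
        nrmVec (ρ / 2) 0 μ + nrmVec (ρ / 2) 0 lam + nrmVec (ρ / 2) 0 χ + ENNReal.ofReal ‖p‖ ≤
          ENNReal.ofReal c ∧
        (k = 0 → ∃ (C : ℂ) (με : (Fin N → ℂ) → (Fin N → ℂ)) (lamε : (Fin N → ℂ) → (Fin 2 → ℂ)),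
          (∀ ξ ∈ strip (ρ / 2), μ ξ = -mu0 H₀ D + με ξ) ∧
          (∀ ξ ∈ strip (ρ / 2),
            lam ξ = C • e₁ + dotProduct (mu0 H₀ D) (fun j => (t0 H₀ j : ℂ)) • e₂ + lamε ξ) ∧
          ‖C - 1‖ ≤ c * |ε| ∧
          nrmVec (ρ / 2) 0 με + nrmVec (ρ / 2) 0 lamε ≤
            ENNReal.ofReal (c * |ε| * vabs (mu0 H₀ D))) := by
  obtain ⟨ε₂, hε₂, -, hex⟩ := exists_unique_of_admissible hω hK hρ d C₀
  obtain ⟨C₃, hC₃, ε₃, hε₃, -, h3⟩ := hom_estimate hω hK hρ d C₀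
  obtain ⟨C₄, hC₄, ε₄, hε₄, h4⟩ := first_problem_k_zero hω hK hρ d C₀
  set S := ∑' s : Fin N → ℤ, Real.exp (-(3 / 4 * ρ - ρ / 2) * l1 s) with hSdef
  have hS : 0 ≤ S := tsum_nonneg fun _ => (Real.exp_pos _).le
  set C₅ := C₃ + C₃ * C₃ with hC₅
  have hC₅0 : 0 ≤ C₅ := by positivity
  refine ⟨C₅ * (3 * S + 1) + C₄ * (1 + 2 * S) + 1, by positivity, min ε₂ (min ε₃ ε₄),
    by positivity, fun c hc ε hε α k hk D hD => ?_⟩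
  have q1 : 0 ≤ C₅ * (3 * S + 1) := by positivity
  have q2 : 0 ≤ C₄ * (1 + 2 * S) := by positivity
  have q3 := mul_nonneg hC₄ hS
  have hc0 : 0 < c := by linarith
  have hε2 : |ε| ≤ ε₂ := hε.trans (min_le_left _ _)
  have hε3 : |ε| ≤ ε₃ := hε.trans ((min_le_right _ _).trans (min_le_left _ _))
  have hε4 : |ε| ≤ ε₄ := hε.trans ((min_le_right _ _).trans (min_le_right _ _))
  obtain ⟨X, μ, lam, χ, hF, hsol, huniq⟩ := hex ε α k D hε2 hk hD (fun _ => 0) (fun _ _ => 0)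
    (Loc.const 0) (fun _ => Loc.const 0) 1
  obtain ⟨e1, -, e3⟩ := h3 ε α k D hε3 hk hD _ _ _ _ _ hF
  have hR : ‖((0, 0, 1, 0) : Cst N)‖ = 1 := by simp [Prod.norm_def]
  rw [hR, mul_one] at e1
  have e4 : C₃ * ‖X‖ ≤ C₅ * 1 := by
    have := mul_le_mul_of_nonneg_left e1 hC₃
    rw [mul_one, hC₅]
    linarith
  refine ⟨μ, lam, χ, X.2.1, hsol, huniq, ?_, fun hk0 => ?_⟩
  · refine (solution_norm_le hρ hsol hC₅0 zero_le_one ?_ fun s => ⟨fun j =>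
      ((e3 s).1 j).trans ?_, fun j => ((e3 s).2.1 j).trans ?_,
      fun j => ((e3 s).2.2 j).trans ?_⟩).trans (ENNReal.ofReal_le_ofReal ?_)
    · rw [mul_one, hC₅]
      have := mul_nonneg hC₃ hC₃
      linarith
    · gcongr
    · gcongr
    · gcongr
    · rw [mul_one]
      linarith
  · subst hk0
    obtain ⟨f1, f2⟩ := h4 ε α D hε4 hD X μ lam χ hF
    set ν := mu0 H₀ D with hν
    set b := X.2.2.1
    refine ⟨b, fun ξ j => μ ξ j + ν j,
      fun ξ => ![lam ξ 0 - b, lam ξ 1 - dotProduct ν (fun j => (t0 H₀ j : ℂ))],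
      fun ξ _ => ?_, fun ξ _ => ?_, f1.trans ?_, ?_⟩
    · funext j
      simp
    · funext a
      fin_cases a <;> simp [e₁, e₂]
    · gcongr
      linarith
    · have hρ2 : 0 < ρ / 2 := half_pos hρ
      have hlt : ρ / 2 < 3 / 4 * ρ := by linarith
      have g1 := nrmVec_le_of_decay hρ2 hlt (u := fun ξ j => μ ξ j + ν j)
        (fun j => (hsol.mem_μ j).add (MemA.const _)) fun s => (f2 s).1
      have g2 := nrmVec_le_of_decay hρ2 hlt
        (u := fun ξ => ![lam ξ 0 - b, lam ξ 1 - dotProduct ν (fun j => (t0 H₀ j : ℂ))])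
        (A := C₄ * |ε| * ‖ν‖)
        (fun a => by
          fin_cases a
          · exact (hsol.mem_lam 0).sub (MemA.const _)
          · exact (hsol.mem_lam 1).sub (MemA.const _))
        (fun s a => by
          fin_cases a
          · exact (f2 s).2.1
          · exact (f2 s).2.2)
      refine (add_le_add g1 g2).trans ?_
      rw [← ENNReal.ofReal_add (by positivity) (by positivity)]
      refine ENNReal.ofReal_le_ofReal ?_
      have h5 := norm_le_vabs ν
      calc _ = (2 * (C₄ * S)) * |ε| * ‖ν‖ := by ring
        _ ≤ c * |ε| * vabs ν := by
            gcongr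
            linarith

end Problems

end

end JacobiTorus

theorem mainTheorem12 (n : ℕ) (hn : 2 ≤ n) (ϱ : ℝ) (hϱ : 0 < ϱ)
    (ω : Fin (n - 1) → ℝ) (c₀ : ℝ) (hω : Diophantine n ω c₀)
    (H₀ : (Fin (n - 1) → ℝ) × ℝ → ℝ) (hH₀ : AnalyticAt ℝ H₀ 0)
    (hH₀y : ∀ j, fderiv ℝ H₀ 0 (Pi.single j 1, 0) = ω j)
    (hH₀z : fderiv ℝ H₀ 0 (0, 1) = 0)
    (hK₀ : (K0 H₀).det ≠ 0)
    (σ : ℝ) (hσ : σ ∈ Set.Ioc (1 / 2 : ℝ) 1) (d : ℕ) (hd : 2 ≤ d) (C₀ : ℝ) :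
    ∃ c : ℝ, 0 < c ∧ ∃ ε₁ : ℝ, 0 < ε₁ ∧
      ∀ ε₀ : ℝ, 0 < ε₀ → ε₀ ≤ ε₁ → ∀ ε : ℝ, |ε| ≤ ε₀ →
      ∀ α k : ℝ, k ∈ Set.Icc (0 : ℝ) 1 →
      ∀ D : Coeffs (n - 1), Admissible H₀ (σ / 2 * ϱ) d C₀ ε α D →
        (∃ (μ : (Fin (n - 1) → ℂ) → (Fin (n - 1) → ℂ)) (lam : (Fin (n - 1) → ℂ) → (Fin 2 → ℂ))
            (χ : (Fin (n - 1) → ℂ) → (Fin (n - 1) → ℂ)) (p : ℂ),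
          IsSolution₂ ω k D (σ / 4 * ϱ) μ lam χ p ∧
          (∀ μ' lam' χ' p', IsSolution₂ ω k D (σ / 4 * ϱ) μ' lam' χ' p' →
            Set.EqOn μ' μ (strip (σ / 4 * ϱ)) ∧ Set.EqOn lam' lam (strip (σ / 4 * ϱ)) ∧
            Set.EqOn χ' χ (strip (σ / 4 * ϱ)) ∧ p' = p) ∧
          nrmVec (σ / 4 * ϱ) 0 μ + nrmVec (σ / 4 * ϱ) 0 lam + nrmVec (σ / 4 * ϱ) 0 χ
              + ENNReal.ofReal ‖p‖
            ≤ ENNReal.ofReal c * nrm (σ / 2 * ϱ) 0 (dev D.w₁) ∧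
          nrm (σ / 2 * ϱ) 0 (dev D.w₁) ≤ ENNReal.ofReal (c * |ε|) ∧
          sobVec 0 μ ≤ ENNReal.ofReal (c * ε₀) * sob (-1) (dev D.w₁) ∧
          ENNReal.ofReal c⁻¹ * sob (-1) (dev D.w₁)
            ≤ sob 0 (fun ξ => lam ξ 1) + ENNReal.ofReal |k| * sob 0 (fun ξ => lam ξ 0)) ∧
        (∃ (μ : (Fin (n - 1) → ℂ) → (Fin (n - 1) → ℂ)) (lam : (Fin (n - 1) → ℂ) → (Fin 2 → ℂ))
            (χ : (Fin (n - 1) → ℂ) → (Fin (n - 1) → ℂ)) (p : ℂ),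
          IsSolution₁ ω k D (σ / 4 * ϱ) μ lam χ p ∧
          (∀ μ' lam' χ' p', IsSolution₁ ω k D (σ / 4 * ϱ) μ' lam' χ' p' →
            Set.EqOn μ' μ (strip (σ / 4 * ϱ)) ∧ Set.EqOn lam' lam (strip (σ / 4 * ϱ)) ∧
            Set.EqOn χ' χ (strip (σ / 4 * ϱ)) ∧ p' = p) ∧
          nrmVec (σ / 4 * ϱ) 0 μ + nrmVec (σ / 4 * ϱ) 0 lam + nrmVec (σ / 4 * ϱ) 0 χ
              + ENNReal.ofReal ‖p‖ ≤ ENNReal.ofReal c ∧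
          (k = 0 →
            ∃ (C : ℂ) (με : (Fin (n - 1) → ℂ) → (Fin (n - 1) → ℂ))
              (lamε : (Fin (n - 1) → ℂ) → (Fin 2 → ℂ)),
              (∀ ξ ∈ strip (σ / 4 * ϱ), μ ξ = - mu0 H₀ D + με ξ) ∧
              (∀ ξ ∈ strip (σ / 4 * ϱ),
                lam ξ = C • e₁ + dotProduct (mu0 H₀ D) (fun j => (t0 H₀ j : ℂ)) • e₂ + lamε ξ) ∧
              ‖C - 1‖ ≤ c * |ε| ∧
              nrmVec (σ / 4 * ϱ) 0 με + nrmVec (σ / 4 * ϱ) 0 lamε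
                ≤ ENNReal.ofReal (c * |ε| * vabs (mu0 H₀ D)))) := by
  have hsd := hω.smallDiv
  have hρ : 0 < σ / 2 * ϱ := mul_pos (by linarith [hσ.1]) hϱ
  -- The coefficients live on the strip of half-width `ρ = σϱ/2`, and the solutions on its half.
  have hhalf : σ / 4 * ϱ = σ / 2 * ϱ / 2 := by ring
  obtain ⟨c₁, hc₁, ε₁, hε₁, h1⟩ := first_problem hsd hK₀ hρ d C₀
  obtain ⟨c₂, hc₂, ε₂, hε₂, h2⟩ := second_problem hsd hK₀ hρ d C₀
  rw [hhalf]
  exact ⟨max c₁ c₂, lt_max_of_lt_left hc₁, min ε₁ ε₂, lt_min hε₁ hε₂,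
    fun ε₀ _ hε₀ ε hε α k hk D hD =>
      ⟨h2 _ (le_max_right _ _) ε₀ (hε₀.trans (min_le_right _ _)) ε hε α k hk D hD,
        h1 _ (le_max_left _ _) ε ((hε.trans hε₀).trans (min_le_left _ _)) α k hk D hD⟩⟩
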